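/- Let $n,p$ be integers with $1\le p\le n$, let $\Omega\subset\mathbb R^n$ be a bounded domain and let $f=f(x,z,\nu)$ be a positive smooth function on $\Omega\times\mathbb R\times\mathbb S^n$. For a $C^2$ function $u$ on $\Omega$ let $M_u=\{(x,u(x)):x\in\Omega\}$ be its graph, with upward unit normal $\nu=(-Du,1)/w$, $w=\sqrt{1+|Du|^2}$, induced metric $g_{ij}=\delta_{ij}+u_iu_j$, second fundamental form $h_{ij}=u_{ij}/w$ and principal curvatures $\kappa_1,\dots,\kappa_n$ (the eigenvalues of $h_{ij}$ with respect to $g_{ij}$); call $u$ admissible if $\kappa_{i_1}+\dots+\kappa_{i_p}\ge 0$ for all $i_1<\dots<i_p$ at every point of $\Omega$. Suppose that $u\in C^4(\Omega)\cap C^2(\bar\Omega)$ is an admissible solution of $$\prod_{1\le i_1<\dots<i_p\le n}(\kappa_{i_1}+\dots+\kappa_{i_p})=f(x,u,\nu)\ \text{ in }\Omega,\qquad u=0\ \text{ on }\partial\Omega,$$ and that either $p\ge n/2$, or $f$ does not depend on $\nu$. Then $u<0$ in $\Omega$ and $$\sup_{\Omega}\,(-u)^\beta\,|h|\le C,$$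 where $|h|$ is the norm of $h$ with respect to $g$, $|h|^2=g^{ik}g^{jl}h_{ij}h_{kl}$, and $C,\beta>0$ depend only on $n$, $p$, an upper bound $M$ for $|u|_{C^1(\Omega)}$, a positive lower bound for $\tilde f=f^{1/\binom np}$ on $\Omega\times[-M,M]\times\mathbb S^n$, and an upper bound for $|f|_{C^2}$ on $\Omega\times[-M,M]\times\mathbb S^n$. -/

import Mathlib

open scoped ContDiff

/-- Euclidean space `ℝⁿ`. -/
abbrev Eucl (n : ℕ) : Type := EuclideanSpace ℝ (Fin n)

/-- The space of triples `(x, z, ν) ∈ ℝⁿ × ℝ × ℝⁿ⁺¹` on which the right-hand side lives. -/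
abbrev RhsSpace (n : ℕ) : Type := Eucl n × ℝ × Eucl (n + 1)

/-- A bounded domain: a nonempty, connected, bounded open set. -/
structure IsBoundedDomain {n : ℕ} (Ω : Set (Eucl n)) : Prop where
  isOpen : IsOpen Ω
  isConnected : IsConnected Ω
  isBounded : Bornology.IsBounded Ω

/-- `u ∈ C^k(Ω̄)` for an open set `Ω`: `u` is `C^k` in `Ω`, continuous on `Ω̄`, and all its
derivatives of order at most `k` extend continuously from `Ω` to `Ω̄`. -/
structure IsCkUpToBoundary {n : ℕ} (k : ℕ) (u : Eucl n → ℝ) (Ω : Set (Eucl n)) : Prop where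
  contDiffOn : ContDiffOn ℝ k u Ω
  continuousOn : ContinuousOn u (closure Ω)
  extends_deriv : ∀ j ≤ k, ∃ g : Eucl n → ContinuousMultilinearMap ℝ (fun _ : Fin j => Eucl n) ℝ,
    ContinuousOn g (closure Ω) ∧ Set.EqOn g (iteratedFDeriv ℝ j u) Ω

/-- `|g|_{C^k} ≤ M` on the set `S`: all derivatives of `g` of order at most `k` (the value of `g`
included) are bounded by `M` at the points of `S`. -/
def CkNormLE {V : Type*} [NormedAddCommGroup V] [NormedSpace ℝ V]
    (k : ℕ) (g : V → ℝ) (S : Set V) (M : ℝ) : Prop :=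
  ∀ j ≤ k, ∀ y ∈ S, ‖iteratedFDeriv ℝ j g y‖ ≤ M

/-- The unit sphere `𝕊ⁿ ⊂ ℝⁿ⁺¹`. -/
def unitSphere (n : ℕ) : Set (Eucl (n + 1)) := Metric.sphere 0 1

/-- The set `Ω × [-M, M] × 𝕊ⁿ`. -/
def rhsRange {n : ℕ} (Ω : Set (Eucl n)) (M : ℝ) : Set (RhsSpace n) :=
  Ω ×ˢ (Set.Icc (-M) M ×ˢ unitSphere n)

namespace GraphSurface

variable {n : ℕ}

/-- The first partial derivative `u_i`. -/
noncomputable def pd (u : Eucl n → ℝ) (x : Eucl n) (i : Fin n) : ℝ :=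
  fderiv ℝ u x (EuclideanSpace.single i 1)

/-- The second partial derivative `u_{ij}`. -/
noncomputable def pd2 (u : Eucl n → ℝ) (x : Eucl n) (i j : Fin n) : ℝ :=
  fderiv ℝ (fderiv ℝ u) x (EuclideanSpace.single i 1) (EuclideanSpace.single j 1)

/-- `w = √(1 + |Du|²)`. -/
noncomputable def areaFactor (u : Eucl n → ℝ) (x : Eucl n) : ℝ :=
  Real.sqrt (1 + ∑ i, pd u x i ^ 2)

/-- The upward unit normal `ν = (-Du, 1) / w` of the graph of `u` at `(x, u(x))`. -/
noncomputable def normal (u : Eucl n → ℝ) (x : Eucl n) : Eucl (n + 1) :=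
  WithLp.toLp 2 (Fin.snoc (α := fun _ => ℝ) (fun i => -pd u x i / areaFactor u x) (1 / areaFactor u x))

/-- The induced metric `g_{ij} = δ_{ij} + u_i u_j`. -/
noncomputable def metric (u : Eucl n → ℝ) (x : Eucl n) : Matrix (Fin n) (Fin n) ℝ :=
  Matrix.of fun i j => (if i = j then 1 else 0) + pd u x i * pd u x j

/-- The second fundamental form `h_{ij} = u_{ij} / w`. -/
noncomputable def secondForm (u : Eucl n → ℝ) (x : Eucl n) : Matrix (Fin n) (Fin n) ℝ :=
  Matrix.of fun i j => pd2 u x i j / areaFactor u x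

/-- The norm of the second fundamental form with respect to the induced metric,
`|h|² = g^{ik} g^{jl} h_{ij} h_{kl}`, where `g^{ij}` is the inverse of `g_{ij}`. -/
noncomputable def secondFormNorm (u : Eucl n → ℝ) (x : Eucl n) : ℝ :=
  Real.sqrt (∑ i, ∑ j, ∑ k, ∑ l,
    (metric u x)⁻¹ i k * (metric u x)⁻¹ j l * secondForm u x i j * secondForm u x k l)

/-- The principal curvatures `κ₁, …, κₙ` of the graph of `u` at `(x, u(x))`: the eigenvalues,
with multiplicity, of `h_{ij}` with respect to `g_{ij}`. -/
noncomputable def principalCurvatures (u : Eucl n → ℝ) (x : Eucl n) : Multiset ℝ :=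
  ((metric u x)⁻¹ * secondForm u x).charpoly.roots

/-- The curvature function `∏_{i₁ < ⋯ < i_p} (κ_{i₁} + ⋯ + κ_{i_p})`. -/
noncomputable def curvatureProd (p : ℕ) (u : Eucl n → ℝ) (x : Eucl n) : ℝ :=
  (((principalCurvatures u x).powersetCard p).map Multiset.sum).prod

/-- `u` is admissible in `Ω`: its graph is `p`-convex, i.e. `κ_{i₁} + ⋯ + κ_{i_p} ≥ 0` for all
`i₁ < ⋯ < i_p` at every point. (Where `curvatureProd p u` is positive, all these sums are then
strictly positive.) -/
def IsAdmissible (p : ℕ) (u : Eucl n → ℝ) (Ω : Set (Eucl n)) : Prop :=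
  ∀ x ∈ Ω, ∀ s ∈ (principalCurvatures u x).powersetCard p, 0 ≤ s.sum

end GraphSurface

/-!
# Interior curvature estimates for `p`-convex graphs with vanishing boundary values

The estimate comes from the maximum principle. Write `λ_I = ∑_{i ∈ I} κ_i` for the `p`-element sets
`I` of indices, `F_k = ∑_{I ∋ k} 1 / λ_I` for the derivatives of `∑ log λ_I` in the principal
curvatures, and `K` for the largest curvature. At an interior maximum of
`log (normal curvature) + β log (-u - t / 2) - log (1 / w - a) + B exp (3 ψ / ρ)` the first-order
conditions express the derivatives of `K`, and the second-order conditions, weighted with the `F_k`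
and summed, are compared with the twice differentiated equation.

*The two-point term.* Here `ψ(x, x') = u x' - |x - x'|² / (2 ρ)`, and the maximum is taken over `x'`
as well: `ψ` is the kernel of a sup-convolution of `u` at the scale `ρ` of the height. It provides a
first-order quantity which is Lipschitz, and whose second derivatives at the maximum are
those of `u` at the other point `x'`, transported by an isometry between the two tangent planes.
At `x'` they are at most `1 / ρ`, while their `p`-sums are positive, by admissibility, with product
bounded below, by the equation. This is `IsTestMax.second_point_sums`.

*Computation at the maximum.* The surface is described as a graph over its tangent plane, so that
the quantities in question have explicit second-order expansions (`Jet2`) along the coordinate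
lines. Since only expansions along lines are used, derivatives of eigenvalues never occur: the test
vector turns along the line (`IsTestMax.variation_basis`), and the equation enters as the inequality
`log ∏ λ_I ≤ ∑_I log ∑_{i ∈ I} h(e_i, e_i)` for orthonormal frames (`IsPrincipalFrame.schur`, from
Birkhoff's theorem) applied to a turning frame (`IsNormalGraph.second_variation_opt`). Both turns are
chosen to give the squares of third derivatives which dominate the first-order terms.

*The gradient terms.* For the indices with `κ_k ≥ -θ K` these squares dominate once `β` is
large compared with `B` (`absorb_good`); the remaining indices contribute `-C / height²`, which is
absorbed by `F_k κ_k²` when `K · height` is large (`absorb_bad`). There remains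
`3/4 K N + (a/2) ∑ F_k κ_k² + (3 E / ρ) ∑_I μ_I / λ_I ≤ C₁ K`, where `N` is the number of the sets
`I`, `E` is the value of `B exp (3 ψ / ρ)` and the `μ_I` are the `p`-sums at `x'`; the right-hand
side is bounded by a constant if the prescribed function does not depend on the normal
(`IsTestMax.reduced`).

*The conclusion* (`exists_bound_at_testMax`). Without dependence on the normal, the first term
bounds `K`. Otherwise, if some curvature is below `-θ K`, or if `p = n`, the second term is of order
`K²`. If all curvatures are at least `-θ K` and `p < n`, the sums `λ_I` with `I` containing the top
index are at least `K / 2`, and the product of all is bounded, so the others are small; for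
`n ≤ 2 p` the former are the majority, and comparison of the products of the `λ_I` and of the `μ_I`
shows that some quotient `μ_I / λ_I` is at least a multiple of `K ρ`
(`le_sum_div_of_nearly_nonneg`). As `E` can be made large, the third term wins. So
`K · height` is bounded at the maximum.

*Localisation.* The two-point term needs the height `-u` to be comparable to a fixed `t` near the
maximum. Therefore `t` is the height at a point which maximises the curvature times a much higher
power of the height (`exists_isTestMax`); this higher power is the exponent in the theorem.
-/

open scoped ContDiff RealInnerProductSpace
open Filter Topology

/-! ### Second-order expansions of curves -/

section Jets

variable {E F G : Type*} [NormedAddCommGroup E] [NormedSpace ℝ E]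
  [NormedAddCommGroup F] [NormedSpace ℝ F] [NormedAddCommGroup G] [NormedSpace ℝ G]

/-- The curve `f` has the second-order expansion `f τ = a + τ b + τ² c + o(τ²)` at `τ = 0`.
The coefficient `c` is half the second derivative. -/
def Jet2 (f : ℝ → E) (a b c : E) : Prop :=
  (fun τ : ℝ => f τ - (a + τ • b + τ ^ 2 • c)) =o[𝓝 0] fun τ : ℝ => τ ^ 2

namespace Jet2

theorem congr {f g : ℝ → E} {a b c : E} (h : Jet2 f a b c) (hfg : f =ᶠ[𝓝 0] g) :
    Jet2 g a b c := by
  refine Asymptotics.IsLittleO.congr' h ?_ EventuallyEq.rfl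
  filter_upwards [hfg] with τ hτ
  rw [hτ]

theorem quad (a b c : E) : Jet2 (fun τ => a + τ • b + τ ^ 2 • c) a b c := by
  simp [Jet2]

theorem line (a b : E) : Jet2 (fun τ => a + τ • b) a b 0 := by
  simp [Jet2]

theorem const (a : E) : Jet2 (fun _ => a) a 0 0 := by
  simp [Jet2]

theorem add {f g : ℝ → E} {a b c a' b' c' : E} (hf : Jet2 f a b c) (hg : Jet2 g a' b' c') :
    Jet2 (fun τ => f τ + g τ) (a + a') (b + b') (c + c') := by
  refine (Asymptotics.IsLittleO.add hf hg).congr_left fun τ => ?_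
  simp only [smul_add]
  abel

theorem clm {f : ℝ → E} {a b c : E} (hf : Jet2 f a b c) (L : E →L[ℝ] F) :
    Jet2 (fun τ => L (f τ)) (L a) (L b) (L c) := by
  refine ((L.isBigO_comp _ _).trans_isLittleO hf).congr_left fun τ => ?_
  simp

theorem neg {f : ℝ → E} {a b c : E} (hf : Jet2 f a b c) :
    Jet2 (fun τ => -f τ) (-a) (-b) (-c) := by
  simpa using hf.clm (-ContinuousLinearMap.id ℝ E)

theorem sub {f g : ℝ → E} {a b c a' b' c' : E} (hf : Jet2 f a b c) (hg : Jet2 g a' b' c') :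
    Jet2 (fun τ => f τ - g τ) (a - a') (b - b') (c - c') := by
  simpa [sub_eq_add_neg] using hf.add hg.neg

theorem sum {ι : Type*} (s : Finset ι) {f : ι → ℝ → E} {a b c : ι → E}
    (h : ∀ i ∈ s, Jet2 (f i) (a i) (b i) (c i)) :
    Jet2 (fun τ => ∑ i ∈ s, f i τ) (∑ i ∈ s, a i) (∑ i ∈ s, b i) (∑ i ∈ s, c i) := by
  classical
  induction s using Finset.induction_on with
  | empty => simpa using const (0 : E)
  | insert i s hi ih =>
    simp only [Finset.sum_insert hi]
    exact (h i (by simp)).add (ih fun j hj => h j (by simp [hj]))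

theorem isBigO_sub {f : ℝ → E} {a b c : E} (hf : Jet2 f a b c) :
    (fun τ => f τ - a) =O[𝓝 0] fun τ : ℝ => τ := by
  have h2 : (fun τ : ℝ => τ ^ 2) =O[𝓝 0] fun τ : ℝ => τ := by
    refine Asymptotics.IsBigO.of_bound 1 ?_
    filter_upwards [Metric.ball_mem_nhds (0 : ℝ) one_pos] with τ hτ
    simp only [Metric.mem_ball, dist_zero_right, Real.norm_eq_abs] at hτ
    simp only [Real.norm_eq_abs, abs_pow, one_mul]
    nlinarith [abs_nonneg τ]
  have h3 : (fun τ : ℝ => τ • b + τ ^ 2 • c) =O[𝓝 0] fun τ : ℝ => τ := by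
    refine Asymptotics.IsBigO.add ?_ ?_
    · refine Asymptotics.IsBigO.of_bound ‖b‖ (Eventually.of_forall fun τ => ?_)
      rw [norm_smul, mul_comm]
    · refine Asymptotics.IsBigO.trans ?_ h2
      refine Asymptotics.IsBigO.of_bound ‖c‖ (Eventually.of_forall fun τ => ?_)
      rw [norm_smul, mul_comm]
  refine ((hf.isBigO.trans h2).add h3).congr_left fun τ => ?_
  abel

theorem tendsto {f : ℝ → E} {a b c : E} (hf : Jet2 f a b c) : Tendsto f (𝓝 0) (𝓝 a) := by
  have h := hf.isBigO_sub.trans_tendsto (tendsto_id (α := ℝ) (x := 𝓝 0))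
  simpa using h.add_const a

theorem isLittleO_sub {f : ℝ → E} {a b c : E} (hf : Jet2 f a b c) :
    (fun τ => f τ - a - τ • b) =O[𝓝 0] fun τ : ℝ => τ ^ 2 := by
  have h3 : (fun τ : ℝ => τ ^ 2 • c) =O[𝓝 0] fun τ : ℝ => τ ^ 2 := by
    refine Asymptotics.IsBigO.of_bound ‖c‖ (Eventually.of_forall fun τ => ?_)
    rw [norm_smul, mul_comm]
  refine (hf.isBigO.add h3).congr_left fun τ => ?_
  abel

/-- Composition of a curve with a map which has a second-order Taylor expansion. -/
theorem comp_of_taylor {γ : ℝ → E} {a b c : E} (hγ : Jet2 γ a b c) {Φ : E → F} {A : F}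
    {L : E →L[ℝ] F} {Q : E →L[ℝ] E →L[ℝ] F}
    (hΦ : (fun x => Φ x - (A + L (x - a) + (1 / 2 : ℝ) • Q (x - a) (x - a)))
      =o[𝓝 a] fun x => ‖x - a‖ ^ 2) :
    Jet2 (fun τ => Φ (γ τ)) A (L b) (L c + (1 / 2 : ℝ) • Q b b) := by
  have h1 : (fun τ => Φ (γ τ) - (A + L (γ τ - a) + (1 / 2 : ℝ) • Q (γ τ - a) (γ τ - a)))
      =o[𝓝 0] fun τ : ℝ => τ ^ 2 := by
    exact (hΦ.comp_tendsto hγ.tendsto).trans_isBigO ((hγ.isBigO_sub.norm_left).pow 2)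
  have h2 : (fun τ => L (γ τ - (a + τ • b + τ ^ 2 • c))) =o[𝓝 0] fun τ : ℝ => τ ^ 2 :=
    (L.isBigO_comp _ _).trans_isLittleO hγ
  have hsub : (fun τ => γ τ - a - τ • b) =O[𝓝 0] fun τ : ℝ => τ ^ 2 := hγ.isLittleO_sub
  have hτ : (fun τ : ℝ => τ • b) =O[𝓝 0] fun τ : ℝ => τ := by
    refine Asymptotics.IsBigO.of_bound ‖b‖ (Eventually.of_forall fun τ => ?_)
    rw [norm_smul, mul_comm]
  have h3 : (fun τ => Q (γ τ - a) (γ τ - a) - τ ^ 2 • Q b b) =o[𝓝 0] fun τ : ℝ => τ ^ 2 := by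
    have e1 : (fun τ : ℝ => ‖τ ^ 2‖ * ‖τ‖) =o[𝓝 0] fun τ : ℝ => τ ^ 2 := by
      have : (fun τ : ℝ => ‖τ‖) =o[𝓝 0] fun _ : ℝ => (1 : ℝ) := by
        rw [Asymptotics.isLittleO_one_iff]
        simpa using (continuous_norm (E := ℝ)).tendsto 0
      simpa only [mul_one] using
        ((Asymptotics.isBigO_refl (fun τ : ℝ => τ ^ 2) (𝓝 0)).norm_left).mul_isLittleO this
    have bil : ∀ f g : ℝ → E, (fun τ => Q (f τ) (g τ)) =O[𝓝 0] fun τ => ‖f τ‖ * ‖g τ‖ := by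
      intro f g
      refine Asymptotics.IsBigO.of_bound ‖Q‖ (Eventually.of_forall fun τ => ?_)
      simpa [mul_assoc] using Q.le_opNorm₂ (f τ) (g τ)
    have b1 : (fun τ => Q (γ τ - a - τ • b) (γ τ - a)) =o[𝓝 0] fun τ : ℝ => τ ^ 2 :=
      ((bil _ _).trans (hsub.norm_norm.mul hγ.isBigO_sub.norm_norm)).trans_isLittleO e1
    have b2 : (fun τ => Q (τ • b) (γ τ - a - τ • b)) =o[𝓝 0] fun τ : ℝ => τ ^ 2 :=
      ((bil _ _).trans (by
        simpa [mul_comm] using hτ.norm_norm.mul hsub.norm_norm)).trans_isLittleO e1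
    refine (b1.add b2).congr_left fun τ => ?_
    simp only [map_sub, map_smul, sub_apply, smul_apply]
    module
  refine ((h1.add h2).add (h3.const_smul_left (1 / 2 : ℝ))).congr_left fun τ => ?_
  simp only [map_sub, map_add, map_smul, Pi.smul_apply]
  module

end Jet2

/-- Taylor's formula of order two, with Peano remainder. -/
theorem ContDiffAt.isLittleO_taylor_two {Φ : E → F} {a : E} (h : ContDiffAt ℝ 2 Φ a) :
    (fun x => Φ x - (Φ a + fderiv ℝ Φ a (x - a)
      + (1 / 2 : ℝ) • fderiv ℝ (fderiv ℝ Φ) a (x - a) (x - a))) =o[𝓝 a] fun x => ‖x - a‖ ^ 2 := by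
  obtain ⟨U, hU, hd⟩ : ∃ U ∈ 𝓝 a, ∀ x ∈ U, DifferentiableAt ℝ Φ x := by
    have := (h.eventually (by simp)).mono fun x hx => hx.differentiableAt two_ne_zero
    exact ⟨_, this, fun x hx => hx⟩
  obtain ⟨ε, hε, hball⟩ := Metric.mem_nhds_iff.1 hU
  have hD : DifferentiableAt ℝ (fderiv ℝ Φ) a :=
    (h.fderiv_right (m := 1) (by norm_num)).differentiableAt one_ne_zero
  have hs : IsSymmSndFDerivAt ℝ Φ a := h.isSymmSndFDerivAt (by simp)
  set Q := fderiv ℝ (fderiv ℝ Φ) a with hQ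
  let R : E → F := fun x => Φ x - (Φ a + fderiv ℝ Φ a (x - a) + (1 / 2 : ℝ) • Q (x - a) (x - a))
  have hR : ∀ x ∈ Metric.ball a ε, HasFDerivWithinAt R
      (fderiv ℝ Φ x - fderiv ℝ Φ a - Q (x - a)) (Metric.ball a ε) x := by
    intro x hx
    have e0 : HasFDerivAt (fun x : E => x - a) (ContinuousLinearMap.id ℝ E) x :=
      (hasFDerivAt_id x).sub_const a
    have e1 : HasFDerivAt (fun x : E => fderiv ℝ Φ a (x - a)) (fderiv ℝ Φ a) x :=
      ((fderiv ℝ Φ a).hasFDerivAt.comp x e0)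
    have e2 : HasFDerivAt (fun x : E => Q (x - a) (x - a)) ((2 : ℝ) • Q (x - a)) x := by
      have e3 := (Q.hasFDerivAt.comp x e0).clm_apply e0
      refine e3.congr_fderiv ?_
      ext v
      have hsym : Q v (x - a) = Q (x - a) v := hs v (x - a)
      simp only [map_sub, sub_apply] at hsym
      simp [hsym, two_smul]
    have e4 := (hd x (hball hx)).hasFDerivAt.sub
      (((hasFDerivAt_const (Φ a) x).add e1).add (e2.const_smul (1 / 2 : ℝ)))
    refine (e4.congr_fderiv ?_).hasFDerivWithinAt
    ext v
    simp only [sub_apply, add_apply,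
      smul_apply, zero_apply, smul_smul]
    norm_num
    abel
  have hlit : (fun x => fderiv ℝ Φ x - fderiv ℝ Φ a - Q (x - a))
      =o[𝓝[Metric.ball a ε] a] fun x => ‖x - a‖ ^ 1 := by
    have := hD.hasFDerivAt.isLittleO
    simpa using (this.norm_right).mono nhdsWithin_le_nhds
  have key := (convex_ball a ε).isLittleO_pow_succ (Metric.mem_ball_self hε) hR hlit
  rw [Metric.isOpen_ball.nhdsWithin_eq (Metric.mem_ball_self hε)] at key
  simpa [R] using key

namespace Jet2

theorem comp {γ : ℝ → E} {a b c : E} (hγ : Jet2 γ a b c) {Φ : E → F}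
    (hΦ : ContDiffAt ℝ 2 Φ a) :
    Jet2 (fun τ => Φ (γ τ)) (Φ a) (fderiv ℝ Φ a b)
      (fderiv ℝ Φ a c + (1 / 2 : ℝ) • fderiv ℝ (fderiv ℝ Φ) a b b) :=
  hγ.comp_of_taylor hΦ.isLittleO_taylor_two

theorem bilin {f : ℝ → E} {g : ℝ → F} {a b c : E} {a' b' c' : F} (hf : Jet2 f a b c)
    (hg : Jet2 g a' b' c') (L : E →L[ℝ] F →L[ℝ] G) :
    Jet2 (fun τ => L (f τ) (g τ)) (L a a') (L a b' + L b a') (L a c' + L b b' + L c a') := by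
  have bil : ∀ (f : ℝ → E) (g : ℝ → F),
      (fun τ => L (f τ) (g τ)) =O[𝓝 0] fun τ => ‖f τ‖ * ‖g τ‖ := by
    intro f g
    refine Asymptotics.IsBigO.of_bound ‖L‖ (Eventually.of_forall fun τ => ?_)
    simpa [mul_assoc] using L.le_opNorm₂ (f τ) (g τ)
  have h1 : (fun τ => L (f τ - (a + τ • b + τ ^ 2 • c)) (g τ)) =o[𝓝 0] fun τ : ℝ => τ ^ 2 := by
    refine (bil _ _).trans_isLittleO ?_
    simpa using (Asymptotics.IsLittleO.norm_norm hf).mul_isBigO (hg.tendsto.norm.isBigO_one ℝ)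
  have h2 : (fun τ => L (a + τ • b + τ ^ 2 • c) (g τ - (a' + τ • b' + τ ^ 2 • c')))
      =o[𝓝 0] fun τ : ℝ => τ ^ 2 := by
    refine (bil _ _).trans_isLittleO ?_
    simpa using ((quad a b c).tendsto.norm.isBigO_one ℝ).mul_isLittleO
      (Asymptotics.IsLittleO.norm_norm hg)
  have h3 : (fun τ : ℝ => τ ^ 2 • (τ • (L b c' + L c b' + τ • L c c')))
      =o[𝓝 0] fun τ : ℝ => τ ^ 2 := by
    have : Tendsto (fun τ : ℝ => τ • (L b c' + L c b' + τ • L c c')) (𝓝 0) (𝓝 0) := by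
      have : Continuous fun τ : ℝ => τ • (L b c' + L c b' + τ • L c c') := by fun_prop
      simpa using this.tendsto 0
    have := (Asymptotics.isBigO_refl (fun τ : ℝ => τ ^ 2) (𝓝 0)).smul_isLittleO
      ((Asymptotics.isLittleO_one_iff ℝ).2 this)
    simpa using this
  refine ((h1.add h2).add h3).congr_left fun τ => ?_
  simp only [map_sub, map_add, map_smul, sub_apply, add_apply, smul_apply]
  module

theorem mul {f g : ℝ → ℝ} {a b c a' b' c' : ℝ} (hf : Jet2 f a b c) (hg : Jet2 g a' b' c') :
    Jet2 (fun τ => f τ * g τ) (a * a') (a * b' + b * a') (a * c' + b * b' + c * a') := by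
  simpa using hf.bilin hg (ContinuousLinearMap.mul ℝ ℝ)

theorem const_mul {f : ℝ → ℝ} {a b c : ℝ} (k : ℝ) (hf : Jet2 f a b c) :
    Jet2 (fun τ => k * f τ) (k * a) (k * b) (k * c) := by
  simpa using (const k).mul hf

/-- Composition with a scalar function whose first derivative near `a` is known. -/
theorem comp_real {f : ℝ → ℝ} {a b c : ℝ} (hf : Jet2 f a b c) {Φ Φ' : ℝ → ℝ} {Φ'' : ℝ}
    (hΦ : ContDiffAt ℝ 2 Φ a) (h1 : ∀ᶠ x in 𝓝 a, HasDerivAt Φ (Φ' x) x)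
    (h2 : HasDerivAt Φ' Φ'' a) :
    Jet2 (fun τ => Φ (f τ)) (Φ a) (Φ' a * b) (Φ' a * c + 1 / 2 * Φ'' * b ^ 2) := by
  have h := hf.comp hΦ
  have e1 : fderiv ℝ Φ =ᶠ[𝓝 a] fun x => ContinuousLinearMap.toSpanSingleton ℝ (Φ' x) := by
    filter_upwards [h1] with x hx
    exact hx.hasFDerivAt.fderiv
  have e2 : HasFDerivAt (fderiv ℝ Φ)
      ((ContinuousLinearMap.toSpanSingletonCLE (𝕜 := ℝ) (E := ℝ) : ℝ →L[ℝ] ℝ →L[ℝ] ℝ).comp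
        (ContinuousLinearMap.toSpanSingleton ℝ Φ'')) a := by
    refine HasFDerivAt.congr_of_eventuallyEq ?_ e1
    exact ((ContinuousLinearMap.toSpanSingletonCLE (𝕜 := ℝ) (E := ℝ) :
      ℝ →L[ℝ] ℝ →L[ℝ] ℝ).hasFDerivAt.comp a h2.hasFDerivAt)
  rw [e2.fderiv, e1.self_of_nhds] at h
  convert h using 1
  · simp [mul_comm]
  · simp
    ring

theorem log {f : ℝ → ℝ} {a b c : ℝ} (hf : Jet2 f a b c) (ha : 0 < a) :
    Jet2 (fun τ => Real.log (f τ)) (Real.log a) (b / a) (c / a - 1 / 2 * (b / a) ^ 2) := by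
  have h := hf.comp_real (Φ := Real.log) (Φ' := fun x => x⁻¹) (Φ'' := -(a ^ 2)⁻¹)
    (Real.contDiffAt_log.2 ha.ne')
    ((eventually_ne_nhds ha.ne').mono fun x hx => Real.hasDerivAt_log hx) (hasDerivAt_inv ha.ne')
  convert h using 1
  · field_simp
  · field_simp
    ring

theorem inv {f : ℝ → ℝ} {a b c : ℝ} (hf : Jet2 f a b c) (ha : a ≠ 0) :
    Jet2 (fun τ => (f τ)⁻¹) a⁻¹ (-b / a ^ 2) (-c / a ^ 2 + b ^ 2 / a ^ 3) := by
  have h2 : HasDerivAt (fun x : ℝ => -(x ^ 2)⁻¹) (2 * a / (a ^ 2) ^ 2) a := by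
    have := ((hasDerivAt_pow 2 a).inv (pow_ne_zero 2 ha)).neg
    refine this.congr_deriv ?_
    simp
    ring
  have h := hf.comp_real (Φ := fun x => x⁻¹) (Φ' := fun x => -(x ^ 2)⁻¹)
    (Φ'' := 2 * a / (a ^ 2) ^ 2) (contDiffAt_inv ℝ ha)
    ((eventually_ne_nhds ha).mono fun x hx => hasDerivAt_inv hx) h2
  convert h using 1
  · field_simp
  · field_simp

theorem sqrt {f : ℝ → ℝ} {a b c : ℝ} (hf : Jet2 f a b c) (ha : 0 < a) :
    Jet2 (fun τ => √(f τ)) (√a) (b / (2 * √a)) (c / (2 * √a) - b ^ 2 / (8 * a * √a)) := by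
  have hs : 0 < √a := Real.sqrt_pos.2 ha
  have h2 : HasDerivAt (fun x : ℝ => 1 / (2 * √x)) (-(1 / (4 * a * √a))) a := by
    have := ((Real.hasDerivAt_sqrt ha.ne').const_mul 2).inv (by positivity)
    have e : (fun x : ℝ => 1 / (2 * √x)) = (fun y => 2 * √y)⁻¹ := by ext x; simp
    rw [e]
    refine this.congr_deriv ?_
    field_simp
    rw [Real.sq_sqrt ha.le]
    ring
  have h := hf.comp_real (Φ := fun x => √x) (Φ' := fun x => 1 / (2 * √x))
    (Φ'' := -(1 / (4 * a * √a))) (Real.contDiffAt_sqrt ha.ne')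
    ((eventually_ne_nhds ha.ne').mono fun x hx => Real.hasDerivAt_sqrt hx) h2
  convert h using 1
  · field_simp
  · field_simp
    ring

theorem exp {f : ℝ → ℝ} {a b c : ℝ} (hf : Jet2 f a b c) :
    Jet2 (fun τ => Real.exp (f τ)) (Real.exp a) (Real.exp a * b)
      (Real.exp a * c + 1 / 2 * Real.exp a * b ^ 2) :=
  hf.comp_real (Φ := Real.exp) (Φ' := Real.exp) Real.contDiff_exp.contDiffAt
    (Eventually.of_forall Real.hasDerivAt_exp) (Real.hasDerivAt_exp a)

/-- If `f ≤ g` near `0` with equality at `0`, then the linear coefficients agree and the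
quadratic ones are ordered. -/
theorem le_of_eventually_le {f g : ℝ → ℝ} {a b c b' c' : ℝ} (hf : Jet2 f a b c)
    (hg : Jet2 g a b' c') (hle : ∀ᶠ τ in 𝓝 0, f τ ≤ g τ) : b = b' ∧ c ≤ c' := by
  have hd := hg.sub hf
  rw [sub_self] at hd
  have hb : b' - b = 0 := by
    by_contra hne
    have hO := hd.isLittleO_sub
    have ho : (fun τ => (g τ - f τ) - τ * (b' - b)) =o[𝓝 0] fun τ : ℝ => τ := by
      have h2 : (fun τ : ℝ => τ ^ 2) =o[𝓝 0] fun τ : ℝ => τ := by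
        simpa using Asymptotics.isLittleO_pow_pow (𝕜 := ℝ) (m := 1) (n := 2) (by norm_num)
      simpa using hO.trans_isLittleO h2
    have hpos : 0 < |b' - b| / 2 := by positivity
    have hev := (ho.bound hpos).and hle
    obtain ⟨ε, hε, hball⟩ := Metric.mem_nhds_iff.1 hev
    have hsgn : ∀ s : ℝ, |s| = ε / 2 → s * (b' - b) = -(ε / 2 * |b' - b|) → False := by
      intro s hs hsb
      have hm : s ∈ Metric.ball (0 : ℝ) ε := by
        simp [hs]; linarith
      obtain ⟨h1, h2⟩ := hball hm
      rw [hsb, Real.norm_eq_abs, Real.norm_eq_abs, hs] at h1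
      have := le_abs_self (g s - f s - -(ε / 2 * |b' - b|))
      have h3 : 0 < |b' - b| * ε := by positivity
      nlinarith
    rcases lt_or_gt_of_ne hne with h | h
    · refine hsgn (ε / 2) (abs_of_pos (by positivity)) ?_
      rw [abs_of_neg h]; ring
    · refine hsgn (-(ε / 2)) (by rw [abs_neg]; exact abs_of_pos (by positivity)) ?_
      rw [abs_of_pos h]; ring
  refine ⟨by linarith, ?_⟩
  by_contra! hlt
  have ho : (fun τ => (g τ - f τ) - (τ ^ 2 * (c' - c))) =o[𝓝 0] fun τ : ℝ => τ ^ 2 := by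
    simpa [Jet2, hb] using hd
  have hpos : 0 < (c - c') / 2 := by linarith
  have hev := (ho.bound hpos).and hle
  obtain ⟨ε, hε, hball⟩ := Metric.mem_nhds_iff.1 hev
  have hm : ε / 2 ∈ Metric.ball (0 : ℝ) ε := by
    rw [Metric.mem_ball, dist_zero_right, Real.norm_eq_abs, abs_of_pos (by positivity)]; linarith
  obtain ⟨h1, h2⟩ := hball hm
  rw [Real.norm_eq_abs, Real.norm_eq_abs, abs_of_nonneg (sq_nonneg (ε / 2))] at h1
  have := le_abs_self (g (ε / 2) - f (ε / 2) - (ε / 2) ^ 2 * (c' - c))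
  have h3 : 0 < (ε / 2) ^ 2 := by positivity
  nlinarith

theorem of_isLocalMax {f : ℝ → ℝ} {a b c : ℝ} (hf : Jet2 f a b c)
    (hmax : ∀ᶠ τ in 𝓝 0, f τ ≤ a) : b = 0 ∧ c ≤ 0 :=
  hf.le_of_eventually_le (const a) hmax

end Jet2

end Jets

/-! ### Isometries between the Euclidean metric and the metric of a graph -/

section Tilt

variable {E : Type*} [NormedAddCommGroup E]

/-- `w = √(1 + |D|²)` for a gradient vector `D`. -/
noncomputable def slopeFactor (D : E) : ℝ := √(1 + ‖D‖ ^ 2)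

theorem slopeFactor_sq (D : E) : slopeFactor D ^ 2 = 1 + ‖D‖ ^ 2 :=
  Real.sq_sqrt (by positivity)

theorem one_le_slopeFactor (D : E) : 1 ≤ slopeFactor D :=
  Real.one_le_sqrt.2 (by nlinarith [sq_nonneg ‖D‖])

theorem slopeFactor_pos (D : E) : 0 < slopeFactor D := one_pos.trans_le (one_le_slopeFactor D)

theorem norm_le_slopeFactor (D : E) : ‖D‖ ≤ slopeFactor D :=
  Real.le_sqrt_of_sq_le (by linarith)

variable [InnerProductSpace ℝ E]

/-- The positive square root of the operator `I + D Dᵀ`: it maps the metric `⟪v, v'⟫ + ⟪D, v⟫⟪D, v'⟫`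
to the Euclidean one. -/
noncomputable def tilt (D v : E) : E := v + (⟪D, v⟫ / (1 + slopeFactor D)) • D

/-- The inverse of `tilt D`. -/
noncomputable def untilt (D z : E) : E :=
  z - (⟪D, z⟫ / (slopeFactor D * (1 + slopeFactor D))) • D

theorem norm_sq_eq_slopeFactor (D : E) : ⟪D, D⟫ = slopeFactor D ^ 2 - 1 := by
  rw [slopeFactor_sq, real_inner_self_eq_norm_sq]; ring

theorem inner_tilt (D v v' : E) : ⟪tilt D v, tilt D v'⟫ = ⟪v, v'⟫ + ⟪D, v⟫ * ⟪D, v'⟫ := by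
  have hw := slopeFactor_pos D
  simp only [tilt, inner_add_left, inner_add_right, inner_smul_left, inner_smul_right,
    norm_sq_eq_slopeFactor, real_inner_comm D v]
  simp
  field_simp
  ring

theorem inner_untilt_self (D z : E) : ⟪D, untilt D z⟫ = ⟪D, z⟫ / slopeFactor D := by
  have hw := slopeFactor_pos D
  simp only [untilt, inner_sub_right, inner_smul_right, norm_sq_eq_slopeFactor]
  field_simp
  ring

theorem inner_tilt_self (D z : E) : ⟪D, tilt D z⟫ = ⟪D, z⟫ * slopeFactor D := by
  have hw := slopeFactor_pos D
  simp only [tilt, inner_add_right, inner_smul_right, norm_sq_eq_slopeFactor]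
  field_simp
  ring

theorem tilt_untilt (D z : E) : tilt D (untilt D z) = z := by
  have hw := slopeFactor_pos D
  rw [tilt, inner_untilt_self, untilt, sub_add, sub_eq_self, ← sub_smul]
  have : ⟪D, z⟫ / (slopeFactor D * (1 + slopeFactor D)) -
    ⟪D, z⟫ / slopeFactor D / (1 + slopeFactor D) = 0 := by field_simp; ring
  rw [this, zero_smul]

theorem untilt_tilt (D z : E) : untilt D (tilt D z) = z := by
  have hw := slopeFactor_pos D
  rw [untilt, inner_tilt_self, tilt, add_sub_assoc, ← sub_smul]
  have : ⟪D, z⟫ / (1 + slopeFactor D) -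
    ⟪D, z⟫ * slopeFactor D / (slopeFactor D * (1 + slopeFactor D)) = 0 := by field_simp; ring
  rw [this, zero_smul, add_zero]

theorem inner_untilt (D z z' : E) :
    ⟪untilt D z, untilt D z'⟫ + ⟪D, untilt D z⟫ * ⟪D, untilt D z'⟫ = ⟪z, z'⟫ := by
  rw [← inner_tilt, tilt_untilt, tilt_untilt]

theorem inner_untilt_left (D z z' : E) : ⟪untilt D z, z'⟫ = ⟪z, untilt D z'⟫ := by
  simp only [untilt, inner_sub_left, inner_sub_right, inner_smul_left, inner_smul_right,
    real_inner_comm D z]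
  simp
  ring

theorem norm_untilt_le (D z : E) : ‖untilt D z‖ ≤ ‖z‖ := by
  have h := inner_untilt D z z
  rw [real_inner_self_eq_norm_sq, real_inner_self_eq_norm_sq] at h
  exact le_of_sq_le_sq (by nlinarith [sq_nonneg ⟪D, untilt D z⟫]) (norm_nonneg z)

theorem untilt_sub (D z z' : E) : untilt D (z - z') = untilt D z - untilt D z' := by
  simp only [untilt, inner_sub_right, sub_div, sub_smul]; abel

/-- Transporting a vector isometrically from the metric with gradient `D` to the one with
gradient `D'` moves it by at most the sum of the two slopes in its direction. -/
theorem norm_sub_untilt_tilt_le (D D' v : E) :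
    ‖v - untilt D' (tilt D v)‖ ≤ |⟪D, v⟫| + |⟪D', v⟫| := by
  have e : v - untilt D' (tilt D v) = untilt D' (tilt D' v - tilt D v) := by
    rw [untilt_sub, untilt_tilt]
  have bd : ∀ A : E, ‖(⟪A, v⟫ / (1 + slopeFactor A)) • A‖ ≤ |⟪A, v⟫| := by
    intro A
    have hw := slopeFactor_pos A
    rw [norm_smul, norm_div, Real.norm_eq_abs, Real.norm_eq_abs, abs_of_pos (by linarith : 0 < 1 + slopeFactor A),
      div_mul_eq_mul_div, div_le_iff₀ (by linarith)]
    have := norm_le_slopeFactor A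
    exact mul_le_mul_of_nonneg_left (by linarith) (abs_nonneg _)
  rw [e]
  refine (norm_untilt_le _ _).trans ?_
  have : tilt D' v - tilt D v = (⟪D', v⟫ / (1 + slopeFactor D')) • D'
      - (⟪D, v⟫ / (1 + slopeFactor D)) • D := by simp only [tilt]; abel
  rw [this]
  refine (norm_sub_le _ _).trans ?_
  have := bd D
  have := bd D'
  linarith

/-- `untilt D` as a linear map. -/
noncomputable def untiltL (D : E) : E →L[ℝ] E :=
  ContinuousLinearMap.id ℝ E -
    ((innerSL ℝ D).smulRight ((slopeFactor D * (1 + slopeFactor D))⁻¹ • D))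

theorem untiltL_apply (D z : E) : untiltL D z = untilt D z := by
  simp [untiltL, untilt, smul_smul, div_eq_mul_inv]

end Tilt

/-! ### Principal frames of a graph -/

namespace GraphSurface

variable {n : ℕ}

/-- The induced metric as a bilinear form: `g(v, v') = ⟪v, v'⟫ + du(v) du(v')`. -/
noncomputable def gForm (u : Eucl n → ℝ) (x v v' : Eucl n) : ℝ :=
  ⟪v, v'⟫ + fderiv ℝ u x v * fderiv ℝ u x v'

/-- The second fundamental form as a bilinear form: `h(v, v') = D²u(v, v') / w`. -/
noncomputable def hForm (u : Eucl n → ℝ) (x v v' : Eucl n) : ℝ :=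
  fderiv ℝ (fderiv ℝ u) x v v' / areaFactor u x

theorem inner_grad (u : Eucl n → ℝ) (x v : Eucl n) : ⟪gradient u x, v⟫ = fderiv ℝ u x v := by
  rw [← toDual_gradient, InnerProductSpace.toDual_apply_apply]

theorem grad_apply (u : Eucl n → ℝ) (x : Eucl n) (i : Fin n) : gradient u x i = pd u x i := by
  rw [pd, ← inner_grad, EuclideanSpace.inner_single_right]
  simp

theorem areaFactor_eq (u : Eucl n → ℝ) (x : Eucl n) :
    areaFactor u x = slopeFactor (gradient u x) := by
  rw [areaFactor, slopeFactor, EuclideanSpace.real_norm_sq_eq]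
  simp only [grad_apply]

theorem areaFactor_pos (u : Eucl n → ℝ) (x : Eucl n) : 0 < areaFactor u x := by
  rw [areaFactor_eq]; exact slopeFactor_pos _

theorem sum_smul_single (v : Eucl n) : ∑ i, v i • EuclideanSpace.single i (1 : ℝ) = v := by
  ext j
  simp [Pi.single_apply]

theorem gForm_eq_sum (u : Eucl n → ℝ) (x v v' : Eucl n) :
    gForm u x v v' = ∑ i, ∑ j, v i * metric u x i j * v' j := by
  have h1 : ∀ v, fderiv ℝ u x v = ∑ i, v i * pd u x i := fun v => by
    conv_lhs => rw [← sum_smul_single v]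
    simp [pd]
  rw [gForm, h1, h1, Finset.sum_mul_sum]
  simp only [metric, Matrix.of_apply, mul_add, add_mul, Finset.sum_add_distrib]
  congr 1
  · simp [PiLp.inner_apply, mul_comm]
  · refine Finset.sum_congr rfl fun i _ => Finset.sum_congr rfl fun j _ => ?_
    ring

theorem hForm_eq_sum (u : Eucl n → ℝ) (x v v' : Eucl n) :
    hForm u x v v' = ∑ i, ∑ j, v i * secondForm u x i j * v' j := by
  rw [hForm]
  conv_lhs => rw [← sum_smul_single v, ← sum_smul_single v']
  simp only [map_sum, map_smul, sum_apply, smul_apply, smul_eq_mul,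
    Finset.sum_div, secondForm, Matrix.of_apply, pd2, Finset.mul_sum]
  rw [Finset.sum_comm]
  refine Finset.sum_congr rfl fun i _ => Finset.sum_congr rfl fun j _ => ?_
  ring

open Matrix in
/-- A basis which is orthonormal for `g` and diagonalises `h` computes the principal curvatures
and the norm of the second fundamental form. -/
theorem principalCurvatures_of_frame {u : Eucl n → ℝ} {x : Eucl n} {v : Fin n → Eucl n}
    {κ : Fin n → ℝ} (hg : ∀ i j, gForm u x (v i) (v j) = if i = j then 1 else 0)
    (hh : ∀ i j, hForm u x (v i) (v j) = if i = j then κ i else 0) :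
    principalCurvatures u x = Finset.univ.val.map κ ∧
      secondFormNorm u x = √(∑ i, κ i ^ 2) := by
  set P : Matrix (Fin n) (Fin n) ℝ := Matrix.of fun i k => v k i with hP
  have h1 : Pᵀ * metric u x * P = 1 := by
    ext i j
    rw [Matrix.one_apply, ← hg, gForm_eq_sum, Matrix.mul_apply]
    simp only [Matrix.mul_apply, Finset.sum_mul, hP, Matrix.transpose_apply, Matrix.of_apply]
    rw [Finset.sum_comm]
  have h2 : Pᵀ * secondForm u x * P = Matrix.diagonal κ := by
    ext i j
    rw [Matrix.diagonal_apply, ← hh, hForm_eq_sum, Matrix.mul_apply]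
    simp only [Matrix.mul_apply, Finset.sum_mul, hP, Matrix.transpose_apply, Matrix.of_apply]
    rw [Finset.sum_comm]
  have h3 : (metric u x)⁻¹ = P * Pᵀ := by
    refine Matrix.inv_eq_left_inv ?_
    rw [Matrix.mul_assoc]
    exact mul_eq_one_comm.1 h1
  constructor
  · rw [principalCurvatures, h3, Matrix.mul_assoc, Matrix.charpoly_mul_comm, h2,
      Matrix.charpoly_diagonal]
    have := Polynomial.roots_multiset_prod_X_sub_C (Finset.univ.val.map κ)
    rwa [Multiset.map_map] at this
  · rw [secondFormNorm]
    congr 1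
    have e : ∀ i j k l, (metric u x)⁻¹ i k * (metric u x)⁻¹ j l * secondForm u x i j
        * secondForm u x k l = ∑ a, ∑ b, (P i a * secondForm u x i j * P j b)
          * (P k a * secondForm u x k l * P l b) := by
      intro i j k l
      rw [h3, Matrix.mul_apply, Matrix.mul_apply, Finset.sum_mul_sum, Finset.sum_mul,
        Finset.sum_mul]
      refine Finset.sum_congr rfl fun a _ => ?_
      rw [Finset.sum_mul, Finset.sum_mul]
      refine Finset.sum_congr rfl fun b _ => ?_
      simp only [Matrix.transpose_apply]
      ring
    have e2 : ∀ a b, ∑ i, ∑ j, P i a * secondForm u x i j * P j b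
        = if a = b then κ a else 0 := by
      intro a b
      rw [← Matrix.diagonal_apply, ← h2, Matrix.mul_apply]
      simp only [Matrix.mul_apply, Finset.sum_mul, Matrix.transpose_apply]
      rw [Finset.sum_comm]
    calc _ = ∑ a, ∑ b, (∑ i, ∑ j, P i a * secondForm u x i j * P j b) ^ 2 := by
          have swap : ∀ F : Fin n → Fin n → Fin n → ℝ,
              ∑ a, ∑ b, ∑ i, F a b i = ∑ i, ∑ a, ∑ b, F a b i := fun F => by
            rw [Finset.sum_comm (s := Finset.univ (α := Fin n)) (f := fun i a => ∑ b, F a b i)]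
            exact Finset.sum_congr rfl fun a _ => Finset.sum_comm
          have sqr : ∀ X : Fin n → Fin n → ℝ,
              (∑ i, ∑ j, X i j) ^ 2 = ∑ i, ∑ j, ∑ k, ∑ l, X i j * X k l := fun X => by
            rw [sq, Finset.sum_mul]
            refine Finset.sum_congr rfl fun i _ => ?_
            rw [Finset.sum_mul]
            refine Finset.sum_congr rfl fun j _ => ?_
            rw [Finset.mul_sum]
            exact Finset.sum_congr rfl fun k _ => Finset.mul_sum _ _ _
          simp only [e, sqr]
          symm
          refine (swap _).trans (Finset.sum_congr rfl fun i _ => ?_)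
          refine (swap _).trans (Finset.sum_congr rfl fun j _ => ?_)
          refine (swap _).trans (Finset.sum_congr rfl fun k _ => ?_)
          exact swap _
      _ = _ := by
          simp only [e2]
          refine Finset.sum_congr rfl fun a _ => ?_
          simp [ite_pow]

end GraphSurface

/-! ### Schur's inequality for the curvature function -/

section Schur

variable {n : ℕ}

/-- The family of the `p`-element subsets of the index set. -/
abbrev pSets (n p : ℕ) : Finset (Finset (Fin n)) := Finset.powersetCard p Finset.univ

theorem sum_pSets_comp_perm (p : ℕ) (σ : Equiv.Perm (Fin n)) (κ : Fin n → ℝ) (Φ : ℝ → ℝ) :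
    ∑ I ∈ pSets n p, Φ (∑ i ∈ I, κ (σ i)) = ∑ I ∈ pSets n p, Φ (∑ i ∈ I, κ i) := by
  refine Finset.sum_equiv σ.finsetCongr (fun I => ?_) fun I _ => ?_
  · simp [Finset.mem_powersetCard]
  · simp

/-- The function `κ ↦ ∑ log (κ_{i₁} + ⋯ + κ_{i_p})` does not decrease when `κ` is averaged by a
doubly stochastic matrix. By Birkhoff's theorem, this is concavity and invariance under
permutations. -/
theorem sum_log_le_of_doublyStochastic {p : ℕ} {κ : Fin n → ℝ}
    (hκ : ∀ I ∈ pSets n p, 0 < ∑ i ∈ I, κ i) {A : Matrix (Fin n) (Fin n) ℝ}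
    (hA : A ∈ doublyStochastic ℝ (Fin n)) :
    (∀ I ∈ pSets n p, 0 < ∑ i ∈ I, ∑ k, A i k * κ k) ∧
      ∑ I ∈ pSets n p, Real.log (∑ i ∈ I, κ i)
        ≤ ∑ I ∈ pSets n p, Real.log (∑ i ∈ I, ∑ k, A i k * κ k) := by
  obtain ⟨w, hw0, hw1, rfl⟩ := exists_eq_sum_perm_of_mem_doublyStochastic hA
  have e1 : ∀ i, ∑ k, (∑ σ : Equiv.Perm (Fin n), w σ • σ.permMatrix ℝ) i k * κ k
      = ∑ σ : Equiv.Perm (Fin n), w σ * κ (σ i) := by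
    intro i
    simp only [Matrix.sum_apply, Matrix.smul_apply, smul_eq_mul, Finset.sum_mul]
    rw [Finset.sum_comm]
    refine Finset.sum_congr rfl fun σ _ => ?_
    simp [Equiv.Perm.permMatrix, PEquiv.toMatrix_apply, Equiv.toPEquiv_apply]
  have e2 : ∀ I : Finset (Fin n), ∑ i ∈ I, ∑ σ : Equiv.Perm (Fin n), w σ * κ (σ i)
      = ∑ σ : Equiv.Perm (Fin n), w σ • ∑ i ∈ I, κ (σ i) := by
    intro I
    rw [Finset.sum_comm]
    simp only [smul_eq_mul, Finset.mul_sum]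
  have hpos : ∀ I ∈ pSets n p, ∀ σ : Equiv.Perm (Fin n), 0 < ∑ i ∈ I, κ (σ i) := by
    intro I hI σ
    have := hκ (I.map σ.toEmbedding) (by
      simpa [Finset.mem_powersetCard] using hI)
    simpa using this
  simp only [e1, e2]
  have hcc := strictConcaveOn_log_Ioi.concaveOn
  constructor
  · intro I hI
    have := (convex_Ioi (0 : ℝ)).sum_mem (t := Finset.univ) (w := w)
      (z := fun σ : Equiv.Perm (Fin n) => ∑ i ∈ I, κ (σ i)) (fun σ _ => hw0 σ) hw1
      fun σ _ => hpos I hI σ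
    exact this
  · calc ∑ I ∈ pSets n p, Real.log (∑ i ∈ I, κ i)
        = ∑ σ : Equiv.Perm (Fin n), w σ * ∑ I ∈ pSets n p, Real.log (∑ i ∈ I, κ (σ i)) := by
          simp only [sum_pSets_comp_perm p _ κ Real.log]
          rw [← Finset.sum_mul, hw1, one_mul]
      _ = ∑ I ∈ pSets n p, ∑ σ : Equiv.Perm (Fin n), w σ • Real.log (∑ i ∈ I, κ (σ i)) := by
          simp only [Finset.mul_sum, smul_eq_mul]
          rw [Finset.sum_comm]
      _ ≤ _ := Finset.sum_le_sum fun I hI =>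
          hcc.le_map_sum (fun σ _ => hw0 σ) hw1 fun σ _ => hpos I hI σ

/-- The diagonal entries of a diagonal form in an orthonormal frame. -/
theorem sum_log_le_of_orthonormal {p : ℕ} {κ : Fin n → ℝ}
    (hκ : ∀ I ∈ pSets n p, 0 < ∑ i ∈ I, κ i) {y : Fin n → Eucl n}
    (hy : Orthonormal ℝ y) :
    (∀ I ∈ pSets n p, 0 < ∑ i ∈ I, ∑ k, κ k * y i k * y i k) ∧
      ∑ I ∈ pSets n p, Real.log (∑ i ∈ I, κ i)
        ≤ ∑ I ∈ pSets n p, Real.log (∑ i ∈ I, ∑ k, κ k * y i k * y i k) := by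
  have hA : (Matrix.of fun i k => y i k * y i k) ∈ doublyStochastic ℝ (Fin n) := by
    rw [mem_doublyStochastic_iff_sum]
    refine ⟨fun i j => mul_self_nonneg _, fun i => ?_, fun k => ?_⟩
    · have := EuclideanSpace.real_norm_sq_eq (y i)
      rw [hy.1 i] at this
      simp only [Matrix.of_apply, ← sq, ← this]
      norm_num
    · let b : OrthonormalBasis (Fin n) ℝ (Eucl n) :=
        OrthonormalBasis.mk hy (by
          rw [LinearIndependent.span_eq_top_of_card_eq_finrank' hy.linearIndependent (by simp)])
      have := b.sum_sq_norm_inner_right (EuclideanSpace.single k (1 : ℝ))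
      simpa [b, EuclideanSpace.inner_single_right, ← sq] using this
  have := sum_log_le_of_doublyStochastic hκ hA
  have e : ∀ i k, κ k * y i k * y i k = y i k * y i k * κ k := fun i k => by ring
  simp only [e]
  exact this

end Schur

namespace GraphSurface

variable {n : ℕ}

theorem gForm_eq_inner_tilt (u : Eucl n → ℝ) (x v v' : Eucl n) :
    gForm u x v v' = ⟪tilt (gradient u x) v, tilt (gradient u x) v'⟫ := by
  rw [inner_tilt, inner_grad, inner_grad, gForm]

theorem gForm_untilt (u : Eucl n → ℝ) (x z z' : Eucl n) :
    gForm u x (untilt (gradient u x) z) (untilt (gradient u x) z') = ⟪z, z'⟫ := by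
  rw [gForm_eq_inner_tilt, tilt_untilt, tilt_untilt]

/-- The isometry `O` carries the standard basis to an eigenbasis, with eigenvalues `κ`, of the
second fundamental form transported to the Euclidean metric. -/
def IsPrincipalFrame (u : Eucl n → ℝ) (x : Eucl n) (κ : Fin n → ℝ)
    (O : Eucl n ≃ₗᵢ[ℝ] Eucl n) : Prop :=
  ∀ y y', hForm u x (untilt (gradient u x) (O y)) (untilt (gradient u x) (O y'))
    = ∑ i, κ i * y i * y' i

theorem exists_isPrincipalFrame {u : Eucl n → ℝ} {x : Eucl n}
    (hs : IsSymmSndFDerivAt ℝ u x) : ∃ κ O, IsPrincipalFrame u x κ O := by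
  let D := gradient u x
  let A : Eucl n →ₗ[ℝ] Eucl n :=
    { toFun := fun v => (InnerProductSpace.toDual ℝ (Eucl n)).symm (fderiv ℝ (fderiv ℝ u) x v)
      map_add' := fun v v' => by simp
      map_smul' := fun k v => by simp }
  have hA : ∀ v v', ⟪A v, v'⟫ = fderiv ℝ (fderiv ℝ u) x v v' := fun v v' => by
    simp [A]
  let T : Eucl n →ₗ[ℝ] Eucl n :=
    (areaFactor u x)⁻¹ • (untiltL D).toLinearMap ∘ₗ A ∘ₗ (untiltL D).toLinearMap
  have hT : ∀ z z', ⟪T z, z'⟫ = hForm u x (untilt D z) (untilt D z') := fun z z' => by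
    simp only [T, ContinuousLinearMap.coe_coe, LinearMap.smul_apply, LinearMap.comp_apply,
      untiltL_apply, inner_smul_left, inner_untilt_left, hA, hForm]
    simp
    ring
  have hsym : T.IsSymmetric := fun z z' => by
    rw [hT, real_inner_comm, hT, hForm, hForm, hs]
  have hn : Module.finrank ℝ (Eucl n) = n := by simp
  refine ⟨hsym.eigenvalues hn, (hsym.eigenvectorBasis hn).repr.symm, fun y y' => ?_⟩
  rw [← hT, ← LinearIsometryEquiv.inner_map_map (hsym.eigenvectorBasis hn).repr]
  simp only [PiLp.inner_apply, hsym.eigenvectorBasis_apply_self_apply,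
    LinearIsometryEquiv.apply_symm_apply]
  refine Finset.sum_congr rfl fun i _ => ?_
  simp
  ring

namespace IsPrincipalFrame

variable {u : Eucl n → ℝ} {x : Eucl n} {κ : Fin n → ℝ} {O : Eucl n ≃ₗᵢ[ℝ] Eucl n}

theorem curvatures (h : IsPrincipalFrame u x κ O) :
    principalCurvatures u x = Finset.univ.val.map κ ∧
      secondFormNorm u x = √(∑ i, κ i ^ 2) := by
  refine principalCurvatures_of_frame
    (v := fun i => untilt (gradient u x) (O (EuclideanSpace.single i 1))) (fun i j => ?_)
    fun i j => ?_
  · rw [gForm_untilt, LinearIsometryEquiv.inner_map_map, EuclideanSpace.inner_single_left]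
    simp
  · rw [h]
    rcases eq_or_ne i j with rfl | hij
    · simp
    · simp [hij, hij.symm]

theorem curvatureProd_eq (h : IsPrincipalFrame u x κ O) (p : ℕ) :
    curvatureProd p u x = ∏ I ∈ pSets n p, ∑ i ∈ I, κ i := by
  rw [curvatureProd, h.curvatures.1, Multiset.powersetCard_map, Multiset.map_map,
    ← Finset.map_val_val_powersetCard, Multiset.map_map]
  rfl

theorem sum_nonneg (h : IsPrincipalFrame u x κ O) {p : ℕ}
    (ha : ∀ s ∈ (principalCurvatures u x).powersetCard p, 0 ≤ s.sum) {I : Finset (Fin n)}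
    (hI : I ∈ pSets n p) : 0 ≤ ∑ i ∈ I, κ i := by
  refine ha (I.val.map κ) ?_
  rw [h.curvatures.1, Multiset.powersetCard_map, ← Finset.map_val_val_powersetCard,
    Multiset.map_map]
  exact Multiset.mem_map.2 ⟨I, hI, rfl⟩

/-- Positivity of the product upgrades admissibility to strict inequalities. -/
theorem sum_pos (h : IsPrincipalFrame u x κ O) {p : ℕ}
    (ha : ∀ s ∈ (principalCurvatures u x).powersetCard p, 0 ≤ s.sum)
    (hpos : 0 < curvatureProd p u x) {I : Finset (Fin n)}
    (hI : I ∈ pSets n p) : 0 < ∑ i ∈ I, κ i := by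
  refine lt_of_le_of_ne (h.sum_nonneg ha hI) fun h0 => hpos.ne' ?_
  rw [h.curvatureProd_eq]
  exact Finset.prod_eq_zero hI h0.symm

/-- **Schur's inequality**: the curvature function evaluated on the diagonal of the second
fundamental form in an arbitrary orthonormal frame is at least its value on the principal
curvatures. -/
theorem schur (h : IsPrincipalFrame u x κ O) {p : ℕ}
    (hκ : ∀ I ∈ pSets n p, 0 < ∑ i ∈ I, κ i) {e : Fin n → Eucl n}
    (he : ∀ i j, gForm u x (e i) (e j) = if i = j then 1 else 0) :
    (∀ I ∈ pSets n p, 0 < ∑ i ∈ I, hForm u x (e i) (e i)) ∧ Real.log (curvatureProd p u x)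
      ≤ ∑ I ∈ pSets n p, Real.log (∑ i ∈ I, hForm u x (e i) (e i)) := by
  let y : Fin n → Eucl n := fun i => O.symm (tilt (gradient u x) (e i))
  have hy : Orthonormal ℝ y := by
    rw [orthonormal_iff_ite]
    intro i j
    rw [LinearIsometryEquiv.inner_map_map, ← gForm_eq_inner_tilt, he]
  have e1 : ∀ i, hForm u x (e i) (e i) = ∑ k, κ k * y i k * y i k := fun i => by
    rw [← h]
    simp [y, untilt_tilt]
  rw [h.curvatureProd_eq, Real.log_prod (fun I hI => (hκ I hI).ne')]
  simp only [e1]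
  exact sum_log_le_of_orthonormal hκ hy

end IsPrincipalFrame

end GraphSurface

/-! ### The surface as a graph over one of its tangent planes -/

namespace GraphSurface

variable {n : ℕ}

/-- The frame map `y ↦ ∑ yₖ vₖ`, where the `vₖ` form a `g`-orthonormal basis. -/
noncomputable def frameMap (u : Eucl n → ℝ) (x : Eucl n) (O : Eucl n ≃ₗᵢ[ℝ] Eucl n) :
    Eucl n →L[ℝ] Eucl n :=
  (untiltL (gradient u x)).comp (O.toContinuousLinearEquiv : Eucl n →L[ℝ] Eucl n)

/-- The slopes `du(vₖ)` of the frame vectors, as a linear form. -/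
noncomputable def slopeForm (u : Eucl n → ℝ) (x : Eucl n) (O : Eucl n ≃ₗᵢ[ℝ] Eucl n) :
    Eucl n →L[ℝ] ℝ :=
  (fderiv ℝ u x).comp (frameMap u x O)

/-- The base point of the point of height `q y` over the point `y` of the tangent plane at `x`. -/
noncomputable def chart (u : Eucl n → ℝ) (x : Eucl n) (O : Eucl n ≃ₗᵢ[ℝ] Eucl n)
    (q : Eucl n → ℝ) (y : Eucl n) : Eucl n :=
  x + frameMap u x O y - (q y / areaFactor u x) • gradient u x

/-- Near the point over `x`, the graph of `u` is the graph of `q` over its tangent plane, which is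
identified with `ℝⁿ` through the frame given by `O`. -/
structure IsTangentGraph (u : Eucl n → ℝ) (x : Eucl n) (O : Eucl n ≃ₗᵢ[ℝ] Eucl n)
    (q : Eucl n → ℝ) : Prop where
  contDiffAt : ContDiffAt ℝ 4 q 0
  zero : q 0 = 0
  eq : ∀ᶠ y in 𝓝 0, u (chart u x O q y) = u x + slopeForm u x O y + q y / areaFactor u x

section

variable {u : Eucl n → ℝ} {x : Eucl n} {O : Eucl n ≃ₗᵢ[ℝ] Eucl n} {q : Eucl n → ℝ}

theorem frameMap_apply (y : Eucl n) : frameMap u x O y = untilt (gradient u x) (O y) := by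
  simp [frameMap, untiltL_apply]

theorem slopeForm_apply (y : Eucl n) :
    slopeForm u x O y = ⟪gradient u x, O y⟫ / areaFactor u x := by
  rw [slopeForm, ContinuousLinearMap.comp_apply, ← inner_grad, frameMap_apply, inner_untilt_self,
    areaFactor_eq]

theorem inner_grad_frameMap (y : Eucl n) : ⟪gradient u x, frameMap u x O y⟫ = slopeForm u x O y := by
  rw [inner_grad]; rfl

theorem areaFactor_sq : areaFactor u x ^ 2 = 1 + ⟪gradient u x, gradient u x⟫ := by
  rw [areaFactor_eq, slopeFactor_sq, real_inner_self_eq_norm_sq]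

theorem inner_frameMap (y y' : Eucl n) : ⟪frameMap u x O y, frameMap u x O y'⟫
    + slopeForm u x O y * slopeForm u x O y' = ⟪y, y'⟫ := by
  rw [← inner_grad_frameMap, ← inner_grad_frameMap, frameMap_apply, frameMap_apply, inner_untilt,
    LinearIsometryEquiv.inner_map_map]

theorem frameMap_norm_sq (y : Eucl n) :
    ‖frameMap u x O y‖ ^ 2 + slopeForm u x O y ^ 2 = ‖y‖ ^ 2 := by
  have := inner_frameMap (u := u) (x := x) (O := O) y y
  rw [real_inner_self_eq_norm_sq, real_inner_self_eq_norm_sq] at this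
  linarith [sq (slopeForm u x O y)]

/-- By the implicit function theorem, a graph is locally a graph over its tangent plane. -/
theorem exists_isTangentGraph (hu : ContDiffAt ℝ 4 u x) (O : Eucl n ≃ₗᵢ[ℝ] Eucl n) :
    ∃ q, IsTangentGraph u x O q := by
  set w := areaFactor u x with hw
  have hw0 : 0 < w := areaFactor_pos u x
  let inner' : Eucl n × ℝ → Eucl n := fun z => x + frameMap u x O z.1 - (z.2 / w) • gradient u x
  let G : Eucl n × ℝ → ℝ := fun z => u (inner' z) - slopeForm u x O z.1 - z.2 / w
  have hin0 : inner' 0 = x := by simp [inner']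
  have hG : ContDiffAt ℝ 4 G 0 := by
    have h1 : ContDiffAt ℝ 4 inner' 0 := by
      refine ContDiffAt.sub ?_ ?_
      · fun_prop
      · exact (contDiffAt_snd.div_const w).smul contDiffAt_const
    have h2 : ContDiffAt ℝ 4 (fun z => u (inner' z)) 0 := by
      refine ContDiffAt.comp (g := u) 0 ?_ h1
      rw [hin0]; exact hu
    refine (h2.sub ?_).sub (contDiffAt_snd.div_const w)
    fun_prop
  have hder : HasFDerivAt (fun t : ℝ => G (0, t))
      (ContinuousLinearMap.toSpanSingleton ℝ (-w)) 0 := by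
    have h1 : HasDerivAt (fun t : ℝ => inner' (0, t)) (-((1 / w) • gradient u x)) 0 := by
      have := (((hasDerivAt_id (0 : ℝ)).div_const w).smul_const (gradient u x)).const_sub x
      simpa [inner'] using this
    have h2 : HasFDerivAt u (fderiv ℝ u x) (inner' (0, (0 : ℝ))) := by
      rw [show ((0 : Eucl n), (0 : ℝ)) = 0 from rfl, hin0]
      exact (hu.differentiableAt (by norm_num)).hasFDerivAt
    have h3 := (h2.comp_hasDerivAt (0 : ℝ) h1).sub ((hasDerivAt_id (0 : ℝ)).div_const w)
    have h4 : HasDerivAt (fun t : ℝ => G (0, t)) (-w) 0 := by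
      have e : (fun t : ℝ => G (0, t)) = (u ∘ fun t : ℝ => inner' (0, t)) - fun t => id t / w := by
        ext t; simp [G]
      rw [e]
      refine h3.congr_deriv ?_
      rw [map_neg, map_smul, ← inner_grad, smul_eq_mul]
      have := areaFactor_sq (u := u) (x := x)
      rw [← hw] at this
      field_simp
      linarith
    exact h4.hasFDerivAt
  have hinv : (fderiv ℝ G 0 ∘L .inr ℝ (Eucl n) ℝ).IsInvertible := by
    have e : fderiv ℝ G 0 ∘L .inr ℝ (Eucl n) ℝ = ContinuousLinearMap.toSpanSingleton ℝ (-w) := by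
      have h1 : HasFDerivAt (fun t : ℝ => ((0 : Eucl n), t)) (.inr ℝ (Eucl n) ℝ) 0 :=
        hasFDerivAt_prodMk_right _ _
      have h2 : HasFDerivAt G (fderiv ℝ G 0) ((0 : Eucl n), (0 : ℝ)) :=
        (hG.differentiableAt (by norm_num)).hasFDerivAt
      exact (h2.comp (0 : ℝ) h1).unique hder
    rw [e]
    refine ⟨ContinuousLinearEquiv.unitsEquivAut ℝ (Units.mk0 (-w) (by linarith)), ?_⟩
    ext
    simp
  refine ⟨hG.implicitFunction (by norm_num) hinv, hG.contDiffAt_implicitFunction (by norm_num) hinv,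
    hG.implicitFunction_apply_self (by norm_num) hinv, ?_⟩
  have := hG.eventually_apply_implicitFunction (by norm_num) hinv
  filter_upwards [this] with y hy
  have h0 : G 0 = u x := by simp [G, hin0]
  rw [h0] at hy
  simp only [G, inner'] at hy
  rw [chart]
  linarith

namespace IsTangentGraph

theorem chart_zero (h : IsTangentGraph u x O q) : chart u x O q 0 = x := by
  simp [chart, h.zero]

theorem contDiffAt_chart (h : IsTangentGraph u x O q) : ContDiffAt ℝ 4 (chart u x O q) 0 := by
  unfold chart
  refine ContDiffAt.sub ?_ ?_
  · fun_prop
  · exact (h.contDiffAt.div_const _).smul contDiffAt_const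

theorem hasFDerivAt_chart {y : Eucl n} (hq : DifferentiableAt ℝ q y) :
    HasFDerivAt (chart u x O q) (frameMap u x O
      - (fderiv ℝ q y).smulRight ((areaFactor u x)⁻¹ • gradient u x)) y := by
  have h1 : HasFDerivAt (fun y => x + frameMap u x O y) (frameMap u x O) y :=
    ((frameMap u x O).hasFDerivAt).const_add x
  have h2 := hq.hasFDerivAt.smul_const ((areaFactor u x)⁻¹ • gradient u x)
  refine (h1.sub h2).congr_of_eventuallyEq (Eventually.of_forall fun y => ?_)
  simp [chart, smul_smul, div_eq_mul_inv]

/-- The image of the tangent vector `e` under the derivative of `chart`. -/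
noncomputable def push (u : Eucl n → ℝ) (x : Eucl n) (O : Eucl n ≃ₗᵢ[ℝ] Eucl n)
    (q : Eucl n → ℝ) (y e : Eucl n) : Eucl n :=
  frameMap u x O e - (fderiv ℝ q y e / areaFactor u x) • gradient u x

/-- The slope `Du(e)` of the push-forward of a tangent vector. -/
theorem fderiv_push (h : IsTangentGraph u x O q) (hu : ContDiffAt ℝ 4 u x) :
    ∀ᶠ y in 𝓝 0, ∀ e, fderiv ℝ u (chart u x O q y) (push u x O q y e)
      = slopeForm u x O e + fderiv ℝ q y e / areaFactor u x := by
  have hqd : ∀ᶠ y in 𝓝 0, DifferentiableAt ℝ q y :=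
    (h.contDiffAt.eventually (by simp)).mono fun y hy => hy.differentiableAt (by norm_num)
  have hud : ∀ᶠ y in 𝓝 0, DifferentiableAt ℝ u (chart u x O q y) := by
    have := (hu.eventually (by simp)).mono fun y hy => hy.differentiableAt (by norm_num)
    rw [← h.chart_zero] at this
    exact h.contDiffAt_chart.continuousAt.eventually this
  filter_upwards [h.eq.eventually_nhds, hqd, hud] with y hy hq hu' e
  have h1 := hu'.hasFDerivAt.comp y (hasFDerivAt_chart (u := u) (x := x) (O := O) hq)
  have h2 : HasFDerivAt (fun y => u x + slopeForm u x O y + q y / areaFactor u x)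
      (slopeForm u x O + (areaFactor u x)⁻¹ • fderiv ℝ q y) y := by
    have := (((slopeForm u x O).hasFDerivAt (x := y)).const_add (u x)).add
      (hq.hasFDerivAt.const_smul (areaFactor u x)⁻¹)
    refine this.congr_of_eventuallyEq (Eventually.of_forall fun y => ?_)
    simp [div_eq_inv_mul]
  have h3 := (h1.congr_of_eventuallyEq (hy.mono fun z hz => hz.symm)).unique h2
  have h4 := congrArg (fun L : Eucl n →L[ℝ] ℝ => L e) h3
  simp only [ContinuousLinearMap.comp_apply, sub_apply, ContinuousLinearMap.smulRight_apply,
    add_apply, smul_apply, smul_eq_mul] at h4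
  rw [push, div_eq_mul_inv, ← smul_smul, h4]
  ring

theorem fderiv_zero (h : IsTangentGraph u x O q) (hu : ContDiffAt ℝ 4 u x) : fderiv ℝ q 0 = 0 := by
  have h1 := (h.fderiv_push hu).self_of_nhds
  ext e
  have h2 := h1 e
  have hw := areaFactor_pos u x
  rw [h.chart_zero, push, map_sub, map_smul, ← inner_grad u x, inner_grad_frameMap,
    ← inner_grad u x, smul_eq_mul] at h2
  have h3 := areaFactor_sq (u := u) (x := x)
  have h4 : fderiv ℝ q 0 e / areaFactor u x * areaFactor u x ^ 2 = 0 := by rw [h3]; linarith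
  rw [div_mul_eq_mul_div, sq] at h4
  field_simp at h4
  simpa [hw.ne'] using h4

/-- The second derivatives of `u` in terms of those of `q`. -/
theorem fderiv_fderiv_push (h : IsTangentGraph u x O q) (hu : ContDiffAt ℝ 4 u x) :
    ∀ᶠ y in 𝓝 0, ∀ e e', fderiv ℝ (fderiv ℝ u) (chart u x O q y) (push u x O q y e)
        (push u x O q y e')
      = fderiv ℝ (fderiv ℝ q) y e e' *
        ((1 + ⟪gradient u x, gradient u (chart u x O q y)⟫) / areaFactor u x) := by
  have hqd : ∀ᶠ y in 𝓝 0, ContDiffAt ℝ 4 q y := h.contDiffAt.eventually (by simp)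
  have hud : ∀ᶠ y in 𝓝 0, ContDiffAt ℝ 4 u (chart u x O q y) := by
    have := hu.eventually (by simp)
    rw [← h.chart_zero] at this
    exact h.contDiffAt_chart.continuousAt.eventually this
  filter_upwards [(h.fderiv_push hu).eventually_nhds, hqd, hud] with y hy hq hu' e e'
  have d1 : HasFDerivAt (fderiv ℝ q) (fderiv ℝ (fderiv ℝ q) y) y :=
    ((hq.fderiv_right (m := 1) (by norm_num)).differentiableAt (by norm_num)).hasFDerivAt
  have d2 : HasFDerivAt (fderiv ℝ u) (fderiv ℝ (fderiv ℝ u) (chart u x O q y)) (chart u x O q y) :=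
    ((hu'.fderiv_right (m := 1) (by norm_num)).differentiableAt (by norm_num)).hasFDerivAt
  have d3 := d2.comp y
    (hasFDerivAt_chart (u := u) (x := x) (O := O) (hq.differentiableAt (by norm_num)))
  have d4 : HasFDerivAt (fun z => push u x O q z e')
      (-(((fderiv ℝ (fderiv ℝ q) y).flip e').smulRight
        ((areaFactor u x)⁻¹ • gradient u x))) y := by
    have a1 : HasFDerivAt (fun z => fderiv ℝ q z e') ((fderiv ℝ (fderiv ℝ q) y).flip e') y := by
      refine (d1.clm_apply (hasFDerivAt_const e' y)).congr_fderiv ?_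
      ext v; simp
    have := (a1.smul_const ((areaFactor u x)⁻¹ • gradient u x)).const_sub (frameMap u x O e')
    refine this.congr_of_eventuallyEq (Eventually.of_forall fun z => ?_)
    simp [push, smul_smul, div_eq_mul_inv]
  have d5 := d3.clm_apply d4
  have d6 : HasFDerivAt (fun z => slopeForm u x O e' + fderiv ℝ q z e' / areaFactor u x)
      ((areaFactor u x)⁻¹ • (fderiv ℝ (fderiv ℝ q) y).flip e') y := by
    have a1 : HasFDerivAt (fun z => fderiv ℝ q z e') ((fderiv ℝ (fderiv ℝ q) y).flip e') y := by
      refine (d1.clm_apply (hasFDerivAt_const e' y)).congr_fderiv ?_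
      ext v; simp
    refine ((a1.const_smul (areaFactor u x)⁻¹).const_add
      (slopeForm u x O e')).congr_of_eventuallyEq (Eventually.of_forall fun z => ?_)
    simp [div_eq_inv_mul]
  have d7 := (d5.congr_of_eventuallyEq (hy.mono fun z hz => (hz e').symm)).unique d6
  have d8 := congrArg (fun L : Eucl n →L[ℝ] ℝ => L e) d7
  have pe : (frameMap u x O - (fderiv ℝ q y).smulRight ((areaFactor u x)⁻¹ • gradient u x)) e
      = push u x O q y e := by
    simp [push, smul_smul, div_eq_mul_inv]
  simp only [ContinuousLinearMap.comp_apply, neg_apply, ContinuousLinearMap.smulRight_apply,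
    add_apply, smul_apply, smul_eq_mul, pe, ContinuousLinearMap.flip_apply, map_neg, map_smul,
    Function.comp_apply] at d8
  rw [← inner_grad u (chart u x O q y) (gradient u x)] at d8
  rw [real_inner_comm]
  have hw := (areaFactor_pos u x).ne'
  field_simp at d8 ⊢
  linarith

end IsTangentGraph

end

end GraphSurface

/-! ### Second fundamental form and normal over the tangent plane -/

theorem tilt_smul {E : Type*} [NormedAddCommGroup E] [InnerProductSpace ℝ E] (D : E) (k : ℝ)
    (z : E) : tilt D (k • z) = k • tilt D z := by
  simp only [tilt, inner_smul_right, smul_add, smul_smul, mul_div_assoc]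

namespace GraphSurface

variable {n : ℕ}

/-- The identification `ℝⁿ × ℝ = ℝⁿ⁺¹`. -/
noncomputable def join (n : ℕ) : Eucl n × ℝ →L[ℝ] Eucl (n + 1) :=
  LinearMap.toContinuousLinearMap
    { toFun := fun z => WithLp.toLp 2 (Fin.snoc (α := fun _ => ℝ) z.1 z.2)
      map_add' := fun z z' => by
        ext i
        refine Fin.lastCases ?_ (fun i => ?_) i <;> simp
      map_smul' := fun k z => by
        ext i
        refine Fin.lastCases ?_ (fun i => ?_) i <;> simp }

theorem join_apply (v : Eucl n) (t : ℝ) :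
    join n (v, t) = WithLp.toLp 2 (Fin.snoc (α := fun _ => ℝ) v t) := rfl

theorem norm_join_sq (v : Eucl n) (t : ℝ) : ‖join n (v, t)‖ ^ 2 = ‖v‖ ^ 2 + t ^ 2 := by
  rw [join_apply, EuclideanSpace.real_norm_sq_eq, EuclideanSpace.real_norm_sq_eq,
    Fin.sum_univ_castSucc]
  simp

theorem normal_eq (u : Eucl n → ℝ) (x : Eucl n) :
    normal u x = join n (-(areaFactor u x)⁻¹ • gradient u x, (areaFactor u x)⁻¹) := by
  rw [join_apply, normal]
  congr 1
  ext i
  refine Fin.lastCases ?_ (fun i => ?_) i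
  · simp
  · simp [grad_apply, div_eq_inv_mul]

theorem norm_normal (u : Eucl n → ℝ) (x : Eucl n) : ‖normal u x‖ = 1 := by
  have h := norm_join_sq (-(areaFactor u x)⁻¹ • gradient u x) (areaFactor u x)⁻¹
  rw [← normal_eq, norm_smul, mul_pow, ← real_inner_self_eq_norm_sq (gradient u x)] at h
  have hw := areaFactor_pos u x
  have h3 := areaFactor_sq (u := u) (x := x)
  have h4 : ‖normal u x‖ ^ 2 = 1 := by
    rw [h, norm_neg, Real.norm_eq_abs, sq_abs]
    field_simp
    linarith
  nlinarith [norm_nonneg (normal u x)]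

/-- The tangent vector of the graph of `u` at `x` with coordinates `y` in the frame given by `O`. -/
noncomputable def tangentMap (u : Eucl n → ℝ) (x : Eucl n) (O : Eucl n ≃ₗᵢ[ℝ] Eucl n) :
    Eucl n →L[ℝ] Eucl (n + 1) :=
  (join n).comp ((frameMap u x O).prod (slopeForm u x O))

section

variable {u : Eucl n → ℝ} {x : Eucl n} {O : Eucl n ≃ₗᵢ[ℝ] Eucl n} {q : Eucl n → ℝ}

theorem norm_tangentMap (y : Eucl n) : ‖tangentMap u x O y‖ = ‖y‖ := by
  have h := norm_join_sq (frameMap u x O y) (slopeForm u x O y)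
  rw [frameMap_norm_sq] at h
  exact (sq_eq_sq₀ (norm_nonneg _) (norm_nonneg _)).1 h

namespace IsTangentGraph

/-- The gradient of `u` in terms of that of `q`. -/
theorem gradient_chart (h : IsTangentGraph u x O q) (hu : ContDiffAt ℝ 4 u x) :
    ∀ᶠ y in 𝓝 0, gradient u (chart u x O q y) = gradient u x
      + ((1 + ⟪gradient u x, gradient u (chart u x O q y)⟫) / areaFactor u x) •
        tilt (gradient u x) (O (gradient q y)) := by
  filter_upwards [h.fderiv_push hu] with y hy
  set D := gradient u x
  set P := gradient u (chart u x O q y)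
  set m := (1 + ⟪D, P⟫) / areaFactor u x with hm
  have key : untilt D (P - D) = m • O (gradient q y) := by
    refine ext_inner_right ℝ fun v => ?_
    obtain ⟨e, rfl⟩ := O.surjective v
    have h1 := hy e
    rw [← inner_grad u, push, inner_sub_right, inner_smul_right, frameMap_apply, slopeForm_apply,
      real_inner_comm D P] at h1
    rw [inner_untilt_left, inner_sub_left, inner_untilt_self, ← areaFactor_eq u x, inner_smul_left,
      LinearIsometryEquiv.inner_map_map, inner_grad q, hm]
    have hw := (areaFactor_pos u x).ne'
    simp only [conj_trivial]
    field_simp at h1 ⊢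
    linarith
  rw [← tilt_smul, ← key, tilt_untilt]
  abel

/-- The factor `m` is the inner product of the unit normal at `x` with the vector `(-Du, 1)` at the
point over `y`. It relates the area factors of the two descriptions of the surface as a graph, and
their second derivatives. -/
theorem areaFactor_chart (h : IsTangentGraph u x O q) (hu : ContDiffAt ℝ 4 u x) :
    ∀ᶠ y in 𝓝 0, ∃ m : ℝ, 0 < m ∧
      m = (1 + ⟪gradient u x, gradient u (chart u x O q y)⟫) / areaFactor u x ∧
      m * ((areaFactor u x)⁻¹ - slopeForm u x O (gradient q y)) = 1 ∧
      areaFactor u (chart u x O q y) = m * slopeFactor (gradient q y) := by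
  have hcont : ContinuousAt (fun y =>
      (1 + fderiv ℝ u (chart u x O q y) (gradient u x)) / areaFactor u x) 0 := by
    have h1 : ContinuousAt (fun y => fderiv ℝ u (chart u x O q y)) 0 := by
      refine ContinuousAt.comp (g := fderiv ℝ u) ?_ h.contDiffAt_chart.continuousAt
      rw [h.chart_zero]
      exact (hu.fderiv_right (m := 3) (by norm_num)).continuousAt
    fun_prop
  have hpos : ∀ᶠ y in 𝓝 0,
      0 < (1 + fderiv ℝ u (chart u x O q y) (gradient u x)) / areaFactor u x := by
    refine hcont.eventually_const_lt ?_
    simp only [h.chart_zero]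
    rw [← inner_grad]
    have := areaFactor_pos u x
    have := real_inner_self_nonneg (x := gradient u x)
    positivity
  filter_upwards [hpos, h.gradient_chart hu] with y hy hg
  rw [← inner_grad, real_inner_comm] at hy
  refine ⟨_, hy, rfl, ?_⟩
  set D := gradient u x
  set P := gradient u (chart u x O q y)
  set m := (1 + ⟪D, P⟫) / areaFactor u x with hm
  have hw := areaFactor_pos u x
  have hwsq : areaFactor u x ^ 2 = 1 + ⟪D, D⟫ := areaFactor_sq
  have e1 : ⟪D, P⟫ = ⟪D, D⟫ + m * (⟪D, O (gradient q y)⟫ * areaFactor u x) := by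
    conv_lhs => rw [hg]
    rw [inner_add_right, inner_smul_right, inner_tilt_self, ← areaFactor_eq u x]
  have e2 : m = areaFactor u x + m * ⟪D, O (gradient q y)⟫ := by
    have : m * areaFactor u x = 1 + ⟪D, P⟫ := by rw [hm]; field_simp
    rw [e1] at this
    have h3 : m * areaFactor u x =
      (areaFactor u x + m * ⟪D, O (gradient q y)⟫) * areaFactor u x := by linarith
    exact mul_right_cancel₀ hw.ne' h3
  constructor
  · rw [slopeForm_apply]
    field_simp
    linarith
  · have e3 : areaFactor u (chart u x O q y) ^ 2 = (m * slopeFactor (gradient q y)) ^ 2 := by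
      rw [areaFactor_sq, mul_pow, slopeFactor_sq]
      have : ⟪P, P⟫ = ⟪D, D⟫ + 2 * m * (⟪D, O (gradient q y)⟫ * areaFactor u x)
          + m ^ 2 * (‖gradient q y‖ ^ 2 + ⟪D, O (gradient q y)⟫ ^ 2) := by
        conv_lhs => rw [hg]
        rw [inner_add_left, inner_add_right, inner_add_right, inner_smul_left, inner_smul_right,
          inner_smul_left, inner_smul_right, inner_tilt,
          real_inner_comm D (tilt D (O (gradient q y))), inner_tilt_self,
          ← areaFactor_eq u x, LinearIsometryEquiv.inner_map_map, real_inner_self_eq_norm_sq (gradient q y)]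
        simp only [conj_trivial]
        ring
      change 1 + ⟪P, P⟫ = _
      rw [this]
      have e4 : m * ⟪D, O (gradient q y)⟫ = m - areaFactor u x := by linarith
      linear_combination (1 - 2 + 1) * hwsq + (2 * areaFactor u x + (m * ⟪D, O (gradient q y)⟫ + m - areaFactor u x)) * e4 - hwsq
    exact (sq_eq_sq₀ (areaFactor_pos _ _).le (mul_nonneg hy.le (slopeFactor_pos _).le)).1 e3

theorem inv_areaFactor_chart (h : IsTangentGraph u x O q) (hu : ContDiffAt ℝ 4 u x) :
    ∀ᶠ y in 𝓝 0, (areaFactor u (chart u x O q y))⁻¹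
      = ((areaFactor u x)⁻¹ - slopeForm u x O (gradient q y)) * (slopeFactor (gradient q y))⁻¹ := by
  filter_upwards [h.areaFactor_chart hu] with y ⟨m, h0, _, h1, h2⟩
  rw [h2, mul_inv, eq_comm, ← eq_inv_of_mul_eq_one_right h1]

theorem hForm_push (h : IsTangentGraph u x O q) (hu : ContDiffAt ℝ 4 u x) :
    ∀ᶠ y in 𝓝 0, ∀ e e', hForm u (chart u x O q y) (push u x O q y e) (push u x O q y e')
      = fderiv ℝ (fderiv ℝ q) y e e' * (slopeFactor (gradient q y))⁻¹ := by
  filter_upwards [h.areaFactor_chart hu, h.fderiv_fderiv_push hu] with y ⟨m, h0, h3, _, h2⟩ h4 e e'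
  rw [hForm, h4, ← h3, h2]
  have := slopeFactor_pos (gradient q y)
  field_simp

theorem gForm_push (h : IsTangentGraph u x O q) (hu : ContDiffAt ℝ 4 u x) :
    ∀ᶠ y in 𝓝 0, ∀ e e', gForm u (chart u x O q y) (push u x O q y e) (push u x O q y e')
      = ⟪e, e'⟫ + fderiv ℝ q y e * fderiv ℝ q y e' := by
  filter_upwards [h.fderiv_push hu] with y hy e e'
  rw [gForm, hy, hy, push, push]
  simp only [inner_sub_left, inner_sub_right, inner_smul_left, inner_smul_right,
    real_inner_comm (gradient u x), inner_grad_frameMap, conj_trivial]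
  rw [← inner_frameMap (u := u) (x := x) (O := O) e e']
  have hw := areaFactor_pos u x
  have h3 : ⟪gradient u x, gradient u x⟫ = areaFactor u x ^ 2 - 1 := by
    rw [areaFactor_sq]; ring
  rw [h3]
  field_simp
  ring

theorem normal_chart (h : IsTangentGraph u x O q) (hu : ContDiffAt ℝ 4 u x) :
    ∀ᶠ y in 𝓝 0, normal u (chart u x O q y)
      = (slopeFactor (gradient q y))⁻¹ • (normal u x - tangentMap u x O (gradient q y)) := by
  filter_upwards [h.areaFactor_chart hu, h.gradient_chart hu] with y ⟨m, h0, h3, h1, h2⟩ hg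
  have hw := areaFactor_pos u x
  have hW := slopeFactor_pos (gradient q y)
  rw [← h3] at hg
  rw [normal_eq, normal_eq, tangentMap, ContinuousLinearMap.comp_apply,
    ContinuousLinearMap.prod_apply, ← map_sub, ← map_smul, h2]
  congr 1
  rw [slopeForm_apply] at h1
  have hmi : m⁻¹ = (areaFactor u x)⁻¹ - ⟪gradient u x, O (gradient q y)⟫ / areaFactor u x :=
    (eq_inv_of_mul_eq_one_right h1).symm
  refine Prod.ext ?_ ?_
  · simp only [Prod.smul_fst, Prod.fst_sub]
    rw [hg, frameMap_apply, mul_inv, smul_add, smul_smul, neg_mul, mul_assoc, mul_comm _ m,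
      ← mul_assoc, inv_mul_cancel₀ h0.ne', hmi, tilt, untilt, ← areaFactor_eq u x]
    match_scalars
    · field_simp
      ring
    · field_simp
  · simp only [Prod.smul_snd, Prod.snd_sub, smul_eq_mul]
    rw [slopeForm_apply, mul_inv, hmi, mul_comm]

end IsTangentGraph

end

end GraphSurface

/-! ### Expansions along the coordinate lines of the tangent plane -/

section

set_option maxSynthPendingDepth 3

theorem Jet2.inner {E : Type*} [NormedAddCommGroup E] [InnerProductSpace ℝ E] {f g : ℝ → E}
    {a b c a' b' c' : E} (hf : Jet2 f a b c) (hg : Jet2 g a' b' c') :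
    Jet2 (fun τ => ⟪f τ, g τ⟫) ⟪a, a'⟫ (⟪a, b'⟫ + ⟪b, a'⟫) (⟪a, c'⟫ + ⟪b, b'⟫ + ⟪c, a'⟫) := by
  exact hf.bilin hg (innerSL ℝ)

theorem Jet2.smul {E : Type*} [NormedAddCommGroup E] [NormedSpace ℝ E] {f : ℝ → ℝ} {g : ℝ → E}
    {a b c : ℝ} {a' b' c' : E} (hf : Jet2 f a b c) (hg : Jet2 g a' b' c') :
    Jet2 (fun τ => f τ • g τ) (a • a') (a • b' + b • a') (a • c' + b • b' + c • a') := by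
  simpa using hf.bilin hg (ContinuousLinearMap.lsmul ℝ ℝ)

section Derivatives

variable {E : Type*} [NormedAddCommGroup E] [NormedSpace ℝ E]

/-- The third derivatives of `q` at the origin. -/
noncomputable def third (q : E → ℝ) (a b c : E) : ℝ :=
  fderiv ℝ (fderiv ℝ (fderiv ℝ q)) 0 a b c

/-- The fourth derivatives of `q` at the origin. -/
noncomputable def fourth (q : E → ℝ) (a b c d : E) : ℝ :=
  fderiv ℝ (fderiv ℝ (fderiv ℝ (fderiv ℝ q))) 0 a b c d

theorem third_symm_left {q : E → ℝ} (h : ContDiffAt ℝ 4 q 0) (a b c : E) :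
    third q a b c = third q b a c := by
  have h1 : ContDiffAt ℝ 3 (fderiv ℝ q) 0 := h.fderiv_right (by norm_num)
  have h2 : IsSymmSndFDerivAt ℝ (fderiv ℝ q) 0 := h1.isSymmSndFDerivAt (by norm_num)
  rw [third, third, h2]

theorem third_symm_right {q : E → ℝ} (h : ContDiffAt ℝ 4 q 0) (a b c : E) :
    third q a b c = third q a c b := by
  have h1 : ContDiffAt ℝ 2 (fderiv ℝ (fderiv ℝ q)) 0 :=
    (h.fderiv_right (m := 3) (by norm_num)).fderiv_right (by norm_num)
  have h2 : ∀ᶠ y in 𝓝 0, fderiv ℝ (fderiv ℝ q) y b c = fderiv ℝ (fderiv ℝ q) y c b := by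
    filter_upwards [h.eventually (by simp)] with y hy
    exact hy.isSymmSndFDerivAt (by norm_num) b c
  have h3 := (h1.differentiableAt (by norm_num)).hasFDerivAt
  have e : ∀ b c : E, HasFDerivAt (fun y => fderiv ℝ (fderiv ℝ q) y b c)
      (((fderiv ℝ (fderiv ℝ (fderiv ℝ q)) 0).flip b).flip c) 0 := fun b c => by
    refine ((h3.clm_apply (hasFDerivAt_const b _)).clm_apply
      (hasFDerivAt_const c _)).congr_fderiv ?_
    ext v; simp
  have h4 := ((e b c).congr_of_eventuallyEq (h2.mono fun y hy => hy.symm)).unique (e c b)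
  exact congrArg (fun L : E →L[ℝ] ℝ => L a) h4

theorem fourth_symm_left {q : E → ℝ} (h : ContDiffAt ℝ 4 q 0) (a b c d : E) :
    fourth q a b c d = fourth q b a c d := by
  have h1 : ContDiffAt ℝ 2 (fderiv ℝ (fderiv ℝ q)) 0 :=
    (h.fderiv_right (m := 3) (by norm_num)).fderiv_right (by norm_num)
  have h2 : IsSymmSndFDerivAt ℝ (fderiv ℝ (fderiv ℝ q)) 0 := h1.isSymmSndFDerivAt (by norm_num)
  rw [fourth, fourth, h2]

theorem fourth_symm_middle {q : E → ℝ} (h : ContDiffAt ℝ 4 q 0) (a b c d : E) :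
    fourth q a b c d = fourth q a c b d := by
  have h1 : ContDiffAt ℝ 1 (fderiv ℝ (fderiv ℝ (fderiv ℝ q))) 0 :=
    ((h.fderiv_right (m := 3) (by norm_num)).fderiv_right (m := 2) (by norm_num)).fderiv_right
      (by norm_num)
  have h2 : ∀ᶠ y in 𝓝 0, fderiv ℝ (fderiv ℝ (fderiv ℝ q)) y b c d
      = fderiv ℝ (fderiv ℝ (fderiv ℝ q)) y c b d := by
    filter_upwards [h.eventually (by simp)] with y hy
    have h3 : IsSymmSndFDerivAt ℝ (fderiv ℝ q) y :=
      ContDiffAt.isSymmSndFDerivAt (n := 3) (hy.fderiv_right (by norm_num)) (by norm_num)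
    rw [h3]
  have h3 := (h1.differentiableAt (by norm_num)).hasFDerivAt
  have e : ∀ b c d : E, HasFDerivAt (fun y => fderiv ℝ (fderiv ℝ (fderiv ℝ q)) y b c d)
      ((((fderiv ℝ (fderiv ℝ (fderiv ℝ (fderiv ℝ q))) 0).flip b).flip c).flip d) 0 := fun b c d => by
    refine (((h3.clm_apply (hasFDerivAt_const b _)).clm_apply
      (hasFDerivAt_const c _)).clm_apply (hasFDerivAt_const d _)).congr_fderiv ?_
    ext v; simp
  have h4 := ((e b c d).congr_of_eventuallyEq (h2.mono fun y hy => hy.symm)).unique (e c b d)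
  exact congrArg (fun L : E →L[ℝ] ℝ => L a) h4

theorem fourth_symm_right {q : E → ℝ} (h : ContDiffAt ℝ 4 q 0) (a b c d : E) :
    fourth q a b c d = fourth q a b d c := by
  have h0 : ContDiffAt ℝ 2 (fderiv ℝ (fderiv ℝ q)) 0 :=
    (h.fderiv_right (m := 3) (by norm_num)).fderiv_right (by norm_num)
  have h1 : ContDiffAt ℝ 1 (fderiv ℝ (fderiv ℝ (fderiv ℝ q))) 0 := h0.fderiv_right (by norm_num)
  have h2 : ∀ᶠ y in 𝓝 0, fderiv ℝ (fderiv ℝ (fderiv ℝ q)) y b c d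
      = fderiv ℝ (fderiv ℝ (fderiv ℝ q)) y b d c := by
    have hs : ∀ᶠ y in 𝓝 0, fderiv ℝ (fderiv ℝ q) y c d = fderiv ℝ (fderiv ℝ q) y d c := by
      filter_upwards [h.eventually (by simp)] with y hy
      exact hy.isSymmSndFDerivAt (by norm_num) c d
    filter_upwards [hs.eventually_nhds, h0.eventually (by simp)] with y hy hy0
    have h3 := (hy0.differentiableAt (by norm_num)).hasFDerivAt
    have e : ∀ b c : E, HasFDerivAt (fun y => fderiv ℝ (fderiv ℝ q) y b c)
        (((fderiv ℝ (fderiv ℝ (fderiv ℝ q)) y).flip b).flip c) y := fun b c => by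
      refine ((h3.clm_apply (hasFDerivAt_const b _)).clm_apply
        (hasFDerivAt_const c _)).congr_fderiv ?_
      ext v; simp
    have h4 := ((e c d).congr_of_eventuallyEq (hy.mono fun y hy => hy.symm)).unique (e d c)
    exact congrArg (fun L : E →L[ℝ] ℝ => L b) h4
  have h3 := (h1.differentiableAt (by norm_num)).hasFDerivAt
  have e : ∀ b c d : E, HasFDerivAt (fun y => fderiv ℝ (fderiv ℝ (fderiv ℝ q)) y b c d)
      ((((fderiv ℝ (fderiv ℝ (fderiv ℝ (fderiv ℝ q))) 0).flip b).flip c).flip d) 0 := fun b c d => by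
    refine (((h3.clm_apply (hasFDerivAt_const b _)).clm_apply
      (hasFDerivAt_const c _)).clm_apply (hasFDerivAt_const d _)).congr_fderiv ?_
    ext v; simp
  have h4 := ((e b c d).congr_of_eventuallyEq (h2.mono fun y hy => hy.symm)).unique (e b d c)
  exact congrArg (fun L : E →L[ℝ] ℝ => L a) h4

theorem fourth_symm_pairs {q : E → ℝ} (h : ContDiffAt ℝ 4 q 0) (a b : E) :
    fourth q a a b b = fourth q b b a a := by
  rw [fourth_symm_middle h a a, fourth_symm_left h a b, fourth_symm_right h b a,
    fourth_symm_middle h b a]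

theorem third_smul (q : E → ℝ) (a b c : E) (k : ℝ) : third q a b (k • c) = k * third q a b c := by
  simp [third]

theorem third_sum {ι : Type*} (s : Finset ι) (q : E → ℝ) (a b : E) (c : ι → E) :
    third q a b (∑ i ∈ s, c i) = ∑ i ∈ s, third q a b (c i) := by
  simp [third]

theorem jet_smul (a : E) : Jet2 (fun τ : ℝ => τ • a) 0 a 0 := by
  simpa using Jet2.line (0 : E) a

/-- The derivative of `q` on a moving vector. -/
theorem jet_fderiv_apply {q : E → ℝ} (h : ContDiffAt ℝ 4 q 0) (h0 : fderiv ℝ q 0 = 0) (e : E)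
    {f : ℝ → E} {a b c : E} (hf : Jet2 f a b c) :
    Jet2 (fun τ : ℝ => fderiv ℝ q (τ • e) (f τ)) 0 (fderiv ℝ (fderiv ℝ q) 0 e a)
      (fderiv ℝ (fderiv ℝ q) 0 e b + 1 / 2 * third q e e a) := by
  have h1 := (jet_smul e).comp (Φ := fderiv ℝ q) (h.fderiv_right (by norm_num))
  have h2 := h1.bilin hf (ContinuousLinearMap.id ℝ (E →L[ℝ] ℝ))
  simpa [h0, third] using h2

/-- The second derivative of `q` on a moving vector. -/
theorem jet_fderiv_fderiv_apply {q : E → ℝ} (h : ContDiffAt ℝ 4 q 0) (e : E)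
    {f : ℝ → E} {a b c : E} (hf : Jet2 f a b c) :
    Jet2 (fun τ : ℝ => fderiv ℝ (fderiv ℝ q) (τ • e) (f τ) (f τ))
      (fderiv ℝ (fderiv ℝ q) 0 a a) (third q e a a + 2 * fderiv ℝ (fderiv ℝ q) 0 a b)
      (1 / 2 * fourth q e e a a + 2 * third q e a b + fderiv ℝ (fderiv ℝ q) 0 b b
        + 2 * fderiv ℝ (fderiv ℝ q) 0 a c) := by
  have h0 := (jet_smul e).comp (Φ := fderiv ℝ (fderiv ℝ q))
    ((h.fderiv_right (m := 3) (by norm_num)).fderiv_right (by norm_num))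
  have h1 := h0.bilin hf (ContinuousLinearMap.id ℝ (E →L[ℝ] E →L[ℝ] ℝ))
  have h2 := h1.bilin hf (ContinuousLinearMap.id ℝ (E →L[ℝ] ℝ))
  have s1 : IsSymmSndFDerivAt ℝ q 0 := h.isSymmSndFDerivAt (by norm_num)
  have s2 := third_symm_right h e b a
  simp only [ContinuousLinearMap.id_apply, add_apply, smul_apply, smul_eq_mul, map_zero,
    zero_add, s1 b a, s1 c a] at h2
  simp only [third, fourth] at s2 ⊢
  rw [s2] at h2
  convert h2 using 1 <;> ring

end Derivatives

section NormalGraph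

variable {n : ℕ}

/-- The standard basis vectors. -/
noncomputable abbrev basisVec (k : Fin n) : Eucl n := EuclideanSpace.single k 1

/-- The graph of `q` is tangent to `ℝⁿ` at the origin, with principal directions along the
coordinate axes and principal curvatures `κ`. -/
structure IsNormalGraph (q : Eucl n → ℝ) (κ : Fin n → ℝ) : Prop where
  contDiffAt : ContDiffAt ℝ 4 q 0
  zero : q 0 = 0
  fderiv_zero : fderiv ℝ q 0 = 0
  hess : ∀ a b, fderiv ℝ (fderiv ℝ q) 0 a b = ∑ i, κ i * a i * b i

namespace IsNormalGraph

variable {q : Eucl n → ℝ} {κ : Fin n → ℝ}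

theorem hess_basisVec (h : IsNormalGraph q κ) (k : Fin n) (a : Eucl n) :
    fderiv ℝ (fderiv ℝ q) 0 (basisVec k) a = κ k * a k := by
  rw [h.hess, Finset.sum_eq_single k]
  · simp
  · intro b _ hb; simp [hb]
  · simp

theorem jet (h : IsNormalGraph q κ) (k : Fin n) :
    Jet2 (fun τ : ℝ => q (τ • basisVec k)) 0 0 (1 / 2 * κ k) := by
  have := (jet_smul (basisVec k)).comp (Φ := q) (h.contDiffAt.of_le (by norm_num))
  convert this using 1
  · exact h.zero.symm
  · simp [h.fderiv_zero]
  · rw [h.hess_basisVec]; simp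

theorem jet_gradient (h : IsNormalGraph q κ) (k : Fin n) :
    Jet2 (fun τ : ℝ => gradient q (τ • basisVec k)) 0 (κ k • basisVec k)
      ((1 / 2 : ℝ) • ∑ i, third q (basisVec k) (basisVec k) (basisVec i) • basisVec i) := by
  have h1 : ∀ i, Jet2 (fun τ : ℝ => fderiv ℝ q (τ • basisVec k) (basisVec i) • basisVec i)
      0 (if i = k then κ k • basisVec k else 0)
      ((1 / 2 * third q (basisVec k) (basisVec k) (basisVec i)) • basisVec i) := fun i => by
    have := (jet_fderiv_apply h.contDiffAt h.fderiv_zero (basisVec k)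
      (Jet2.const (basisVec i))).smul (Jet2.const (basisVec i))
    simp only [h.hess_basisVec] at this
    convert this using 1
    · simp
    · split_ifs with hik
      · subst hik; simp
      · simp [Ne.symm hik]
    · simp
  have h2 := Jet2.sum Finset.univ fun i _ => h1 i
  convert h2 using 1
  · ext τ i
    rw [GraphSurface.grad_apply]
    simp [Pi.single_apply, GraphSurface.pd]
  · simp
  · simp
  · simp only [Finset.smul_sum, smul_smul]

theorem jet_slopeFactor (h : IsNormalGraph q κ) (k : Fin n) :
    Jet2 (fun τ : ℝ => slopeFactor (gradient q (τ • basisVec k))) 1 0 (1 / 2 * κ k ^ 2) := by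
  have h1 := (h.jet_gradient k).inner (h.jet_gradient k)
  have h2 := ((Jet2.const (1 : ℝ)).add h1).sqrt (by simp)
  convert h2 using 1
  · ext τ
    rw [slopeFactor, real_inner_self_eq_norm_sq]
  · simp
  · simp
  · simp only [inner_zero_left, inner_zero_right, inner_smul_left, inner_smul_right,
      EuclideanSpace.inner_single_left]
    simp
    ring

theorem jet_inv_slopeFactor (h : IsNormalGraph q κ) (k : Fin n) :
    Jet2 (fun τ : ℝ => (slopeFactor (gradient q (τ • basisVec k)))⁻¹) 1 0
      (-(1 / 2 * κ k ^ 2)) := by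
  simpa using (h.jet_slopeFactor k).inv one_ne_zero

/-- The second fundamental form evaluated on a moving tangent vector. -/
theorem jet_hess_apply (h : IsNormalGraph q κ) (k : Fin n) {f : ℝ → Eucl n} {a b c : Eucl n}
    (hf : Jet2 f a b c) :
    Jet2 (fun τ : ℝ => fderiv ℝ (fderiv ℝ q) (τ • basisVec k) (f τ) (f τ)
        * (slopeFactor (gradient q (τ • basisVec k)))⁻¹)
      (∑ i, κ i * a i * a i)
      (third q (basisVec k) a a + 2 * ∑ i, κ i * a i * b i)
      (1 / 2 * fourth q (basisVec k) (basisVec k) a a + 2 * third q (basisVec k) a b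
        + ∑ i, κ i * b i * b i + 2 * ∑ i, κ i * a i * c i
        - 1 / 2 * κ k ^ 2 * ∑ i, κ i * a i * a i) := by
  have h3 := (jet_fderiv_fderiv_apply h.contDiffAt (basisVec k) hf).mul (h.jet_inv_slopeFactor k)
  simp only [h.hess] at h3
  convert h3 using 1 <;> ring

/-- The metric evaluated on a moving tangent vector. -/
theorem jet_metric_apply (h : IsNormalGraph q κ) (k : Fin n) {f : ℝ → Eucl n} {a b c : Eucl n}
    (hf : Jet2 f a b c) :
    Jet2 (fun τ : ℝ => ⟪f τ, f τ⟫ + fderiv ℝ q (τ • basisVec k) (f τ)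
        * fderiv ℝ q (τ • basisVec k) (f τ))
      ⟪a, a⟫ (2 * ⟪a, b⟫) (2 * ⟪a, c⟫ + ⟪b, b⟫ + (κ k * a k) ^ 2) := by
  have h1 := jet_fderiv_apply h.contDiffAt h.fderiv_zero (basisVec k) hf
  have h2 := (hf.inner hf).add (h1.mul h1)
  simp only [h.hess_basisVec] at h2
  convert h2 using 1
  · ring
  · rw [real_inner_comm a b]; ring
  · rw [real_inner_comm a c]; ring

/-- The isometry from the metric at the origin to the metric of the graph of `q`. -/
theorem jet_untilt (h : IsNormalGraph q κ) (k : Fin n) {f : ℝ → Eucl n} {a b c : Eucl n}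
    (hf : Jet2 f a b c) :
    Jet2 (fun τ : ℝ => untilt (gradient q (τ • basisVec k)) (f τ)) a b
      (c - (1 / 2 * κ k ^ 2 * a k) • basisVec k) := by
  have h1 := (h.jet_gradient k).inner hf
  have h2 := ((h.jet_slopeFactor k).mul ((Jet2.const 1).add (h.jet_slopeFactor k))).inv
    (by norm_num)
  have h3 := hf.sub ((h1.mul h2).smul (h.jet_gradient k))
  convert h3 using 1
  · ext1 τ
    rw [untilt, div_eq_mul_inv]
  · simp
  · simp
  · simp only [inner_zero_left, zero_mul, zero_smul, zero_add, inner_smul_left, smul_zero, add_zero,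
      EuclideanSpace.inner_single_left, smul_smul]
    congr 2
    simp
    ring

end IsNormalGraph

end NormalGraph

end

/-! ### Variations of the curvature equation -/

section

set_option maxSynthPendingDepth 3

/-- The weights `F_k = ∑_{I ∋ k} 1 / λ_I`: the derivatives of `log ∏ λ_I` with respect to the
principal curvatures, where `λ_I = ∑_{i ∈ I} κ_i`. -/
noncomputable def curvWeight {n : ℕ} (p : ℕ) (κ : Fin n → ℝ) (k : Fin n) : ℝ :=
  ∑ I ∈ pSets n p, if k ∈ I then (∑ i ∈ I, κ i)⁻¹ else 0

theorem sum_pSets_eq_sum_curvWeight {n : ℕ} (p : ℕ) (κ c : Fin n → ℝ) :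
    ∑ I ∈ pSets n p, (∑ i ∈ I, c i) / ∑ i ∈ I, κ i = ∑ k, curvWeight p κ k * c k := by
  simp only [curvWeight, Finset.sum_mul]
  rw [Finset.sum_comm]
  refine Finset.sum_congr rfl fun I _ => ?_
  simp only [ite_mul, zero_mul, Finset.sum_ite_mem, Finset.univ_inter, div_eq_inv_mul,
    Finset.mul_sum]

theorem curvWeight_pos {n p : ℕ} {κ : Fin n → ℝ} (hp : 1 ≤ p) (hpn : p ≤ n)
    (hκ : ∀ I ∈ pSets n p, 0 < ∑ i ∈ I, κ i) (k : Fin n) : 0 < curvWeight p κ k := by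
  obtain ⟨I, hI1, _, hI2⟩ := Finset.exists_subsuperset_card_eq (Finset.subset_univ {k})
    (by simpa using hp) (by simpa using hpn)
  have hk : k ∈ I := hI1 (Finset.mem_singleton_self k)
  have hI : I ∈ pSets n p := Finset.mem_powersetCard.2 ⟨Finset.subset_univ I, hI2⟩
  refine Finset.sum_pos' (fun J hJ => ?_) ⟨I, hI, ?_⟩
  · split_ifs
    · exact (inv_pos.2 (hκ J hJ)).le
    · exact le_rfl
  · rw [if_pos hk]
    exact inv_pos.2 (hκ I hI)

/-! ### The Cayley transform -/

section Cayley

variable {E : Type*} [NormedAddCommGroup E] [InnerProductSpace ℝ E]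

/-- The Cayley transform `(1 - τA/2)⁻¹ (1 + τA/2)` of a skew map with `A³ = -N A`. It takes the
place of `exp (τA)`: a curve of orthogonal maps in closed form, with the same expansion to second
order. -/
noncomputable def cayley (A : E →L[ℝ] E) (N τ : ℝ) (v : E) : E :=
  v + (τ * (1 + τ ^ 2 * (N / 4))⁻¹) • A v + (τ ^ 2 * (1 / 2) * (1 + τ ^ 2 * (N / 4))⁻¹) • A (A v)

theorem inner_cayley {A : E →L[ℝ] E} {N : ℝ} (hN : 0 ≤ N) (hA : ∀ v w, ⟪A v, w⟫ = -⟪v, A w⟫)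
    (hA3 : ∀ v, A (A (A v)) = -N • A v) (τ : ℝ) (v w : E) :
    ⟪cayley A N τ v, cayley A N τ w⟫ = ⟪v, w⟫ := by
  have hd : 0 < 1 + τ ^ 2 * (N / 4) := by positivity
  simp only [cayley, inner_add_left, inner_add_right, inner_smul_left, inner_smul_right, hA, hA3,
    conj_trivial, map_smul]
  field_simp
  ring

theorem jet_cayley (A : E →L[ℝ] E) (N : ℝ) (v : E) :
    Jet2 (fun τ => cayley A N τ v) v (A v) ((1 / 2 : ℝ) • A (A v)) := by
  have h1 : Jet2 (fun τ : ℝ => τ) 0 1 0 := by simpa using Jet2.line (0 : ℝ) 1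
  have h2 : Jet2 (fun τ : ℝ => τ ^ 2) 0 0 1 := by simpa using Jet2.quad (0 : ℝ) 0 1
  have h3 := ((Jet2.const 1).add (h2.mul (Jet2.const (N / 4)))).inv (by norm_num)
  have h4 := ((Jet2.const v).add ((h1.mul h3).smul (Jet2.const (A v)))).add
    (((h2.mul (Jet2.const (1 / 2))).mul h3).smul (Jet2.const (A (A v))))
  convert h4 using 1
  all_goals first | rfl | simp

end Cayley

namespace GraphSurface

variable {n : ℕ} {u : Eucl n → ℝ} {x : Eucl n} {O : Eucl n ≃ₗᵢ[ℝ] Eucl n} {q : Eucl n → ℝ}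
  {κ : Fin n → ℝ}

/-- The infinitesimal rotation taking `e_o` to `r`. -/
noncomputable def infRot (o : Fin n) (r : Eucl n) : Eucl n →L[ℝ] Eucl n :=
  (innerSL ℝ (basisVec o)).smulRight r - (innerSL ℝ r).smulRight (basisVec o)

theorem infRot_apply (o : Fin n) (r v : Eucl n) : infRot o r v = v o • r - ⟪r, v⟫ • basisVec o := by
  simp [infRot, EuclideanSpace.inner_single_left]

theorem infRot_skew (o : Fin n) (r v w : Eucl n) : ⟪infRot o r v, w⟫ = -⟪v, infRot o r w⟫ := by
  simp only [infRot_apply, inner_sub_left, inner_sub_right, inner_smul_left, inner_smul_right,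
    EuclideanSpace.inner_single_left, EuclideanSpace.inner_single_right, conj_trivial,
    real_inner_comm r v]
  simp
  ring

theorem infRot_sq (o : Fin n) {r : Eucl n} (hr : r o = 0) (v : Eucl n) :
    infRot o r (infRot o r v) = -(⟪r, v⟫ • r) - (⟪r, r⟫ * v o) • basisVec o := by
  have e1 : (infRot o r v) o = -⟪r, v⟫ := by
    rw [infRot_apply]; simp [hr]
  have e2 : ⟪r, infRot o r v⟫ = v o * ⟪r, r⟫ := by
    rw [infRot_apply, inner_sub_right, inner_smul_right, inner_smul_right,
      EuclideanSpace.inner_single_right]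
    simp [hr]
  rw [infRot_apply o r (infRot o r v), e1, e2]
  module

theorem infRot_cube (o : Fin n) {r : Eucl n} (hr : r o = 0) (v : Eucl n) :
    infRot o r (infRot o r (infRot o r v)) = -⟪r, r⟫ • infRot o r v := by
  have e1 : (infRot o r v) o = -⟪r, v⟫ := by
    rw [infRot_apply]; simp [hr]
  have e2 : ⟪r, infRot o r v⟫ = v o * ⟪r, r⟫ := by
    rw [infRot_apply, inner_sub_right, inner_smul_right, inner_smul_right,
      EuclideanSpace.inner_single_right]
    simp [hr]
  rw [infRot_sq o hr, e1, e2, infRot_apply]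
  module

namespace IsTangentGraph

theorem isNormalGraph (h : IsTangentGraph u x O q) (hu : ContDiffAt ℝ 4 u x)
    (hF : IsPrincipalFrame u x κ O) : IsNormalGraph q κ where
  contDiffAt := h.contDiffAt
  zero := h.zero
  fderiv_zero := h.fderiv_zero hu
  hess a b := by
    have h1 := (h.hForm_push hu).self_of_nhds a b
    have h2 : ∀ e, push u x O q 0 e = frameMap u x O e := fun e => by
      simp [push, h.fderiv_zero hu]
    have h3 : gradient q 0 = 0 := by
      ext i
      rw [grad_apply, pd, h.fderiv_zero hu]
      simp
    rw [h.chart_zero, h2, h2, frameMap_apply, frameMap_apply, hF, h3] at h1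
    simpa [slopeFactor] using h1.symm

/-- The frame of the tangent spaces along the line `τ ↦ τ e_k`, which turns with
velocity `infRot o r`. -/
noncomputable def movingFrame (q : Eucl n → ℝ) (k o : Fin n) (r : Eucl n) (i : Fin n) (τ : ℝ) :
    Eucl n :=
  untilt (gradient q (τ • basisVec k)) (cayley (infRot o r) ⟪r, r⟫ τ (basisVec i))

/-- Schur's inequality for the turning frame. -/
theorem log_curvatureProd_le (h : IsTangentGraph u x O q) (hu : ContDiffAt ℝ 4 u x) {p : ℕ}
    (hadm : ∀ᶠ x' in 𝓝 x, (∀ s ∈ (principalCurvatures u x').powersetCard p, 0 ≤ s.sum) ∧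
      0 < curvatureProd p u x') (k o : Fin n) {r : Eucl n} (hr : r o = 0) :
    ∀ᶠ τ : ℝ in 𝓝 0, Real.log (curvatureProd p u (chart u x O q (τ • basisVec k)))
      ≤ ∑ I ∈ pSets n p, Real.log (∑ i ∈ I,
        fderiv ℝ (fderiv ℝ q) (τ • basisVec k) (movingFrame q k o r i τ) (movingFrame q k o r i τ)
          * (slopeFactor (gradient q (τ • basisVec k)))⁻¹) := by
  have hline : Tendsto (fun τ : ℝ => τ • basisVec k) (𝓝 0) (𝓝 0) :=
    (jet_smul (basisVec k)).tendsto
  have hch := h.contDiffAt_chart.continuousAt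
  rw [ContinuousAt, h.chart_zero] at hch
  filter_upwards [hline.eventually (h.hForm_push hu), hline.eventually (h.gForm_push hu),
    (hch.comp hline).eventually hadm,
    (hch.comp hline).eventually (hu.eventually (by simp))] with τ h1 h2 h3 h4
  obtain ⟨κ', O', hF⟩ := exists_isPrincipalFrame (u := u)
    (x := chart u x O q (τ • basisVec k)) (h4.isSymmSndFDerivAt (by norm_num))
  have h5 := hF.schur (p := p) (fun I hI => hF.sum_pos h3.1 h3.2 hI)
    (e := fun i => push u x O q (τ • basisVec k) (movingFrame q k o r i τ)) fun i j => by
      rw [h2, movingFrame, movingFrame, ← inner_grad q, ← inner_grad q, inner_untilt,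
        inner_cayley real_inner_self_nonneg (infRot_skew o r) (infRot_cube o hr)]
      simp [EuclideanSpace.inner_single_left]
  simpa only [h1] using h5.2

end IsTangentGraph

end GraphSurface

namespace IsNormalGraph

open GraphSurface GraphSurface.IsTangentGraph

variable {n : ℕ} {q : Eucl n → ℝ} {κ : Fin n → ℝ}

theorem jet_movingFrame (h : IsNormalGraph q κ) (k o : Fin n) {r : Eucl n} (hr : r o = 0)
    (i : Fin n) :
    Jet2 (movingFrame q k o r i) (basisVec i) (infRot o r (basisVec i))
      ((1 / 2 : ℝ) • (-(r i • r) - (⟪r, r⟫ * basisVec i o) • basisVec o)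
        - (1 / 2 * κ k ^ 2 * basisVec i k) • basisVec k) := by
  have := h.jet_untilt k (jet_cayley (infRot o r) ⟪r, r⟫ (basisVec i))
  rw [infRot_sq o hr] at this
  have e : ⟪r, basisVec i⟫ = r i := by simp [EuclideanSpace.inner_single_right]
  rw [e] at this
  exact this

/-- The diagonal entries of the second fundamental form in the turning frame, and the resulting
expansion of the upper bound for the curvature function. -/
theorem variation (h : IsNormalGraph q κ) {p : ℕ} (hκ : ∀ I ∈ pSets n p, 0 < ∑ i ∈ I, κ i)
    (k o : Fin n) {r : Eucl n} (hr : r o = 0) {Y : ℝ → ℝ} {y0 y1 y2 : ℝ} (hY : Jet2 Y y0 y1 y2)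
    (h0 : y0 = ∑ I ∈ pSets n p, Real.log (∑ i ∈ I, κ i))
    (hle : ∀ᶠ τ : ℝ in 𝓝 0, Y τ ≤ ∑ I ∈ pSets n p, Real.log (∑ i ∈ I,
        fderiv ℝ (fderiv ℝ q) (τ • basisVec k) (movingFrame q k o r i τ) (movingFrame q k o r i τ)
          * (slopeFactor (gradient q (τ • basisVec k)))⁻¹)) :
    y1 = ∑ i, curvWeight p κ i * (third q (basisVec k) (basisVec i) (basisVec i)
        + 2 * (κ i * infRot o r (basisVec i) i)) ∧
    y2 ≤ ∑ i, curvWeight p κ i *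
      (1 / 2 * fourth q (basisVec k) (basisVec k) (basisVec i) (basisVec i)
        + 2 * third q (basisVec k) (basisVec i) (infRot o r (basisVec i))
        + ∑ j, κ j * infRot o r (basisVec i) j * infRot o r (basisVec i) j
        + 2 * (κ i * ((1 / 2) * (-(r i * r i) - ⟪r, r⟫ * basisVec i o * basisVec o i)
          - 1 / 2 * κ k ^ 2 * basisVec i k * basisVec k i))
        - 1 / 2 * κ k ^ 2 * κ i) := by
  have ha := fun i => h.jet_hess_apply k (h.jet_movingFrame k o hr i)
  have hs : ∀ (i : Fin n) (v : Eucl n), ∑ j, κ j * basisVec i j * v j = κ i * v i := fun i v => by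
    rw [← h.hess, h.hess_basisVec]
  have hb : ∀ i : Fin n, basisVec i i = 1 := fun i => by simp
  have hJ := Jet2.sum (pSets n p) fun I hI =>
    (Jet2.sum I fun i _ => ha i).log (by simpa only [hs, hb, mul_one] using hκ I hI)
  subst h0
  have hl : ∑ I ∈ pSets n p, Real.log (∑ i ∈ I, ∑ j, κ j * basisVec i j * basisVec i j)
      = ∑ I ∈ pSets n p, Real.log (∑ i ∈ I, κ i) := by
    simp only [hs, hb, mul_one]
  rw [hl] at hJ
  have hmain := hY.le_of_eventually_le hJ hle
  simp only [hs, hb, mul_one] at hmain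
  rw [sum_pSets_eq_sum_curvWeight] at hmain
  refine ⟨hmain.1, hmain.2.trans ?_⟩
  rw [Finset.sum_sub_distrib, sum_pSets_eq_sum_curvWeight]
  have hnn : 0 ≤ ∑ I ∈ pSets n p, 1 / 2 * ((∑ i ∈ I, (third q (basisVec k) (basisVec i) (basisVec i)
      + 2 * (κ i * infRot o r (basisVec i) i))) / ∑ i ∈ I, κ i) ^ 2 :=
    Finset.sum_nonneg fun I _ => by positivity
  refine (sub_le_self _ hnn).trans (le_of_eq (Finset.sum_congr rfl fun i _ => ?_))
  congr 2

/-- The first derivative of the equation along a coordinate line. -/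
theorem first_variation (h : IsNormalGraph q κ) {p : ℕ}
    (hκ : ∀ I ∈ pSets n p, 0 < ∑ i ∈ I, κ i) (k : Fin n) {Y : ℝ → ℝ} {y0 y1 y2 : ℝ}
    (hY : Jet2 Y y0 y1 y2) (h0 : y0 = ∑ I ∈ pSets n p, Real.log (∑ i ∈ I, κ i))
    (hle : ∀ᶠ τ : ℝ in 𝓝 0, Y τ ≤ ∑ I ∈ pSets n p, Real.log (∑ i ∈ I,
        fderiv ℝ (fderiv ℝ q) (τ • basisVec k) (movingFrame q k k 0 i τ) (movingFrame q k k 0 i τ)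
          * (slopeFactor (gradient q (τ • basisVec k)))⁻¹)) :
    y1 = ∑ i, curvWeight p κ i * third q (basisVec k) (basisVec i) (basisVec i) := by
  rw [(h.variation hκ k k (r := 0) (by simp) hY h0 hle).1]
  simp [infRot_apply]

/-- The second derivative of the equation along the line of the index `o`, as an inequality: the
frame turns with speed `r` in the planes which contain `basisVec o`. -/
theorem second_variation (h : IsNormalGraph q κ) {p : ℕ}
    (hκ : ∀ I ∈ pSets n p, 0 < ∑ i ∈ I, κ i) (o : Fin n) {r : Eucl n} (hr : r o = 0)
    {Y : ℝ → ℝ} {y0 y1 y2 : ℝ}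
    (hY : Jet2 Y y0 y1 y2) (h0 : y0 = ∑ I ∈ pSets n p, Real.log (∑ i ∈ I, κ i))
    (hle : ∀ᶠ τ : ℝ in 𝓝 0, Y τ ≤ ∑ I ∈ pSets n p, Real.log (∑ i ∈ I,
        fderiv ℝ (fderiv ℝ q) (τ • basisVec o) (movingFrame q o o r i τ) (movingFrame q o o r i τ)
          * (slopeFactor (gradient q (τ • basisVec o)))⁻¹)) :
    y2 ≤ 1 / 2 * ∑ i, curvWeight p κ i * fourth q (basisVec i) (basisVec i) (basisVec o) (basisVec o)
      - curvWeight p κ o * κ o ^ 3 - 1 / 2 * κ o ^ 2 * ∑ i, curvWeight p κ i * κ i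
      + ∑ i, (curvWeight p κ o - curvWeight p κ i) *
          (2 * r i * third q (basisVec o) (basisVec o) (basisVec i) - r i ^ 2 * (κ o - κ i)) := by
  refine (h.variation hκ o o hr hY h0 hle).2.trans (le_of_eq ?_)
  set T : Fin n → ℝ := fun l => third q (basisVec o) (basisVec o) (basisVec l) with hT
  have hrT : third q (basisVec o) (basisVec o) r = ∑ l, r l * T l := by
    conv_lhs => rw [← GraphSurface.sum_smul_single r]
    rw [third_sum]
    simp only [third_smul, hT]
  have hrr : ⟪r, r⟫ = ∑ l, r l ^ 2 := by
    rw [real_inner_self_eq_norm_sq, EuclideanSpace.real_norm_sq_eq]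
  have hoff : ∀ i, i ≠ o → infRot o r (basisVec i) = -r i • basisVec o := fun i hi => by
    rw [infRot_apply]
    simp [hi.symm, EuclideanSpace.inner_single_right]
  have hon : infRot o r (basisVec o) = r := by
    rw [infRot_apply]
    simp [EuclideanSpace.inner_single_right, hr]
  have key : ∀ i, curvWeight p κ i *
      (1 / 2 * fourth q (basisVec o) (basisVec o) (basisVec i) (basisVec i)
        + 2 * third q (basisVec o) (basisVec i) (infRot o r (basisVec i))
        + ∑ j, κ j * infRot o r (basisVec i) j * infRot o r (basisVec i) j
        + 2 * (κ i * ((1 / 2) * (-(r i * r i) - ⟪r, r⟫ * basisVec i o * basisVec o i)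
          - 1 / 2 * κ o ^ 2 * basisVec i o * basisVec o i))
        - 1 / 2 * κ o ^ 2 * κ i)
      = 1 / 2 * (curvWeight p κ i * fourth q (basisVec i) (basisVec i) (basisVec o) (basisVec o))
        - 1 / 2 * κ o ^ 2 * (curvWeight p κ i * κ i)
        - curvWeight p κ i * (2 * r i * T i - r i ^ 2 * (κ o - κ i))
        + if i = o then curvWeight p κ o *
          (∑ l, (2 * r l * T l - r l ^ 2 * (κ o - κ l)) - κ o ^ 3) else 0 := by
    intro i
    rw [fourth_symm_pairs h.contDiffAt (basisVec o)]
    rcases eq_or_ne i o with rfl | hi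
    · rw [hon, hrT, hrr, if_pos rfl, hr]
      have e : ∑ l, (2 * r l * T l - r l ^ 2 * (κ i - κ l))
          = 2 * ∑ l, r l * T l + ∑ l, κ l * r l * r l - κ i * ∑ l, r l ^ 2 := by
        rw [Finset.mul_sum, Finset.mul_sum, ← Finset.sum_add_distrib, ← Finset.sum_sub_distrib]
        exact Finset.sum_congr rfl fun l _ => by ring
      have hb : basisVec i i = 1 := by simp
      rw [e, hb]
      ring
    · rw [hoff i hi, third_smul, third_symm_right h.contDiffAt, if_neg hi]
      have e : ∑ j, κ j * (-r i • basisVec o) j * (-r i • basisVec o) j = κ o * r i ^ 2 := by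
        rw [← h.hess]
        simp only [map_smul, smul_apply, smul_eq_mul, h.hess_basisVec]
        simp
        ring
      rw [e]
      simp only [hT, PiLp.single_apply, if_neg hi.symm, if_neg hi]
      ring
  rw [Finset.sum_congr rfl fun i _ => key i]
  simp only [Finset.sum_add_distrib, Finset.sum_sub_distrib, Finset.sum_ite_eq', Finset.mem_univ,
    if_true, ← Finset.mul_sum, sub_mul]
  ring

/-- The optimal rotation speed in the second variation of the equation. -/
theorem second_variation_opt (h : IsNormalGraph q κ) {p : ℕ}
    (hκ : ∀ I ∈ pSets n p, 0 < ∑ i ∈ I, κ i) (o : Fin n)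
    {Y : ℝ → ℝ} {y0 y1 y2 : ℝ}
    (hY : Jet2 Y y0 y1 y2) (h0 : y0 = ∑ I ∈ pSets n p, Real.log (∑ i ∈ I, κ i))
    (hle : ∀ r : Eucl n, r o = 0 → ∀ᶠ τ : ℝ in 𝓝 0, Y τ ≤ ∑ I ∈ pSets n p, Real.log (∑ i ∈ I,
        fderiv ℝ (fderiv ℝ q) (τ • basisVec o) (movingFrame q o o r i τ) (movingFrame q o o r i τ)
          * (slopeFactor (gradient q (τ • basisVec o)))⁻¹)) :
    2 * y2 + 2 * curvWeight p κ o * κ o ^ 3 + κ o ^ 2 * ∑ i, curvWeight p κ i * κ i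
      + 2 * ∑ i, (curvWeight p κ i - curvWeight p κ o) *
          (third q (basisVec o) (basisVec o) (basisVec i) ^ 2 / (κ o - κ i))
      ≤ ∑ i, curvWeight p κ i * fourth q (basisVec i) (basisVec i) (basisVec o) (basisVec o) := by
  -- this speed makes each term of the last sum in `second_variation` extremal in `r i`; for
  -- `κ i = κ o`, in particular for `i = o`, division by zero gives the speed zero
  let r : Eucl n := WithLp.toLp 2 fun i =>
    third q (basisVec o) (basisVec o) (basisVec i) / (κ o - κ i)
  have hr : r o = 0 := by simp [r]
  have hv := h.second_variation hκ o hr hY h0 (hle r hr)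
  have e : ∑ i, (curvWeight p κ o - curvWeight p κ i) *
          (2 * r i * third q (basisVec o) (basisVec o) (basisVec i) - r i ^ 2 * (κ o - κ i))
      = -∑ i, (curvWeight p κ i - curvWeight p κ o) *
          (third q (basisVec o) (basisVec o) (basisVec i) ^ 2 / (κ o - κ i)) := by
    rw [← Finset.sum_neg_distrib]
    refine Finset.sum_congr rfl fun i _ => ?_
    simp only [r]
    rcases eq_or_ne (κ o - κ i) 0 with hd | hd
    · simp [hd]
    · field_simp
      ring
  rw [e] at hv
  linarith

end IsNormalGraph

end

/-! ### Variations of the test function -/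

section

set_option maxSynthPendingDepth 3

namespace IsNormalGraph

variable {n : ℕ} {q : Eucl n → ℝ} {κ : Fin n → ℝ}

/-- The logarithm of the largest principal curvature along a line transversal to its direction. -/
theorem jet_log_curv (h : IsNormalGraph q κ) {k o : Fin n} (hk : k ≠ o) (ho : 0 < κ o) :
    Jet2 (fun τ : ℝ =>
        Real.log (fderiv ℝ (fderiv ℝ q) (τ • basisVec k) (basisVec o) (basisVec o)
          * (slopeFactor (gradient q (τ • basisVec k)))⁻¹)
        - Real.log (⟪(basisVec o : Eucl n), basisVec o⟫ + fderiv ℝ q (τ • basisVec k) (basisVec o)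
          * fderiv ℝ q (τ • basisVec k) (basisVec o)))
      (Real.log (κ o)) (third q (basisVec o) (basisVec o) (basisVec k) / κ o)
      (1 / 2 * fourth q (basisVec k) (basisVec k) (basisVec o) (basisVec o) / κ o
        - 1 / 2 * κ k ^ 2
        - 1 / 2 * (third q (basisVec o) (basisVec o) (basisVec k) / κ o) ^ 2) := by
  have hs : ∀ v : Eucl n, ∑ j, κ j * basisVec o j * v j = κ o * v o := fun v => by
    rw [← h.hess, h.hess_basisVec]
  have h1 := h.jet_hess_apply k (Jet2.const (basisVec o))
  have h2 := h.jet_metric_apply k (Jet2.const (basisVec o))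
  have hoo : (basisVec o : Eucl n) o = 1 := by simp
  have hin : ⟪(basisVec o : Eucl n), basisVec o⟫ = 1 := by simp
  have hok : (basisVec o : Eucl n) k = 0 := by simp [hk]
  simp only [hs, hoo, mul_one] at h1
  have h3 := (h1.log ho).sub (h2.log (by rw [hin]; exact one_pos))
  rw [third_symm_left h.contDiffAt, third_symm_right h.contDiffAt] at h3
  convert h3 using 1
  · rw [hin]; simp
  · simp
  · have h0 : third q (basisVec k) (basisVec o) 0 = 0 := by
      simpa using third_smul q (basisVec k) (basisVec o) 0 0
    rw [h0, hin, hok]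
    simp
    field_simp

/-- The logarithm of the second fundamental form along its top direction, evaluated on a vector
which turns with velocity `ξ`. -/
theorem jet_log_curv_self (h : IsNormalGraph q κ) {o : Fin n} (ho : 0 < κ o) {ξ : Eucl n}
    (hξ : ξ o = 0) :
    Jet2 (fun τ : ℝ =>
        Real.log (fderiv ℝ (fderiv ℝ q) (τ • basisVec o) (basisVec o + τ • ξ) (basisVec o + τ • ξ)
          * (slopeFactor (gradient q (τ • basisVec o)))⁻¹)
        - Real.log (⟪basisVec o + τ • ξ, basisVec o + τ • ξ⟫
          + fderiv ℝ q (τ • basisVec o) (basisVec o + τ • ξ)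
          * fderiv ℝ q (τ • basisVec o) (basisVec o + τ • ξ)))
      (Real.log (κ o)) (third q (basisVec o) (basisVec o) (basisVec o) / κ o)
      (1 / 2 * fourth q (basisVec o) (basisVec o) (basisVec o) (basisVec o) / κ o
        - 3 / 2 * κ o ^ 2
        - 1 / 2 * (third q (basisVec o) (basisVec o) (basisVec o) / κ o) ^ 2
        + (∑ l, (2 * ξ l * third q (basisVec o) (basisVec o) (basisVec l)
          - (κ o - κ l) * ξ l ^ 2)) / κ o) := by
  have hs : ∀ v : Eucl n, ∑ j, κ j * basisVec o j * v j = κ o * v o := fun v => by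
    rw [← h.hess, h.hess_basisVec]
  have h1 := h.jet_hess_apply o (Jet2.line (basisVec o) ξ)
  have h2 := h.jet_metric_apply o (Jet2.line (basisVec o) ξ)
  have hoo : (basisVec o : Eucl n) o = 1 := by simp
  have hin : ⟪(basisVec o : Eucl n), basisVec o⟫ = 1 := by simp
  have hin2 : ⟪(basisVec o : Eucl n), ξ⟫ = 0 := by simp [EuclideanSpace.inner_single_left, hξ]
  simp only [hs, hoo, hξ, mul_one] at h1
  have h3 := (h1.log ho).sub (h2.log (by rw [hin]; exact one_pos))
  have hT : third q (basisVec o) (basisVec o) ξ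
      = ∑ l, ξ l * third q (basisVec o) (basisVec o) (basisVec l) := by
    conv_lhs => rw [← GraphSurface.sum_smul_single ξ]
    rw [third_sum]
    simp only [third_smul]
  have hξξ : ⟪ξ, ξ⟫ = ∑ l, ξ l ^ 2 := by
    rw [real_inner_self_eq_norm_sq, EuclideanSpace.real_norm_sq_eq]
  have e : ∑ l, (2 * ξ l * third q (basisVec o) (basisVec o) (basisVec l)
      - (κ o - κ l) * ξ l ^ 2) = 2 * ∑ l, ξ l * third q (basisVec o) (basisVec o) (basisVec l)
        + ∑ l, κ l * ξ l * ξ l - κ o * ∑ l, ξ l ^ 2 := by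
    rw [Finset.mul_sum, Finset.mul_sum, ← Finset.sum_add_distrib, ← Finset.sum_sub_distrib]
    exact Finset.sum_congr rfl fun l _ => by ring
  rw [hin, hin2, hξξ, hT, inner_zero_right] at h3
  convert h3 using 1
  · rw [Real.log_one, sub_zero]
  · simp
  · rw [e, hoo]
    simp
    field_simp
    ring

end IsNormalGraph

namespace GraphSurface

variable {n : ℕ} {u : Eucl n → ℝ} {x : Eucl n} {O : Eucl n ≃ₗᵢ[ℝ] Eucl n} {q : Eucl n → ℝ}
  {κ : Fin n → ℝ}

namespace IsTangentGraph

theorem jet_chart (hn : IsNormalGraph q κ) (k : Fin n) :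
    Jet2 (fun τ : ℝ => chart u x O q (τ • basisVec k)) x (frameMap u x O (basisVec k))
      (-(1 / 2 * κ k * (areaFactor u x)⁻¹) • gradient u x) := by
  have h1 := ((Jet2.const x).add ((jet_smul (basisVec k)).clm (frameMap u x O))).sub
    (((hn.jet k).const_mul (areaFactor u x)⁻¹).smul (Jet2.const (gradient u x)))
  convert h1 using 1
  · ext1 τ
    rw [chart, div_eq_inv_mul]
  · simp
  · simp
  · simp
    module

theorem jet_height (h : IsTangentGraph u x O q) (hn : IsNormalGraph q κ) (k : Fin n) :
    Jet2 (fun τ : ℝ => u (chart u x O q (τ • basisVec k))) (u x) (slopeForm u x O (basisVec k))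
      (1 / 2 * κ k * (areaFactor u x)⁻¹) := by
  have h1 := ((Jet2.const (u x)).add ((jet_smul (basisVec k)).clm (slopeForm u x O))).add
    ((hn.jet k).const_mul (areaFactor u x)⁻¹)
  have h2 := h1.congr (g := fun τ : ℝ => u (chart u x O q (τ • basisVec k))) (by
    filter_upwards [(jet_smul (basisVec k)).tendsto.eventually h.eq] with τ hτ
    rw [hτ]
    ring)
  convert h2 using 1
  · simp
  · simp
  · simp
    ring

theorem jet_inv_areaFactor (h : IsTangentGraph u x O q) (hu : ContDiffAt ℝ 4 u x)
    (hn : IsNormalGraph q κ) (k : Fin n) :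
    Jet2 (fun τ : ℝ => (areaFactor u (chart u x O q (τ • basisVec k)))⁻¹) (areaFactor u x)⁻¹
      (-(κ k * slopeForm u x O (basisVec k)))
      (-(1 / 2 * ∑ i, third q (basisVec k) (basisVec k) (basisVec i) * slopeForm u x O (basisVec i))
        - 1 / 2 * κ k ^ 2 * (areaFactor u x)⁻¹) := by
  have h1 := ((Jet2.const (areaFactor u x)⁻¹).sub ((hn.jet_gradient k).clm (slopeForm u x O))).mul
    (hn.jet_inv_slopeFactor k)
  have h2 := h1.congr (g := fun τ : ℝ => (areaFactor u (chart u x O q (τ • basisVec k)))⁻¹) (by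
    filter_upwards [(jet_smul (basisVec k)).tendsto.eventually (h.inv_areaFactor_chart hu)]
      with τ hτ
    rw [hτ])
  convert h2 using 1
  · simp
  · simp
  · simp only [map_smul, map_sum, smul_eq_mul, map_zero]
    ring

theorem jet_normal (h : IsTangentGraph u x O q) (hu : ContDiffAt ℝ 4 u x)
    (hn : IsNormalGraph q κ) (k : Fin n) :
    Jet2 (fun τ : ℝ => normal u (chart u x O q (τ • basisVec k))) (normal u x)
      (-(κ k • tangentMap u x O (basisVec k)))
      (-((1 / 2 * κ k ^ 2) • normal u x) - (1 / 2 : ℝ) •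
        ∑ i, third q (basisVec k) (basisVec k) (basisVec i) • tangentMap u x O (basisVec i)) := by
  have h1 := (hn.jet_inv_slopeFactor k).smul
    ((Jet2.const (normal u x)).sub ((hn.jet_gradient k).clm (tangentMap u x O)))
  have h2 := h1.congr (g := fun τ : ℝ => normal u (chart u x O q (τ • basisVec k))) (by
    filter_upwards [(jet_smul (basisVec k)).tendsto.eventually (h.normal_chart hu)]
      with τ hτ
    rw [hτ])
  convert h2 using 1
  · simp
  · simp
  · simp only [map_smul, map_sum, map_zero]
    module

end IsTangentGraph

end GraphSurface

end

/-! ### Maximum points of the test function -/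

section

set_option maxSynthPendingDepth 3

namespace GraphSurface

variable {n : ℕ}

/-- The function maximised over `x'` in the sup-convolution of `u` at `x`. -/
noncomputable def supKernel (u : Eucl n → ℝ) (ρ : ℝ) (x x' : Eucl n) : ℝ :=
  u x' - ‖x - x'‖ ^ 2 / (2 * ρ)

/-- The logarithm of the quantity to which the maximum principle is applied. -/
noncomputable def testFn (u : Eucl n → ℝ) (t ρ β a B : ℝ) (x x' e : Eucl n) : ℝ :=
  Real.log (hForm u x e e) - Real.log (gForm u x e e) + β * Real.log (-u x - t / 2)
    - Real.log ((areaFactor u x)⁻¹ - a) + B * Real.exp (3 / ρ * supKernel u ρ x x')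

/-- The test function has a local maximum at the points `x, x'` and the principal direction with
index `o`. The graph is described over its tangent plane at `x` by the function `q`. -/
structure IsTestMax (u : Eucl n → ℝ) (t ρ β a B : ℝ) (x x' : Eucl n) (O : Eucl n ≃ₗᵢ[ℝ] Eucl n)
    (q : Eucl n → ℝ) (κ : Fin n → ℝ) (o : Fin n) : Prop where
  contDiffAt : ContDiffAt ℝ 4 u x
  contDiffAt' : ContDiffAt ℝ 2 u x'
  graph : IsTangentGraph u x O q
  frame : IsPrincipalFrame u x κ O
  le_top : ∀ i, κ i ≤ κ o
  top_pos : 0 < κ o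
  height_pos : 0 < -u x - t / 2
  slope_lt : a < (areaFactor u x)⁻¹
  rho_pos : 0 < ρ
  B_pos : 0 < B
  max : ∀ᶠ z : Eucl n × Eucl n in 𝓝 (x, x'), ∀ e, 0 < hForm u z.1 e e →
    testFn u t ρ β a B z.1 z.2 e ≤ testFn u t ρ β a B x x' (frameMap u x O (basisVec o))

namespace IsTestMax

variable {u : Eucl n → ℝ} {t ρ β a B : ℝ} {x x' : Eucl n} {O : Eucl n ≃ₗᵢ[ℝ] Eucl n}
  {q : Eucl n → ℝ} {κ : Fin n → ℝ} {o : Fin n}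

theorem normalGraph (h : IsTestMax u t ρ β a B x x' O q κ o) : IsNormalGraph q κ :=
  h.graph.isNormalGraph h.contDiffAt h.frame

theorem hForm_top (h : IsTestMax u t ρ β a B x x' O q κ o) :
    hForm u x (frameMap u x O (basisVec o)) (frameMap u x O (basisVec o)) = κ o := by
  rw [frameMap_apply, h.frame, ← h.normalGraph.hess, h.normalGraph.hess_basisVec]
  simp

theorem gForm_top :
    gForm u x (frameMap u x O (basisVec o)) (frameMap u x O (basisVec o)) = 1 := by
  rw [frameMap_apply, gForm_untilt, LinearIsometryEquiv.inner_map_map]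
  simp

/-- Maximality in the second point: the gradient there, and the bound on the second derivatives
which holds at the points where a sup-convolution is attained. -/
theorem second_point (h : IsTestMax u t ρ β a B x x' O q κ o) (v : Eucl n) :
    fderiv ℝ u x' v = -(⟪x - x', v⟫ / ρ) ∧ fderiv ℝ (fderiv ℝ u) x' v v ≤ ‖v‖ ^ 2 / ρ := by
  have hρ := h.rho_pos
  have h1 := (Jet2.line x' v).comp (Φ := u) h.contDiffAt'
  have h2 := (Jet2.const x).sub (Jet2.line x' v)
  have h3 := h1.sub ((h2.inner h2).const_mul (1 / (2 * ρ)))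
  have hlim : Tendsto (fun τ : ℝ => (x, x' + τ • v)) (𝓝 0) (𝓝 (x, x')) := by
    have : Continuous fun τ : ℝ => (x, x' + τ • v) := by fun_prop
    simpa using this.tendsto 0
  have h4 := h3.of_isLocalMax (by
    filter_upwards [hlim.eventually h.max] with τ hτ
    have := hτ (frameMap u x O (basisVec o)) (by rw [h.hForm_top]; exact h.top_pos)
    simp only [testFn, add_le_add_iff_left] at this
    have := (mul_le_mul_iff_right₀ h.B_pos).1 this
    have := (mul_le_mul_iff_right₀ (by positivity : 0 < 3 / ρ)).1 (Real.exp_le_exp.1 this)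
    simp only [supKernel, ← real_inner_self_eq_norm_sq] at this
    rw [one_div_mul_eq_div, one_div_mul_eq_div]
    exact this)
  simp only [zero_sub, inner_neg_left, inner_neg_right, neg_zero, inner_zero_left, inner_zero_right,
    zero_add, add_zero, neg_neg, map_zero, smul_eq_mul, real_inner_comm (x - x') v] at h4
  rw [real_inner_self_eq_norm_sq] at h4
  constructor
  · have := h4.1
    field_simp at this ⊢
    linarith
  · have := h4.2
    field_simp at this ⊢
    linarith

/-- The expansion of the two-point term. -/
theorem jet_supKernel (h : IsTestMax u t ρ β a B x x' O q κ o) (k : Fin n) (T : Eucl n) :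
    Jet2 (fun τ : ℝ => supKernel u ρ (chart u x O q (τ • basisVec k)) (x' + τ • T))
      (supKernel u ρ x x') (fderiv ℝ u x' (frameMap u x O (basisVec k)))
      (1 / 2 * fderiv ℝ (fderiv ℝ u) x' T T
        - 1 / 2 * ‖frameMap u x O (basisVec k) - T‖ ^ 2 / ρ
        - 1 / 2 * κ k * (areaFactor u x)⁻¹ * fderiv ℝ u x' (gradient u x)) := by
  have hρ := h.rho_pos
  have h1 := (Jet2.line x' T).comp (Φ := u) h.contDiffAt'
  have h2 := (IsTangentGraph.jet_chart (u := u) (x := x) (O := O) h.normalGraph k).sub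
    (Jet2.line x' T)
  have h3 := h1.sub ((h2.inner h2).const_mul (1 / (2 * ρ)))
  convert h3 using 1
  · ext1 τ
    rw [supKernel, one_div_mul_eq_div, real_inner_self_eq_norm_sq]
  · rw [supKernel, one_div_mul_eq_div, real_inner_self_eq_norm_sq]
  · rw [(h.second_point _).1, (h.second_point _).1, real_inner_comm (x - x'), inner_sub_right]
    field_simp
    ring
  · rw [(h.second_point (gradient u x)).1, ← real_inner_self_eq_norm_sq,
      real_inner_comm (x - x') (-(1 / 2 * κ k * (areaFactor u x)⁻¹) • gradient u x - 0), sub_zero,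
      inner_smul_right]
    simp
    field_simp
    ring

/-- The maximum condition along a curve through the maximum point. -/
theorem variation (h : IsTestMax u t ρ β a B x x' O q κ o) (k : Fin n) (T : Eucl n)
    {ê : ℝ → Eucl n} {b c : Eucl n} (hê : Jet2 ê (basisVec o) b c) {m₁ m₂ : ℝ}
    (hm : Jet2 (fun τ : ℝ =>
        Real.log (fderiv ℝ (fderiv ℝ q) (τ • basisVec k) (ê τ) (ê τ)
          * (slopeFactor (gradient q (τ • basisVec k)))⁻¹)
        - Real.log (⟪ê τ, ê τ⟫ + fderiv ℝ q (τ • basisVec k) (ê τ)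
          * fderiv ℝ q (τ • basisVec k) (ê τ))) (Real.log (κ o)) m₁ m₂) :
    m₁ - β * (slopeForm u x O (basisVec k) / (-u x - t / 2))
      + κ k * slopeForm u x O (basisVec k) / ((areaFactor u x)⁻¹ - a)
      + B * Real.exp (3 / ρ * supKernel u ρ x x') * (3 / ρ)
        * fderiv ℝ u x' (frameMap u x O (basisVec k)) = 0 ∧
    m₂ - β * (1 / 2 * κ k * (areaFactor u x)⁻¹ / (-u x - t / 2)
        + 1 / 2 * (slopeForm u x O (basisVec k) / (-u x - t / 2)) ^ 2)
      + (1 / 2 * ∑ i, third q (basisVec k) (basisVec k) (basisVec i) * slopeForm u x O (basisVec i)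
        + 1 / 2 * κ k ^ 2 * (areaFactor u x)⁻¹) / ((areaFactor u x)⁻¹ - a)
      + 1 / 2 * (κ k * slopeForm u x O (basisVec k) / ((areaFactor u x)⁻¹ - a)) ^ 2
      + B * Real.exp (3 / ρ * supKernel u ρ x x') * (3 / ρ) *
        (1 / 2 * fderiv ℝ (fderiv ℝ u) x' T T
          - 1 / 2 * ‖frameMap u x O (basisVec k) - T‖ ^ 2 / ρ
          - 1 / 2 * κ k * (areaFactor u x)⁻¹ * fderiv ℝ u x' (gradient u x))
      + 1 / 2 * (B * Real.exp (3 / ρ * supKernel u ρ x x')) * (3 / ρ) ^ 2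
        * fderiv ℝ u x' (frameMap u x O (basisVec k)) ^ 2 ≤ 0 := by
  have hn := h.normalGraph
  have ha : 0 < (areaFactor u x)⁻¹ - a := sub_pos.2 h.slope_lt
  have j1 := (((h.graph.jet_height hn k).neg.sub (Jet2.const (t / 2))).log
    h.height_pos).const_mul β
  have j2 := ((h.graph.jet_inv_areaFactor h.contDiffAt hn k).sub (Jet2.const a)).log ha
  have j3 := (((h.jet_supKernel k T).const_mul (3 / ρ)).exp).const_mul B
  have j4 := ((hm.add j1).sub j2).add j3
  have hlim : Tendsto (fun τ : ℝ => (chart u x O q (τ • basisVec k), x' + τ • T)) (𝓝 0)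
      (𝓝 (x, x')) :=
    (IsTangentGraph.jet_chart hn k).tendsto.prodMk_nhds (Jet2.line x' T).tendsto
  have hline : Tendsto (fun τ : ℝ => τ • basisVec k) (𝓝 0) (𝓝 0) :=
    (jet_smul (basisVec k)).tendsto
  have hpos : ∀ᶠ τ : ℝ in 𝓝 0, 0 < fderiv ℝ (fderiv ℝ q) (τ • basisVec k) (ê τ) (ê τ)
          * (slopeFactor (gradient q (τ • basisVec k)))⁻¹ := by
    refine (hn.jet_hess_apply k hê).tendsto.eventually_const_lt ?_
    rw [← hn.hess, hn.hess_basisVec]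
    simpa using h.top_pos
  have e0 : Real.log (κ o) + β * Real.log (-u x - t / 2) - Real.log ((areaFactor u x)⁻¹ - a)
      + B * Real.exp (3 / ρ * supKernel u ρ x x')
      = testFn u t ρ β a B x x' (frameMap u x O (basisVec o)) := by
    rw [testFn, h.hForm_top, gForm_top, Real.log_one, sub_zero]
  rw [e0] at j4
  obtain ⟨h1, h2⟩ := j4.le_of_eventually_le (Jet2.const _) (by
    filter_upwards [hlim.eventually h.max, hpos,
      hline.eventually (h.graph.hForm_push h.contDiffAt),
      hline.eventually (h.graph.gForm_push h.contDiffAt)] with τ h1 h2 h3 h4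
    have h5 := h1 (IsTangentGraph.push u x O q (τ • basisVec k) (ê τ)) (by rw [h3]; exact h2)
    rw [testFn, h3, h4] at h5
    exact h5)
  constructor
  · rw [← h1]
    ring
  · refine le_of_eq_of_le ?_ h2
    ring

end IsTestMax

end GraphSurface

end

/-! ### The summed second-order condition -/

section

set_option maxSynthPendingDepth 3

namespace GraphSurface

variable {n : ℕ}

namespace IsTestMax

variable {u : Eucl n → ℝ} {t ρ β a B : ℝ} {x x' : Eucl n} {O : Eucl n ≃ₗᵢ[ℝ] Eucl n}
  {q : Eucl n → ℝ} {κ : Fin n → ℝ} {o : Fin n}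

/-- The maximum condition for the direction `k` (multiplied by two). For `k = o` the unit vector is
turned along the curve, at a rate chosen to produce the sum with the weights `κ o - κ l + δ`. -/
theorem variation_basis (h : IsTestMax u t ρ β a B x x' O q κ o) {δ : ℝ} (hδ : 0 < δ)
    (k : Fin n) (T : Eucl n) {s b y : Fin n → ℝ} {η c E : ℝ}
    (hs : ∀ i, s i = slopeForm u x O (basisVec i))
    (hb : ∀ i, b i = fderiv ℝ u x' (frameMap u x O (basisVec i)))
    (hy : ∀ i, y i = third q (basisVec o) (basisVec o) (basisVec i) / κ o)
    (hη : η = -u x - t / 2) (hc : c = (areaFactor u x)⁻¹)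
    (hE : E = B * Real.exp (3 / ρ * supKernel u ρ x x')) :
    y k = β * s k / η - κ k * s k / (c - a) - 3 * E / ρ * b k ∧
    fourth q (basisVec k) (basisVec k) (basisVec o) (basisVec o) / κ o - κ k ^ 2 - y k ^ 2
      + (if k = o then
          2 * κ o * ∑ l ∈ Finset.univ.erase o, y l ^ 2 / (κ o - κ l + δ) - 2 * κ o ^ 2 else 0)
      - β * (κ k * c / η + (s k / η) ^ 2)
      + (∑ i, third q (basisVec i) (basisVec k) (basisVec k) * s i + κ k ^ 2 * c) / (c - a)
      + (κ k * s k / (c - a)) ^ 2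
      + 3 * E / ρ * (fderiv ℝ (fderiv ℝ u) x' T T - ‖frameMap u x O (basisVec k) - T‖ ^ 2 / ρ
          - κ k * c * fderiv ℝ u x' (gradient u x))
      + 9 * E / ρ ^ 2 * b k ^ 2 ≤ 0 := by
  have hK := h.top_pos
  have hn := h.normalGraph
  have hsym : ∑ i, third q (basisVec k) (basisVec k) (basisVec i) * slopeForm u x O (basisVec i)
      = ∑ i, third q (basisVec i) (basisVec k) (basisVec k) * s i := by
    refine Finset.sum_congr rfl fun i _ => ?_
    rw [hs, third_symm_right hn.contDiffAt, third_symm_left hn.contDiffAt]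
  by_cases hk : k = o
  · subst hk
    let ξ : Eucl n := WithLp.toLp 2 fun l =>
      if l = k then 0 else third q (basisVec k) (basisVec k) (basisVec l) / (κ k - κ l + δ)
    have hξ : ξ k = 0 := by simp [ξ]
    obtain ⟨h1, h2⟩ := h.variation k T (Jet2.line (basisVec k) ξ) (hn.jet_log_curv_self hK hξ)
    have h3 : κ k * ∑ l ∈ Finset.univ.erase k, y l ^ 2 / (κ k - κ l + δ)
        ≤ (∑ l, (2 * ξ l * third q (basisVec k) (basisVec k) (basisVec l)
          - (κ k - κ l) * ξ l ^ 2)) / κ k := by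
      rw [le_div_iff₀ hK, Finset.mul_sum, Finset.sum_mul,
        ← Finset.add_sum_erase _ _ (Finset.mem_univ k), hξ]
      simp only [mul_zero, zero_mul, ne_eq, OfNat.ofNat_ne_zero, not_false_eq_true, zero_pow,
        sub_zero, zero_add]
      refine Finset.sum_le_sum fun l hl => ?_
      have hlk := Finset.ne_of_mem_erase hl
      have hd := h.le_top l
      have hd' : 0 < κ k - κ l + δ := by linarith
      have hξl : ξ l = third q (basisVec k) (basisVec k) (basisVec l) / (κ k - κ l + δ) := by
        simp [ξ, hlk]
      rw [hξl, hy l]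
      rw [← sub_nonneg]
      have : 2 * (third q (basisVec k) (basisVec k) (basisVec l) / (κ k - κ l + δ))
            * third q (basisVec k) (basisVec k) (basisVec l)
          - (κ k - κ l) * (third q (basisVec k) (basisVec k) (basisVec l) / (κ k - κ l + δ)) ^ 2
          - κ k * ((third q (basisVec k) (basisVec k) (basisVec l) / κ k) ^ 2 / (κ k - κ l + δ))
            * κ k
          = δ * (third q (basisVec k) (basisVec k) (basisVec l) / (κ k - κ l + δ)) ^ 2 := by
        field_simp
        ring
      rw [this]
      positivity
    rw [← hb, ← hs, ← hy, ← hη, ← hc, ← hE] at h1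
    rw [if_pos rfl]
    constructor
    · linear_combination h1
    · rw [← hb, ← hs, ← hη, ← hc, ← hE, hsym, ← hy] at h2
      refine le_trans ?_ (mul_nonpos_of_nonneg_of_nonpos zero_le_two h2)
      rw [← sub_nonneg] at h3 ⊢
      refine (mul_nonneg zero_le_two h3).trans_eq ?_
      ring
  · obtain ⟨h1, h2⟩ := h.variation k T (Jet2.const (basisVec o)) (hn.jet_log_curv hk hK)
    rw [← hb, ← hs, ← hy, ← hη, ← hc, ← hE] at h1
    rw [← hb, ← hs, ← hη, ← hc, ← hE, hsym, ← hy] at h2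
    rw [if_neg hk]
    constructor
    · linear_combination h1
    · refine le_of_eq_of_le ?_ (mul_nonpos_of_nonneg_of_nonpos zero_le_two h2)
      ring

/-- The sum over all directions of the maximum conditions, combined with the inequality for the
fourth derivatives which comes from the equation. -/
theorem combined (h : IsTestMax u t ρ β a B x x' O q κ o) {p : ℕ}
    (hκ : ∀ I ∈ pSets n p, 0 < ∑ i ∈ I, κ i) (hp : 1 ≤ p) (hpn : p ≤ n)
    {δ : ℝ} (hδ : 0 < δ) (T : Fin n → Eucl n) {s b y G : Fin n → ℝ} {η c E g : ℝ}
    (hs : ∀ i, s i = slopeForm u x O (basisVec i))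
    (hb : ∀ i, b i = fderiv ℝ u x' (frameMap u x O (basisVec i)))
    (hy : ∀ i, y i = third q (basisVec o) (basisVec o) (basisVec i) / κ o)
    (hη : η = -u x - t / 2) (hc : c = (areaFactor u x)⁻¹)
    (hE : E = B * Real.exp (3 / ρ * supKernel u ρ x x'))
    (hG : ∀ k, G k = ∑ i, curvWeight p κ i * third q (basisVec k) (basisVec i) (basisVec i))
    (hg : g + 2 * curvWeight p κ o * κ o ^ 3 + κ o ^ 2 * ∑ i, curvWeight p κ i * κ i +
      2 * ∑ i, (curvWeight p κ i - curvWeight p κ o) *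
          (third q (basisVec o) (basisVec o) (basisVec i) ^ 2 / (κ o - κ i)) ≤
      ∑ i, curvWeight p κ i * fourth q (basisVec i) (basisVec i) (basisVec o) (basisVec o)) :
    g / κ o + κ o * ∑ i, curvWeight p κ i * κ i
      + 2 * κ o * ∑ i, (curvWeight p κ i - curvWeight p κ o) * (y i ^ 2 / (κ o - κ i))
      + 2 * κ o * curvWeight p κ o * ∑ l ∈ Finset.univ.erase o, y l ^ 2 / (κ o - κ l + δ)
      + ∑ k, curvWeight p κ k * (-y k ^ 2 + (c / (c - a) - 1) * κ k ^ 2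
          + (κ k * s k / (c - a)) ^ 2 - β * (s k / η) ^ 2
          - 3 * E / ρ * ‖frameMap u x O (basisVec k) - T k‖ ^ 2 / ρ + 9 * E / ρ ^ 2 * b k ^ 2)
      - β * c / η * ∑ i, curvWeight p κ i * κ i + (∑ i, G i * s i) / (c - a)
      + 3 * E / ρ * (∑ k, curvWeight p κ k * fderiv ℝ (fderiv ℝ u) x' (T k) (T k)
        - c * fderiv ℝ u x' (gradient u x) * ∑ i, curvWeight p κ i * κ i) ≤ 0 := by
  have hK := h.top_pos
  have h1 := Finset.sum_nonpos fun k (_ : k ∈ Finset.univ) =>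
    mul_nonpos_of_nonneg_of_nonpos (curvWeight_pos hp hpn hκ k).le
      (h.variation_basis hδ k (T k) hs hb hy hη hc hE).2
  have h2 : (∑ i, G i * s i) = ∑ k, curvWeight p κ k *
      ∑ i, third q (basisVec i) (basisVec k) (basisVec k) * s i := by
    simp only [hG, Finset.sum_mul, Finset.mul_sum]
    rw [Finset.sum_comm]
    exact Finset.sum_congr rfl fun _ _ => Finset.sum_congr rfl fun _ _ => by ring
  have h3 := div_le_div_of_nonneg_right hg hK.le
  have h4 : ∑ i, (curvWeight p κ i - curvWeight p κ o) *
          (third q (basisVec o) (basisVec o) (basisVec i) ^ 2 / (κ o - κ i))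
      = κ o ^ 2 * ∑ i, (curvWeight p κ i - curvWeight p κ o) * (y i ^ 2 / (κ o - κ i)) := by
    rw [Finset.mul_sum]
    refine Finset.sum_congr rfl fun i _ => ?_
    rw [hy, div_pow]
    field_simp
  rw [h4] at h3
  have h5 : (g + 2 * curvWeight p κ o * κ o ^ 3 + κ o ^ 2 * ∑ i, curvWeight p κ i * κ i +
      2 * (κ o ^ 2 * ∑ i, (curvWeight p κ i - curvWeight p κ o) * (y i ^ 2 / (κ o - κ i)))) / κ o
      = g / κ o + 2 * curvWeight p κ o * κ o ^ 2 + κ o * ∑ i, curvWeight p κ i * κ i +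
      2 * κ o * ∑ i, (curvWeight p κ i - curvWeight p κ o) * (y i ^ 2 / (κ o - κ i)) := by
    field_simp
  rw [h5] at h3
  have h6 : ∑ k, curvWeight p κ k * (if k = o then
      2 * κ o * ∑ l ∈ Finset.univ.erase o, y l ^ 2 / (κ o - κ l + δ) - 2 * κ o ^ 2 else 0)
      = curvWeight p κ o *
        (2 * κ o * ∑ l ∈ Finset.univ.erase o, y l ^ 2 / (κ o - κ l + δ) - 2 * κ o ^ 2) := by
    simp
  have h7 : ∑ k, curvWeight p κ k *
      (fourth q (basisVec k) (basisVec k) (basisVec o) (basisVec o) / κ o - κ k ^ 2 - y k ^ 2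
      + (if k = o then
          2 * κ o * ∑ l ∈ Finset.univ.erase o, y l ^ 2 / (κ o - κ l + δ) - 2 * κ o ^ 2 else 0)
      - β * (κ k * c / η + (s k / η) ^ 2)
      + (∑ i, third q (basisVec i) (basisVec k) (basisVec k) * s i + κ k ^ 2 * c) / (c - a)
      + (κ k * s k / (c - a)) ^ 2
      + 3 * E / ρ * (fderiv ℝ (fderiv ℝ u) x' (T k) (T k)
          - ‖frameMap u x O (basisVec k) - T k‖ ^ 2 / ρ - κ k * c * fderiv ℝ u x' (gradient u x))
      + 9 * E / ρ ^ 2 * b k ^ 2)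
      = (∑ i, curvWeight p κ i * fourth q (basisVec i) (basisVec i) (basisVec o) (basisVec o)) / κ o
      + (∑ k, curvWeight p κ k * (if k = o then
          2 * κ o * ∑ l ∈ Finset.univ.erase o, y l ^ 2 / (κ o - κ l + δ) - 2 * κ o ^ 2 else 0))
      + ∑ k, curvWeight p κ k * (-y k ^ 2 + (c / (c - a) - 1) * κ k ^ 2
          + (κ k * s k / (c - a)) ^ 2 - β * (s k / η) ^ 2
          - 3 * E / ρ * ‖frameMap u x O (basisVec k) - T k‖ ^ 2 / ρ + 9 * E / ρ ^ 2 * b k ^ 2)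
      - β * c / η * ∑ i, curvWeight p κ i * κ i + (∑ i, G i * s i) / (c - a)
      + 3 * E / ρ * (∑ k, curvWeight p κ k * fderiv ℝ (fderiv ℝ u) x' (T k) (T k)
        - c * fderiv ℝ u x' (gradient u x) * ∑ i, curvWeight p κ i * κ i) := by
    rw [h2, mul_sub]
    rw [Finset.sum_div, Finset.sum_div, Finset.mul_sum _ _ (β * c / η),
      Finset.mul_sum _ _ (c * _), Finset.mul_sum _ _ (3 * E / ρ), Finset.mul_sum _ _ (3 * E / ρ)]
    simp only [← Finset.sum_add_distrib, ← Finset.sum_sub_distrib]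
    exact Finset.sum_congr rfl fun k _ => by ring
  rw [h7, h6] at h1
  linarith

end IsTestMax

end GraphSurface

end

/-! ### The right-hand side of the equation -/

theorem Jet2.prodMk {E F : Type*} [NormedAddCommGroup E] [NormedSpace ℝ E]
    [NormedAddCommGroup F] [NormedSpace ℝ F] {f : ℝ → E} {g : ℝ → F} {a b c : E} {a' b' c' : F}
    (hf : Jet2 f a b c) (hg : Jet2 g a' b' c') :
    Jet2 (fun τ => (f τ, g τ)) (a, a') (b, b') (c, c') := by
  rw [Jet2] at *
  simpa using hf.prod_left hg

/-- The second-order expansion of the logarithm of a positive function along a curve, with bounds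
for the coefficients. -/
theorem Jet2.log_comp_bounds {V : Type*} [NormedAddCommGroup V] [NormedSpace ℝ V] {γ : ℝ → V}
    {P b c : V} (hγ : Jet2 γ P b c) {f : V → ℝ} (hf : ContDiffAt ℝ 2 f P) {m Λ : ℝ} (hm : 0 < m)
    (hfm : m ≤ f P) (h1 : ‖fderiv ℝ f P‖ ≤ Λ) (h2 : ‖fderiv ℝ (fderiv ℝ f) P‖ ≤ Λ) :
    ∃ y₁ y₂, Jet2 (fun τ => Real.log (f (γ τ))) (Real.log (f P)) y₁ y₂ ∧
      |y₁| ≤ Λ / m * ‖b‖ ∧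
      -(2 * y₂) ≤ 2 * (Λ / m) * ‖c‖ + (Λ / m + (Λ / m) ^ 2) * ‖b‖ ^ 2 := by
  have hfP : 0 < f P := hm.trans_le hfm
  have hΛ : 0 ≤ Λ := (norm_nonneg _).trans h1
  refine ⟨_, _, (hγ.comp hf).log hfP, ?_, ?_⟩
  · rw [abs_div, abs_of_pos hfP, div_mul_eq_mul_div]
    exact div_le_div₀ (by positivity) ((fderiv ℝ f P).le_of_opNorm_le h1 b) hm hfm
  · have e1 : |fderiv ℝ f P b / f P| ≤ Λ / m * ‖b‖ := by
      rw [abs_div, abs_of_pos hfP, div_mul_eq_mul_div]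
      exact div_le_div₀ (by positivity) ((fderiv ℝ f P).le_of_opNorm_le h1 b) hm hfm
    have e2 : |fderiv ℝ f P c / f P| ≤ Λ / m * ‖c‖ := by
      rw [abs_div, abs_of_pos hfP, div_mul_eq_mul_div]
      exact div_le_div₀ (by positivity) ((fderiv ℝ f P).le_of_opNorm_le h1 c) hm hfm
    have e3 : |fderiv ℝ (fderiv ℝ f) P b b / f P| ≤ Λ / m * ‖b‖ ^ 2 := by
      rw [abs_div, abs_of_pos hfP, div_mul_eq_mul_div]
      refine div_le_div₀ (by positivity) ?_ hm hfm
      refine ((fderiv ℝ (fderiv ℝ f) P b).le_opNorm b).trans ?_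
      rw [pow_two, ← mul_assoc]
      exact mul_le_mul_of_nonneg_right ((fderiv ℝ (fderiv ℝ f) P).le_of_opNorm_le h2 b)
        (norm_nonneg _)
    have e4 := sq_le_sq' (by linarith [neg_abs_le (fderiv ℝ f P b / f P)])
      ((le_abs_self _).trans e1)
    have e5 := (abs_le.1 e2).1
    have e6 := (abs_le.1 e3).1
    rw [smul_eq_mul, add_div]
    have e7 : 1 / 2 * (fderiv ℝ (fderiv ℝ f) P) b b / f P
        = 1 / 2 * ((fderiv ℝ (fderiv ℝ f) P) b b / f P) := by ring
    rw [e7]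
    nlinarith

section

set_option maxSynthPendingDepth 3

namespace GraphSurface

variable {n : ℕ}

namespace IsTangentGraph

variable {u : Eucl n → ℝ} {x : Eucl n} {O : Eucl n ≃ₗᵢ[ℝ] Eucl n} {q : Eucl n → ℝ}
  {κ : Fin n → ℝ}

/-- The equation differentiated once and twice. The derivatives of the right-hand side are `G k`
and `g`; they are bounded in terms of the expansion of its argument `γ`. -/
theorem exists_rhs_bounds (h : IsTangentGraph u x O q) (hu : ContDiffAt ℝ 4 u x)
    (hframe : IsPrincipalFrame u x κ O) {p : ℕ}
    (hadm : ∀ᶠ x' in 𝓝 x, (∀ s ∈ (principalCurvatures u x').powersetCard p, 0 ≤ s.sum) ∧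
      0 < curvatureProd p u x')
    (o : Fin n) {V : Type*} [NormedAddCommGroup V] [NormedSpace ℝ V] {γ : Fin n → ℝ → V}
    {P : V} {b c : Fin n → V} (hγ : ∀ k, Jet2 (γ k) P (b k) (c k)) {f : V → ℝ}
    (hf : ContDiffAt ℝ 2 f P) {m Λ : ℝ} (hm : 0 < m) (hfm : m ≤ f P)
    (h1 : ‖fderiv ℝ f P‖ ≤ Λ) (h2 : ‖fderiv ℝ (fderiv ℝ f) P‖ ≤ Λ)
    (heq0 : curvatureProd p u x = f P)
    (heq : ∀ k, ∀ᶠ τ in 𝓝 0, curvatureProd p u (chart u x O q (τ • basisVec k)) = f (γ k τ)) :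
    ∃ (G : Fin n → ℝ) (g : ℝ),
      (∀ k, G k = ∑ i, curvWeight p κ i * third q (basisVec k) (basisVec i) (basisVec i)) ∧
      g + 2 * curvWeight p κ o * κ o ^ 3 + κ o ^ 2 * ∑ i, curvWeight p κ i * κ i +
        2 * ∑ i, (curvWeight p κ i - curvWeight p κ o) *
          (third q (basisVec o) (basisVec o) (basisVec i) ^ 2 / (κ o - κ i)) ≤
        ∑ i, curvWeight p κ i * fourth q (basisVec i) (basisVec i) (basisVec o) (basisVec o) ∧
      (∀ k, |G k| ≤ Λ / m * ‖b k‖) ∧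
      -g ≤ 2 * (Λ / m) * ‖c o‖ + (Λ / m + (Λ / m) ^ 2) * ‖b o‖ ^ 2 := by
  have hn := h.isNormalGraph hu hframe
  have hκ : ∀ I ∈ pSets n p, 0 < ∑ i ∈ I, κ i := fun I hI =>
    hframe.sum_pos hadm.self_of_nhds.1 hadm.self_of_nhds.2 hI
  have h0 : Real.log (f P) = ∑ I ∈ pSets n p, Real.log (∑ i ∈ I, κ i) := by
    rw [← heq0, hframe.curvatureProd_eq, Real.log_prod fun I hI => (hκ I hI).ne']
  have key : ∀ k o' : Fin n, ∀ r : Eucl n, r o' = 0 → ∀ᶠ τ : ℝ in 𝓝 0, Real.log (f (γ k τ)) ≤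
      ∑ I ∈ pSets n p, Real.log (∑ i ∈ I,
        fderiv ℝ (fderiv ℝ q) (τ • basisVec k) (movingFrame q k o' r i τ) (movingFrame q k o' r i τ)
          * (slopeFactor (gradient q (τ • basisVec k)))⁻¹) := by
    intro k o' r hr
    filter_upwards [h.log_curvatureProd_le hu hadm k o' hr, heq k] with τ e1 e2
    rwa [e2] at e1
  choose y₁ y₂ hY hy₁ hy₂ using fun k => (hγ k).log_comp_bounds hf hm hfm h1 h2
  exact ⟨y₁, 2 * y₂ o, fun k => hn.first_variation hκ k (hY k) h0 (key k k 0 rfl),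
    hn.second_variation_opt hκ o (hY o) h0 fun r hr => key o o r hr, hy₁, hy₂ o⟩

theorem norm_frameMap_le (k : Fin n) : ‖frameMap u x O (basisVec k)‖ ≤ 1 := by
  have h1 := frameMap_norm_sq (u := u) (x := x) (O := O) (basisVec k)
  have h2 : ‖(basisVec k : Eucl n)‖ = 1 := by simp
  rw [h2] at h1
  nlinarith [norm_nonneg (frameMap u x O (basisVec k)), sq_nonneg (slopeForm u x O (basisVec k))]

theorem abs_slopeForm_le (k : Fin n) : |slopeForm u x O (basisVec k)| ≤ 1 := by
  have h1 := frameMap_norm_sq (u := u) (x := x) (O := O) (basisVec k)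
  have h2 : ‖(basisVec k : Eucl n)‖ = 1 := by simp
  rw [h2] at h1
  rw [abs_le_one_iff_mul_self_le_one]
  nlinarith [sq_nonneg ‖frameMap u x O (basisVec k)‖]

theorem norm_smul_gradient_le (a : ℝ) : ‖(a * (areaFactor u x)⁻¹) • gradient u x‖ ≤ |a| := by
  have h1 := areaFactor_pos u x
  have h2 : ‖gradient u x‖ ≤ areaFactor u x := by
    rw [areaFactor_eq]; exact norm_le_slopeFactor _
  rw [norm_smul, norm_mul, Real.norm_eq_abs, norm_inv, Real.norm_of_nonneg h1.le, mul_assoc]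
  refine mul_le_of_le_one_right (abs_nonneg _) ?_
  rw [inv_mul_le_iff₀ h1]
  simpa

theorem abs_mul_inv_areaFactor_le (a : ℝ) : |a * (areaFactor u x)⁻¹| ≤ |a| := by
  have h1 := areaFactor_pos u x
  rw [abs_mul, abs_inv, abs_of_pos h1]
  refine mul_le_of_le_one_right (abs_nonneg _) (inv_le_one_of_one_le₀ ?_)
  rw [areaFactor_eq]; exact one_le_slopeFactor _

/-- Bounds for the derivatives of a right-hand side which depends on the normal. -/
theorem exists_bounds_of_normal (h : IsTangentGraph u x O q) (hu : ContDiffAt ℝ 4 u x)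
    (hframe : IsPrincipalFrame u x κ O) {p : ℕ}
    (hadm : ∀ᶠ x' in 𝓝 x, (∀ s ∈ (principalCurvatures u x').powersetCard p, 0 ≤ s.sum) ∧
      0 < curvatureProd p u x')
    (o : Fin n) {f : RhsSpace n → ℝ} (hf : ContDiffAt ℝ 2 f (x, u x, normal u x)) {m Λ : ℝ}
    (hm : 0 < m) (hfm : m ≤ f (x, u x, normal u x))
    (h1 : ‖fderiv ℝ f (x, u x, normal u x)‖ ≤ Λ)
    (h2 : ‖fderiv ℝ (fderiv ℝ f) (x, u x, normal u x)‖ ≤ Λ)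
    (heq : ∀ᶠ x' in 𝓝 x, curvatureProd p u x' = f (x', u x', normal u x')) :
    ∃ (G : Fin n → ℝ) (g : ℝ),
      (∀ k, G k = ∑ i, curvWeight p κ i * third q (basisVec k) (basisVec i) (basisVec i)) ∧
      g + 2 * curvWeight p κ o * κ o ^ 3 + κ o ^ 2 * ∑ i, curvWeight p κ i * κ i +
        2 * ∑ i, (curvWeight p κ i - curvWeight p κ o) *
          (third q (basisVec o) (basisVec o) (basisVec i) ^ 2 / (κ o - κ i)) ≤
        ∑ i, curvWeight p κ i * fourth q (basisVec i) (basisVec i) (basisVec o) (basisVec o) ∧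
      (∀ k, |G k| ≤ Λ / m * (1 + |κ k|)) ∧
      -g ≤ Λ / m * (|κ o| + κ o ^ 2 + ∑ i, |third q (basisVec o) (basisVec o) (basisVec i)|)
        + (Λ / m + (Λ / m) ^ 2) * (1 + |κ o|) ^ 2 := by
  have hn := h.isNormalGraph hu hframe
  have hΛ : 0 ≤ Λ / m := div_nonneg ((norm_nonneg _).trans h1) hm.le
  obtain ⟨G, g, hG, hg, hG', hg'⟩ := h.exists_rhs_bounds hu hframe hadm o
    (fun k => (jet_chart hn k).prodMk ((h.jet_height hn k).prodMk (h.jet_normal hu hn k)))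
    hf hm hfm h1 h2 heq.self_of_nhds
    (fun k => (jet_chart hn k).tendsto.eventually heq)
  have hb : ∀ k, ‖((frameMap u x O (basisVec k), slopeForm u x O (basisVec k),
      -(κ k • tangentMap u x O (basisVec k))) : RhsSpace n)‖ ≤ 1 + |κ k| := by
    intro k
    have := abs_nonneg (κ k)
    have e1 := norm_frameMap_le (u := u) (x := x) (O := O) k
    have e2 := abs_slopeForm_le (u := u) (x := x) (O := O) k
    rw [Prod.norm_mk, Prod.norm_mk]
    refine max_le (by linarith) (max_le (by rw [Real.norm_eq_abs]; linarith) ?_)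
    rw [norm_neg, norm_smul, norm_tangentMap, Real.norm_eq_abs]
    simp
  refine ⟨G, g, hG, hg, fun k => (hG' k).trans (mul_le_mul_of_nonneg_left (hb k) hΛ),
    hg'.trans (add_le_add ?_ ?_)⟩
  · rw [mul_comm 2, mul_assoc]
    refine mul_le_mul_of_nonneg_left ?_ hΛ
    rw [← le_div_iff₀' two_pos, Prod.norm_mk, Prod.norm_mk]
    have p1 := abs_nonneg (κ o)
    have p2 := sq_nonneg (κ o)
    have p3 : 0 ≤ ∑ i, |third q (basisVec o) (basisVec o) (basisVec i)| :=
      Finset.sum_nonneg fun _ _ => abs_nonneg _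
    have p4 : |1 / 2 * κ o| = |κ o| / 2 := by rw [abs_mul]; norm_num; ring
    refine max_le ?_ (max_le ?_ ?_)
    · rw [neg_smul, norm_neg]
      refine (norm_smul_gradient_le _).trans ?_
      linarith
    · rw [Real.norm_eq_abs]
      refine (abs_mul_inv_areaFactor_le _).trans ?_
      linarith
    · refine (norm_sub_le _ _).trans ?_
      have e1 : ‖-((1 / 2 * κ o ^ 2) • normal u x)‖ = κ o ^ 2 / 2 := by
        rw [norm_neg, norm_smul, norm_normal, Real.norm_of_nonneg (by positivity)]
        ring
      have e2 : ‖(1 / 2 : ℝ) • ∑ i, third q (basisVec o) (basisVec o) (basisVec i) •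
          tangentMap u x O (basisVec i)‖
          ≤ (∑ i, |third q (basisVec o) (basisVec o) (basisVec i)|) / 2 := by
        rw [norm_smul, Real.norm_of_nonneg (by norm_num), one_div, inv_mul_eq_div]
        refine div_le_div_of_nonneg_right ((norm_sum_le _ _).trans_eq ?_) zero_le_two
        refine Finset.sum_congr rfl fun i _ => ?_
        rw [norm_smul, norm_tangentMap, Real.norm_eq_abs]
        simp
      rw [e1]
      linarith
  · exact mul_le_mul_of_nonneg_left (pow_le_pow_left₀ (norm_nonneg _) (hb o) 2) (by positivity)

/-- Bounds for the derivatives of a right-hand side which does not depend on the normal. -/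
theorem exists_bounds_of_const (h : IsTangentGraph u x O q) (hu : ContDiffAt ℝ 4 u x)
    (hframe : IsPrincipalFrame u x κ O) {p : ℕ}
    (hadm : ∀ᶠ x' in 𝓝 x, (∀ s ∈ (principalCurvatures u x').powersetCard p, 0 ≤ s.sum) ∧
      0 < curvatureProd p u x')
    (o : Fin n) {f : RhsSpace n → ℝ} (hf : ContDiffAt ℝ 2 f (x, u x, normal u x)) {m Λ : ℝ}
    (hm : 0 < m) (hfm : m ≤ f (x, u x, normal u x))
    (h1 : ‖fderiv ℝ f (x, u x, normal u x)‖ ≤ Λ)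
    (h2 : ‖fderiv ℝ (fderiv ℝ f) (x, u x, normal u x)‖ ≤ Λ)
    (heq : ∀ᶠ x' in 𝓝 x, curvatureProd p u x' = f (x', u x', normal u x)) :
    ∃ (G : Fin n → ℝ) (g : ℝ),
      (∀ k, G k = ∑ i, curvWeight p κ i * third q (basisVec k) (basisVec i) (basisVec i)) ∧
      g + 2 * curvWeight p κ o * κ o ^ 3 + κ o ^ 2 * ∑ i, curvWeight p κ i * κ i +
        2 * ∑ i, (curvWeight p κ i - curvWeight p κ o) *
          (third q (basisVec o) (basisVec o) (basisVec i) ^ 2 / (κ o - κ i)) ≤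
        ∑ i, curvWeight p κ i * fourth q (basisVec i) (basisVec i) (basisVec o) (basisVec o) ∧
      (∀ k, |G k| ≤ Λ / m) ∧ -g ≤ Λ / m * |κ o| + (Λ / m + (Λ / m) ^ 2) := by
  have hn := h.isNormalGraph hu hframe
  have hΛ : 0 ≤ Λ / m := div_nonneg ((norm_nonneg _).trans h1) hm.le
  obtain ⟨G, g, hG, hg, hG', hg'⟩ := h.exists_rhs_bounds hu hframe hadm o
    (fun k => (jet_chart hn k).prodMk ((h.jet_height hn k).prodMk (Jet2.const (normal u x))))
    hf hm hfm h1 h2 heq.self_of_nhds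
    (fun k => (jet_chart hn k).tendsto.eventually heq)
  have hb : ∀ k, ‖((frameMap u x O (basisVec k), slopeForm u x O (basisVec k), 0) :
      RhsSpace n)‖ ≤ 1 := by
    intro k
    rw [Prod.norm_mk, Prod.norm_mk]
    exact max_le (norm_frameMap_le k) (max_le (abs_slopeForm_le k) (by simp))
  refine ⟨G, g, hG, hg, fun k => (hG' k).trans (mul_le_of_le_one_right hΛ (hb k)),
    hg'.trans (add_le_add ?_ ?_)⟩
  · rw [mul_comm 2, mul_assoc]
    refine mul_le_mul_of_nonneg_left ?_ hΛ
    rw [← le_div_iff₀' two_pos, Prod.norm_mk, Prod.norm_mk]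
    have p1 := abs_nonneg (κ o)
    have p4 : |1 / 2 * κ o| = |κ o| / 2 := by rw [abs_mul]; norm_num; ring
    refine max_le ?_ (max_le ?_ ?_)
    · rw [neg_smul, norm_neg]
      refine (norm_smul_gradient_le _).trans ?_
      linarith
    · rw [Real.norm_eq_abs]
      refine (abs_mul_inv_areaFactor_le _).trans ?_
      linarith
    · simpa using by positivity
  · refine mul_le_of_le_one_right (by positivity) ?_
    exact pow_le_one₀ (norm_nonneg _) (hb o)

end IsTangentGraph

end GraphSurface

end

/-! ### The weights and the sums of curvatures -/

section Weights

variable {n p : ℕ} {κ : Fin n → ℝ}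

/-- The weights decrease when the curvature grows. -/
theorem curvWeight_anti (hκ : ∀ I ∈ pSets n p, 0 < ∑ i ∈ I, κ i) {i j : Fin n}
    (hij : κ i ≤ κ j) : curvWeight p κ j ≤ curvWeight p κ i := by
  let σ := Equiv.swap i j
  have h1 : curvWeight p κ i
      = ∑ I ∈ pSets n p, if j ∈ I then (∑ l ∈ I, κ (σ l))⁻¹ else 0 := by
    rw [curvWeight]
    symm
    refine Finset.sum_equiv σ.finsetCongr (fun I => ?_) fun I _ => ?_
    · simp [Finset.mem_powersetCard]
    · have e1 : i ∈ σ.finsetCongr I ↔ j ∈ I := by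
        simp [σ, Equiv.finsetCongr_apply, Finset.mem_map_equiv]
      have e2 : ∑ l ∈ σ.finsetCongr I, κ l = ∑ l ∈ I, κ (σ l) := by simp
      simp only [e1, e2]
  rw [h1, curvWeight]
  refine Finset.sum_le_sum fun I hI => ?_
  split_ifs with hj
  · have hI' : I.map σ.toEmbedding ∈ pSets n p := by
      simpa [Finset.mem_powersetCard] using hI
    have hpos := hκ _ hI'
    rw [Finset.sum_map] at hpos
    refine inv_anti₀ hpos ?_
    by_cases hi : i ∈ I
    · refine le_of_eq ?_
      have : I.map σ.toEmbedding = I := by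
        ext l
        rw [Finset.mem_map_equiv]
        by_cases h1 : l = i
        · subst h1; simp [σ, hi, hj]
        · by_cases h2 : l = j
          · subst h2; simp [σ, hi, hj]
          · simp [σ, Equiv.swap_apply_of_ne_of_ne h1 h2]
      conv_rhs => rw [← this, Finset.sum_map]
      rfl
    · refine Finset.sum_le_sum fun l hl => ?_
      by_cases h2 : l = j
      · subst h2; simpa [σ] using hij
      · have h1 : l ≠ i := fun h => hi (h ▸ hl)
        simp [σ, Equiv.swap_apply_of_ne_of_ne h1 h2]
  · exact le_rfl

theorem curvWeight_eq_of_card (κ : Fin n → ℝ) (i j : Fin n) :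
    curvWeight n κ i = curvWeight n κ j := by
  refine Finset.sum_congr rfl fun I hI => ?_
  have : I = Finset.univ :=
    Finset.eq_univ_of_card I (by simpa using (Finset.mem_powersetCard.1 hI).2)
  simp [this]

theorem sum_curvWeight_mul_self (hκ : ∀ I ∈ pSets n p, 0 < ∑ i ∈ I, κ i) :
    ∑ i, curvWeight p κ i * κ i = n.choose p := by
  rw [← sum_pSets_eq_sum_curvWeight, Finset.sum_congr rfl fun I hI => div_self (hκ I hI).ne']
  simp

theorem exists_mem_pSets (hp : 1 ≤ p) (hpn : p ≤ n) (k : Fin n) : ∃ I ∈ pSets n p, k ∈ I := by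
  obtain ⟨I, h1, -, h3⟩ := Finset.exists_subsuperset_card_eq (Finset.subset_univ {k})
    (by simpa using hp) (by simpa using hpn)
  exact ⟨I, by simp [Finset.mem_powersetCard, h3], h1 (Finset.mem_singleton_self k)⟩

/-- All curvatures are bounded by the largest one. -/
theorem abs_le_mul_top (hκ : ∀ I ∈ pSets n p, 0 < ∑ i ∈ I, κ i) (hp : 1 ≤ p) (hpn : p ≤ n)
    {o : Fin n} (ho : ∀ i, κ i ≤ κ o) (hK : 0 < κ o) (k : Fin n) : |κ k| ≤ p * κ o := by
  have hp' : (1 : ℝ) ≤ p := by exact_mod_cast hp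
  rw [abs_le]
  constructor
  · obtain ⟨I, hI, hk⟩ := exists_mem_pSets hp hpn k
    have h1 := hκ I hI
    rw [← Finset.add_sum_erase _ _ hk] at h1
    have h2 := Finset.sum_le_card_nsmul (I.erase k) κ (κ o) fun i _ => ho i
    rw [nsmul_eq_mul, Finset.card_erase_of_mem hk, (Finset.mem_powersetCard.1 hI).2,
      Nat.cast_sub hp, Nat.cast_one] at h2
    nlinarith
  · nlinarith [ho k]

/-- A bound for the product gives a lower bound for the weight of the smallest curvature. -/
theorem one_div_le_curvWeight (hκ : ∀ I ∈ pSets n p, 0 < ∑ i ∈ I, κ i) (hp : 1 ≤ p)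
    (hpn : p ≤ n) {Λ : ℝ} (hΛ : ∏ I ∈ pSets n p, ∑ i ∈ I, κ i ≤ Λ) {l : Fin n}
    (hl : ∀ i, κ l ≤ κ i) : 1 / max 1 Λ ≤ curvWeight p κ l := by
  obtain ⟨I, hI, hIΛ⟩ : ∃ I ∈ pSets n p, ∑ i ∈ I, κ i ≤ max 1 Λ := by
    by_contra! hcon
    obtain ⟨I, hI, -⟩ := exists_mem_pSets hp hpn l
    have h1 := hcon I hI
    rw [← Finset.mul_prod_erase _ _ hI] at hΛ
    have h2 : 1 ≤ ∏ J ∈ (pSets n p).erase I, ∑ i ∈ J, κ i := by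
      refine Finset.one_le_prod fun J hJ => ?_
      exact (le_max_left 1 Λ).trans (hcon J (Finset.mem_of_mem_erase hJ)).le
    have h3 := le_mul_of_one_le_right (hκ I hI).le h2
    exact absurd ((le_max_right 1 Λ).trans_lt h1) (by linarith)
  have hne : I.Nonempty := by
    rw [← Finset.card_pos, (Finset.mem_powersetCard.1 hI).2]
    exact hp
  obtain ⟨k, hk⟩ := hne
  refine le_trans ?_ (curvWeight_anti hκ (hl k))
  rw [curvWeight]
  have h4 : (∑ i ∈ I, κ i)⁻¹
      ≤ ∑ J ∈ pSets n p, if k ∈ J then (∑ i ∈ J, κ i)⁻¹ else 0 := by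
    refine le_trans (le_of_eq (if_pos hk).symm) (Finset.single_le_sum
      (f := fun J => if k ∈ J then (∑ i ∈ J, κ i)⁻¹ else 0) (fun J hJ => ?_) hI)
    have := hκ J hJ
    split_ifs <;> positivity
  refine le_trans ?_ h4
  rw [one_div]
  exact inv_anti₀ (hκ I hI) hIΛ

theorem card_filter_mem_pSets (hp : 1 ≤ p) (o : Fin n) :
    ((pSets n p).filter (o ∈ ·)).card = (n - 1).choose (p - 1) := by
  have h1 : (pSets n p).filter (o ∈ ·)
      = (Finset.powersetCard (p - 1) (Finset.univ.erase o)).image (insert o) := by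
    ext I
    simp only [Finset.mem_filter, Finset.mem_powersetCard, Finset.mem_image]
    constructor
    · rintro ⟨⟨-, h2⟩, h3⟩
      refine ⟨I.erase o, ⟨Finset.erase_subset_erase _ (Finset.subset_univ _), ?_⟩,
        Finset.insert_erase h3⟩
      rw [Finset.card_erase_of_mem h3, h2]
    · rintro ⟨J, ⟨h2, h3⟩, rfl⟩
      have : o ∉ J := fun h => (Finset.mem_erase.1 (h2 h)).1 rfl
      refine ⟨⟨Finset.subset_univ _, ?_⟩, Finset.mem_insert_self _ _⟩
      rw [Finset.card_insert_of_notMem this, h3]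
      omega
  rw [h1, Finset.card_image_of_injOn, Finset.card_powersetCard, Finset.card_erase_of_mem
    (Finset.mem_univ _), Finset.card_univ, Fintype.card_fin]
  intro J hJ J' hJ' h
  have h2 : ∀ J : Finset (Fin n), J ∈ (Finset.powersetCard (p - 1) (Finset.univ.erase o)) →
      o ∉ J := fun J hJ h => (Finset.mem_erase.1 ((Finset.mem_powersetCard.1 hJ).1 h)).1 rfl
  rw [← Finset.erase_insert (h2 J hJ), ← Finset.erase_insert (h2 J' hJ')]
  exact congrArg (fun A => Finset.erase A o) h

theorem card_filter_notMem_pSets (o : Fin n) :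
    ((pSets n p).filter (o ∉ ·)).card = (n - 1).choose p := by
  have h1 : (pSets n p).filter (o ∉ ·) = Finset.powersetCard p (Finset.univ.erase o) := by
    ext I
    simp only [Finset.mem_filter, Finset.mem_powersetCard, Finset.subset_univ, true_and,
      Finset.subset_erase]
    exact and_comm
  rw [h1, Finset.card_powersetCard, Finset.card_erase_of_mem (Finset.mem_univ _),
    Finset.card_univ, Fintype.card_fin]

theorem choose_pred_le (hp : 1 ≤ p) (hn : n ≤ 2 * p) :
    (n - 1).choose p ≤ (n - 1).choose (p - 1) := by
  obtain ⟨r, rfl⟩ : ∃ r, p = r + 1 := ⟨p - 1, by omega⟩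
  have h1 := Nat.choose_succ_right_eq (n - 1) r
  simp only [Nat.add_sub_cancel]
  have h2 : n - 1 - r ≤ r + 1 := by omega
  have h3 : (n - 1).choose (r + 1) * (r + 1) ≤ (n - 1).choose r * (r + 1) := by
    rw [h1]
    exact Nat.mul_le_mul_left _ h2
  exact Nat.le_of_mul_le_mul_right h3 (by omega)

/-- If all curvatures are nearly nonnegative, the sums which avoid the largest curvature are small
on average, since those which contain it are large and the product is bounded. Two families of
sums, of which the second is bounded above with a product bounded below, therefore have a large
quotient. Here `n ≤ 2 p` enters: the sums containing a given index are the majority. -/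
theorem le_sum_div_of_nearly_nonneg (hκ : ∀ I ∈ pSets n p, 0 < ∑ i ∈ I, κ i) (hp : 1 ≤ p)
    (hpn : p < n) (hn : n ≤ 2 * p) {o : Fin n} (hK : 0 < κ o)
    (hsmall : ∀ k, -(1 / (8 * p) * κ o) ≤ κ k) {Λ m ρ : ℝ} (hm : 0 < m) (hρ : 0 < ρ)
    (hΛ1 : 1 ≤ Λ) (hΛ : ∏ I ∈ pSets n p, ∑ i ∈ I, κ i ≤ Λ) {μ : Finset (Fin n) → ℝ}
    (hμ0 : ∀ I ∈ pSets n p, 0 < μ I) (hμ : ∀ I ∈ pSets n p, μ I ≤ p / ρ)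
    (hμm : m ≤ ∏ I ∈ pSets n p, μ I) (hKρ : 1 ≤ κ o * ρ) :
    min 1 (m / (2 * (2 * p) ^ (n - 1).choose (p - 1) * Λ)) * (κ o * ρ)
      ≤ ∑ I ∈ pSets n p, μ I / ∑ i ∈ I, κ i := by
  have hp' : (1 : ℝ) ≤ p := by exact_mod_cast hp
  set N1 := (n - 1).choose (p - 1) with hN1
  set N0 := (n - 1).choose p with hN0
  have hN01 : N0 ≤ N1 := choose_pred_le hp hn
  have hN0pos : N0 ≠ 0 := (Nat.choose_pos (by omega)).ne'
  set c := min 1 (m / (2 * (2 * p) ^ N1 * Λ)) with hc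
  have hc0 : 0 < c := lt_min one_pos (by positivity)
  by_contra! hcon
  have hlt : ∀ I ∈ pSets n p, μ I ≤ c * (κ o * ρ) * ∑ i ∈ I, κ i := by
    intro I hI
    have h1 : μ I / ∑ i ∈ I, κ i ≤ ∑ I ∈ pSets n p, μ I / ∑ i ∈ I, κ i :=
      Finset.single_le_sum (f := fun I => μ I / ∑ i ∈ I, κ i)
        (fun J hJ => (div_pos (hμ0 J hJ) (hκ J hJ)).le) hI
    exact (div_le_iff₀ (hκ I hI)).1 (h1.trans hcon.le)
  have hbig : ∀ I ∈ (pSets n p).filter (o ∈ ·), κ o / 2 ≤ ∑ i ∈ I, κ i := by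
    intro I hI
    obtain ⟨h1, h2⟩ := Finset.mem_filter.1 hI
    rw [← Finset.add_sum_erase _ _ h2]
    have h3 := Finset.card_nsmul_le_sum (I.erase o) κ _ fun i _ => hsmall i
    rw [nsmul_eq_mul, Finset.card_erase_of_mem h2, (Finset.mem_powersetCard.1 h1).2,
      Nat.cast_sub hp, Nat.cast_one] at h3
    have h4 : ((p : ℝ) - 1) * -(1 / (8 * p) * κ o) ≥ -(κ o / 2) := by
      have : ((p : ℝ) - 1) * (1 / (8 * p)) ≤ 1 / 2 := by
        rw [mul_one_div, div_le_iff₀ (by positivity)]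
        linarith
      nlinarith
    linarith
  have e1 : (κ o / 2) ^ N1 * ∏ I ∈ (pSets n p).filter (o ∉ ·), ∑ i ∈ I, κ i ≤ Λ := by
    refine le_trans ?_ hΛ
    rw [← Finset.prod_filter_mul_prod_filter_not (pSets n p) (o ∈ ·)]
    refine mul_le_mul_of_nonneg_right ?_ (Finset.prod_nonneg fun I hI =>
      (hκ I (Finset.mem_filter.1 hI).1).le)
    rw [hN1, ← card_filter_mem_pSets hp o, ← Finset.prod_const]
    exact Finset.prod_le_prod (fun _ _ => by positivity) hbig
  have e2 : ∏ I ∈ pSets n p, μ I ≤ (p / ρ) ^ N1 *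
      ((c * (κ o * ρ)) ^ N0 * ∏ I ∈ (pSets n p).filter (o ∉ ·), ∑ i ∈ I, κ i) := by
    rw [← Finset.prod_filter_mul_prod_filter_not (pSets n p) (o ∈ ·)]
    refine mul_le_mul ?_ ?_ (Finset.prod_nonneg fun I hI =>
      (hμ0 I (Finset.mem_filter.1 hI).1).le) (by positivity)
    · rw [hN1, ← card_filter_mem_pSets hp o, ← Finset.prod_const]
      exact Finset.prod_le_prod (fun I hI => (hμ0 I (Finset.mem_filter.1 hI).1).le)
        fun I hI => hμ I (Finset.mem_filter.1 hI).1
    · rw [hN0, ← card_filter_notMem_pSets o, ← Finset.prod_const, ← Finset.prod_mul_distrib]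
      exact Finset.prod_le_prod (fun I hI => (hμ0 I (Finset.mem_filter.1 hI).1).le)
        fun I hI => hlt I (Finset.mem_filter.1 hI).1
  set Q := ∏ I ∈ (pSets n p).filter (o ∉ ·), ∑ i ∈ I, κ i with hQ
  have hQ0 : 0 ≤ Q := Finset.prod_nonneg fun I hI => (hκ I (Finset.mem_filter.1 hI).1).le
  have e3 : (c * (κ o * ρ)) ^ N0 ≤ c * (κ o * ρ) ^ N1 := by
    rw [mul_pow]
    exact mul_le_mul (pow_le_of_le_one hc0.le (min_le_left _ _) hN0pos)
      (pow_le_pow_right₀ hKρ hN01) (by positivity) hc0.le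
  have e4 : (p / ρ : ℝ) ^ N1 * (c * (κ o * ρ) ^ N1 * Q)
      = (2 * p) ^ N1 * c * ((κ o / 2) ^ N1 * Q) := by
    rw [mul_pow, mul_pow, div_pow, div_pow]
    field_simp
  have e5 : (2 * p : ℝ) ^ N1 * c * ((κ o / 2) ^ N1 * Q) ≤ (2 * p) ^ N1 * c * Λ :=
    mul_le_mul_of_nonneg_left e1 (by positivity)
  have e6 : (2 * p : ℝ) ^ N1 * c * Λ ≤ m / 2 := by
    have : c ≤ m / (2 * (2 * p) ^ N1 * Λ) := min_le_right _ _
    rw [le_div_iff₀ (by positivity)] at this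
    linarith
  have e7 : (p / ρ : ℝ) ^ N1 * ((c * (κ o * ρ)) ^ N0 * Q)
      ≤ (p / ρ : ℝ) ^ N1 * (c * (κ o * ρ) ^ N1 * Q) :=
    mul_le_mul_of_nonneg_left (mul_le_mul_of_nonneg_right e3 hQ0) (by positivity)
  linarith

end Weights

/-! ### Absorption of the gradient terms -/

section Absorption

/-- The third-derivative terms of the second-order condition dominate `(3/2) F y²`. -/
theorem three_halves_le_gradient_terms {F F₀ d K y : ℝ} (hK : 0 < K) (hd0 : 0 ≤ d)
    (hd : d ≤ 9 / 8 * K) (hF0 : 0 < F₀) (hF : F₀ ≤ F) (hd' : d = 0 → F = F₀) :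
    3 / 2 * F * y ^ 2 ≤ 2 * K * ((F - F₀) * (y ^ 2 / d) + F₀ * (y ^ 2 / (d + K / 8))) := by
  rcases hd0.eq_or_lt with rfl | hdpos
  · rw [hd' rfl]
    have : 2 * K * ((F₀ - F₀) * (y ^ 2 / 0) + F₀ * (y ^ 2 / (0 + K / 8))) = 16 * F₀ * y ^ 2 := by
      field_simp
      ring
    rw [this]
    linarith [mul_nonneg hF0.le (sq_nonneg y)]
  · have h1 : 8 / 9 * (y ^ 2) ≤ K * (y ^ 2 / d) := by
      rw [← mul_div_assoc, le_div_iff₀ hdpos]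
      linarith [mul_nonneg (sub_nonneg.2 hd) (sq_nonneg y)]
    have h2 : 4 / 5 * (y ^ 2) ≤ K * (y ^ 2 / (d + K / 8)) := by
      rw [← mul_div_assoc, le_div_iff₀ (by linarith)]
      linarith [mul_nonneg (sub_nonneg.2 hd) (sq_nonneg y)]
    have h3 := mul_le_mul_of_nonneg_left h1 (sub_nonneg.2 hF)
    have h4 := mul_le_mul_of_nonneg_left h2 hF0.le
    linarith [mul_nonneg hF0.le (sq_nonneg y), mul_nonneg (sub_nonneg.2 hF) (sq_nonneg y)]

/-- Indices with `κ ≥ -θ K`: since `y + φ = β σ - 3 E z`, the positive multiples of `y²`, `φ²` and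
`z²` leave a multiple of `β² σ²`. -/
theorem absorb_good {y φ z σ β E : ℝ} (hy : y = β * σ - φ - 3 * E * z) (hE : 0 ≤ E)
    (hβ : 6 * (1 + E) ≤ β) : 2 * β * σ ^ 2 ≤ 1 / 2 * y ^ 2 + φ ^ 2 + 3 * E * z ^ 2 := by
  have h1 : (β * σ - 3 * E * z) ^ 2 / 3 ≤ 1 / 2 * y ^ 2 + φ ^ 2 := by
    have : β * σ - 3 * E * z = y + φ := by rw [hy]; ring
    rw [this]
    linarith [sq_nonneg (y - 2 * φ)]
  have h2 : (β * σ) ^ 2 ≤ (1 + E) * ((β * σ - 3 * E * z) ^ 2 + 9 * E * z ^ 2) := by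
    linarith [mul_nonneg hE (sq_nonneg (β * σ - 3 * E * z - 3 * z))]
  have h3 : 6 * (1 + E) * (β * σ ^ 2) ≤ (β * σ) ^ 2 := by
    have : 0 ≤ β * σ ^ 2 := mul_nonneg (by linarith) (sq_nonneg σ)
    linarith [mul_le_mul_of_nonneg_right hβ this]
  have h4 : 0 ≤ (1 + E) * ((β * σ - 3 * E * z) ^ 2 + 9 * E * z ^ 2 - 6 * (β * σ ^ 2)) := by
    linarith
  have h5 := nonneg_of_mul_nonneg_right h4 (by linarith : 0 < 1 + E)
  linarith

/-- Indices with `|κ| ≥ θ K`: the negative terms are lower order in `κ`. -/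
theorem absorb_bad {y φ z σ β E a k R η : ℝ} (hy : y = β * σ - φ - 3 * E * z) (hE : 0 ≤ E)
    (ha : 0 < a) (ha1 : a ≤ 1) (hη : 0 < η) (hβ : 1 ≤ β) (hβR : β ≤ R) (hφ : |φ| ≤ |k| / a)
    (hR : |β * σ - 3 * E * z| ≤ R / η) (hσ : |σ| ≤ 1 / η) (hk : 8 * R / a ^ 2 ≤ |k| * η) :
    2 * β * σ ^ 2 + y ^ 2 ≤ a / 2 * k ^ 2 + φ ^ 2 + 3 * E * z ^ 2 := by
  set r := β * σ - 3 * E * z with hr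
  have hyr : y = r - φ := by rw [hy]; ring
  have hR1 : 1 ≤ R := hβ.trans hβR
  have h1 : |r * φ| ≤ R / η * (|k| / a) := by
    rw [abs_mul]
    exact mul_le_mul hR hφ (abs_nonneg _) (by positivity)
  have h2 : r ^ 2 ≤ (R / η) ^ 2 := sq_le_sq' (abs_le.1 hR).1 (abs_le.1 hR).2
  have h3 : β * σ ^ 2 ≤ (R / η) ^ 2 := by
    have : σ ^ 2 ≤ (1 / η) ^ 2 := sq_le_sq' (abs_le.1 hσ).1 (abs_le.1 hσ).2
    calc β * σ ^ 2 ≤ R ^ 2 * (1 / η) ^ 2 := by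
          refine mul_le_mul (by nlinarith) this (sq_nonneg _) (by positivity)
      _ = (R / η) ^ 2 := by ring
  set Q := |k| with hQ
  have hk2 : k ^ 2 = Q ^ 2 := (sq_abs k).symm
  set s := R / η with hs
  have hs0 : 0 ≤ s := by positivity
  have hQs : 8 * s ≤ a ^ 2 * Q := by
    rw [div_le_iff₀ (by positivity)] at hk
    rw [hs, ← mul_div_assoc, div_le_iff₀ hη]
    linarith
  have hQ0 : 0 ≤ Q := abs_nonneg k
  have h4 : s * (Q / a) ≤ a / 8 * Q ^ 2 := by
    rw [← mul_div_assoc, div_le_iff₀ ha]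
    linarith [mul_le_mul_of_nonneg_right hQs hQ0]
  have h5 : 3 * s ^ 2 ≤ a / 8 * Q ^ 2 := by
    have e2 : a ^ 2 ≤ a := pow_le_of_le_one ha.le ha1 two_ne_zero
    have e1 : 8 * s ≤ a * Q := hQs.trans (mul_le_mul_of_nonneg_right e2 hQ0)
    have e3 : (8 * s) ^ 2 ≤ (a * Q) ^ 2 := pow_le_pow_left₀ (by positivity) e1 2
    linarith [mul_nonneg (sub_nonneg.2 e2) (sq_nonneg Q), sq_nonneg s]
  have h6 := neg_abs_le (r * φ)
  have h7 := mul_nonneg hE (sq_nonneg z)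
  have h8 : 0 ≤ a / 8 * Q ^ 2 := by positivity
  rw [hyr, hk2]
  linarith

set_option maxHeartbeats 400000 in
/-- The terms belonging to one index of the summed second-order condition. -/
theorem absorb {F F₀ d K k s b V y η ρ c a β E L θ : ℝ} {top : Prop} [Decidable top]
    (hK : 0 < K) (hkK : k ≤ K) (hd : d = K - k) (hF0 : 0 < F₀) (hF : F₀ ≤ F)
    (hd' : d = 0 → F = F₀) (htop : top → k = K) (hL : 1 ≤ L) (hs : |s| ≤ 1) (hb : |b| ≤ L)
    (hV : V ≤ 2 * (s ^ 2 + b ^ 2)) (ha : 0 < a) (hca : a ≤ c - a) (hc : c ≤ 1) (hη : 0 < η)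
    (hρ : 0 < ρ) (hηρ : η ≤ 24 * L ^ 2 * ρ) (hE : 0 ≤ E) (hβ1 : 6 * (1 + E) ≤ β)
    (hβ2 : 3456 * L ^ 4 * E ≤ β) (hy : y = β * s / η - k * s / (c - a) - 3 * E / ρ * b)
    (hθ0 : 0 < θ) (hθ : θ ≤ 1 / 8)
    (hbig : 8 * (β + 72 * E * L ^ 3) / a ^ 2 ≤ θ * K * η) :
    a / 2 * (F * k ^ 2) ≤ F * (-y ^ 2 + (c / (c - a) - 1) * k ^ 2 + (k * s / (c - a)) ^ 2
        - β * (s / η) ^ 2 - 3 * E / ρ * V / ρ + 9 * E / ρ ^ 2 * b ^ 2)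
      + if top then 0 else 2 * K * ((F - F₀) * (y ^ 2 / d) + F₀ * (y ^ 2 / (d + K / 8))) := by
  have hca0 : 0 < c - a := ha.trans_le hca
  have hF' : 0 < F := hF0.trans_le hF
  set σ := s / η with hσ
  set z := b / ρ with hz
  set φ := k * s / (c - a) with hφ
  have hy' : y = β * σ - φ - 3 * E * z := by rw [hy, hσ, hz]; ring
  have hd0 : 0 ≤ d := by linarith
  have e1 : a * k ^ 2 ≤ (c / (c - a) - 1) * k ^ 2 := by
    refine mul_le_mul_of_nonneg_right ?_ (sq_nonneg k)
    rw [le_sub_iff_add_le, le_div_iff₀ hca0]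
    linarith [mul_le_of_le_one_right ha.le (by linarith : c - a ≤ 1)]
  have e2 : 3 * E / ρ * V / ρ ≤ β * σ ^ 2 + 6 * E * z ^ 2 := by
    have h1 : 3 * E / ρ * V / ρ ≤ 6 * E * (s / ρ) ^ 2 + 6 * E * z ^ 2 := by
      have : 3 * E / ρ * V / ρ = 3 * E / ρ ^ 2 * V := by field_simp
      rw [this]
      refine (mul_le_mul_of_nonneg_left hV (by positivity)).trans_eq ?_
      rw [hz]
      field_simp
      ring
    have h2 : (s / ρ) ^ 2 ≤ 576 * L ^ 4 * σ ^ 2 := by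
      have h3 : (η / ρ) ^ 2 ≤ (24 * L ^ 2) ^ 2 := by
        refine pow_le_pow_left₀ (by positivity) ?_ 2
        rwa [div_le_iff₀ hρ]
      have h4 : s / ρ = σ * (η / ρ) := by rw [hσ]; field_simp
      rw [h4, mul_pow]
      linarith [mul_le_mul_of_nonneg_left h3 (sq_nonneg σ)]
    have h5 := mul_le_mul_of_nonneg_left h2 (by positivity : 0 ≤ 6 * E)
    have h6 := mul_le_mul_of_nonneg_right hβ2 (sq_nonneg σ)
    linarith
  have e3 : 9 * E / ρ ^ 2 * b ^ 2 = 9 * E * z ^ 2 := by rw [hz]; field_simp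
  have e4 : -y ^ 2 + a * k ^ 2 + φ ^ 2 - 2 * β * σ ^ 2 + 3 * E * z ^ 2
      ≤ -y ^ 2 + (c / (c - a) - 1) * k ^ 2 + φ ^ 2
        - β * σ ^ 2 - 3 * E / ρ * V / ρ + 9 * E / ρ ^ 2 * b ^ 2 := by
    rw [e3]
    linarith
  have hgood : d ≤ 9 / 8 * K → 3 / 2 * F * y ^ 2 ≤
      2 * K * ((F - F₀) * (y ^ 2 / d) + F₀ * (y ^ 2 / (d + K / 8))) := fun h =>
    three_halves_le_gradient_terms hK hd0 h hF0 hF hd'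
  have hZ : 0 ≤ 2 * K * ((F - F₀) * (y ^ 2 / d) + F₀ * (y ^ 2 / (d + K / 8))) := by
    have := sub_nonneg.2 hF
    positivity
  have hbad : θ * K ≤ |k| → a / 2 * (F * k ^ 2) ≤ F * (-y ^ 2 + (c / (c - a) - 1) * k ^ 2 + φ ^ 2
        - β * σ ^ 2 - 3 * E / ρ * V / ρ + 9 * E / ρ ^ 2 * b ^ 2) := by
    intro hk
    have h1 := absorb_bad (R := β + 72 * E * L ^ 3) (k := k) hy' hE ha (by linarith) hη
      (by linarith) (by have := mul_nonneg hE (pow_nonneg (zero_le_one.trans hL) 3); linarith)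
      (by
        rw [hφ, abs_div, abs_mul, abs_of_pos hca0]
        exact div_le_div₀ (abs_nonneg _) (mul_le_of_le_one_right (abs_nonneg _) hs) ha hca)
      (by
        refine (abs_sub _ _).trans ?_
        rw [abs_mul, abs_mul, abs_of_nonneg (by positivity : 0 ≤ 3 * E), hσ, hz, abs_div, abs_div,
          abs_of_pos hη, abs_of_pos hρ, abs_of_nonneg (by linarith : 0 ≤ β), add_div]
        refine add_le_add ?_ ?_
        · rw [← mul_div_assoc]
          exact div_le_div_of_nonneg_right (mul_le_of_le_one_right (by linarith) hs) hη.le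
        · rw [← mul_div_assoc, div_le_div_iff₀ hρ hη]
          calc 3 * E * |b| * η ≤ 3 * E * L * (24 * L ^ 2 * ρ) := by gcongr
            _ = 72 * E * L ^ 3 * ρ := by ring)
      (by
        rw [hσ, abs_div, abs_of_pos hη]
        exact div_le_div_of_nonneg_right hs hη.le)
      (hbig.trans (mul_le_mul_of_nonneg_right hk hη.le))
    have h2 := mul_le_mul_of_nonneg_left e4 hF'.le
    have h3 : a / 2 * (F * k ^ 2) = F * (a / 2 * k ^ 2) := by ring
    rw [h3]
    refine le_trans (mul_le_mul_of_nonneg_left ?_ hF'.le) h2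
    linarith
  split_ifs with h
  · rw [add_zero]
    refine hbad ?_
    rw [htop h, abs_of_pos hK]
    exact mul_le_of_le_one_left hK.le (by linarith)
  · by_cases hk : -(θ * K) ≤ k
    · have h1 := absorb_good hy' hE hβ1
      have h2 := mul_le_mul_of_nonneg_left e4 hF'.le
      have h3 := hgood (by linarith [mul_le_mul_of_nonneg_right hθ hK.le])
      have h4 := mul_le_mul_of_nonneg_left h1 hF'.le
      have h5 : 0 ≤ F * (a / 2 * k ^ 2) := by positivity
      refine le_trans ?_ (add_le_add h2 h3)
      linarith
    · have := hbad (by rw [le_abs]; right; linarith)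
      linarith

end Absorption

/-! ### The second-order condition after absorption -/

section

set_option maxSynthPendingDepth 3

namespace GraphSurface

variable {n : ℕ}

theorem abs_fderiv_le_norm_gradient (u : Eucl n → ℝ) (x v : Eucl n) :
    |fderiv ℝ u x v| ≤ ‖gradient u x‖ * ‖v‖ := by
  rw [← inner_grad]
  exact abs_real_inner_le_norm _ _

namespace IsTestMax

variable {u : Eucl n → ℝ} {t ρ β a B : ℝ} {x x' : Eucl n} {O : Eucl n ≃ₗᵢ[ℝ] Eucl n}
  {q : Eucl n → ℝ} {κ : Fin n → ℝ} {o : Fin n}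

theorem norm_frameMap_sub_untilt_sq_le (k : Fin n) :
    ‖frameMap u x O (basisVec k) - untilt (gradient u x') (O (basisVec k))‖ ^ 2
      ≤ 2 * (slopeForm u x O (basisVec k) ^ 2
        + fderiv ℝ u x' (frameMap u x O (basisVec k)) ^ 2) := by
  have h1 := norm_sub_untilt_tilt_le (gradient u x) (gradient u x') (frameMap u x O (basisVec k))
  rw [inner_grad, inner_grad, frameMap_apply, tilt_untilt, ← frameMap_apply] at h1
  have h2 := pow_le_pow_left₀ (norm_nonneg _) h1 2
  refine h2.trans ?_
  rw [slopeForm, ContinuousLinearMap.comp_apply, ← sq_abs (fderiv ℝ u x _),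
    ← sq_abs (fderiv ℝ u x' _)]
  nlinarith [sq_nonneg (|fderiv ℝ u x (frameMap u x O (basisVec k))|
    - |fderiv ℝ u x' (frameMap u x O (basisVec k))|)]

/-- The second-order condition after absorption of the gradient terms, valid when the curvature is
large compared with the inverse height. -/
theorem reduced (h : IsTestMax u t ρ β a B x x' O q κ o) {p : ℕ}
    (hκ : ∀ I ∈ pSets n p, 0 < ∑ i ∈ I, κ i) (hp : 1 ≤ p) (hpn : p ≤ n)
    {G : Fin n → ℝ} {η E g L : ℝ}
    (hη : η = -u x - t / 2) (hE : E = B * Real.exp (3 / ρ * supKernel u ρ x x'))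
    (hG : ∀ k, G k = ∑ i, curvWeight p κ i * third q (basisVec k) (basisVec i) (basisVec i))
    (hg : g + 2 * curvWeight p κ o * κ o ^ 3 + κ o ^ 2 * ∑ i, curvWeight p κ i * κ i +
      2 * ∑ i, (curvWeight p κ i - curvWeight p κ o) *
          (third q (basisVec o) (basisVec o) (basisVec i) ^ 2 / (κ o - κ i)) ≤
      ∑ i, curvWeight p κ i * fourth q (basisVec i) (basisVec i) (basisVec o) (basisVec o))
    (hL : 1 ≤ L) (hD : ‖gradient u x‖ ≤ L) (hD' : ‖gradient u x'‖ ≤ L) (ha : 0 < a)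
    (hca : a ≤ (areaFactor u x)⁻¹ - a) (hηρ : η ≤ 24 * L ^ 2 * ρ)
    (hβ1 : 6 * (1 + E) ≤ β) (hβ2 : 3456 * L ^ 4 * E ≤ β)
    (hbig1 : 8 * (β + 72 * E * L ^ 3) / a ^ 2 ≤ 1 / (8 * p) * κ o * η)
    (hbig2 : 4 * (β + 72 * E * L ^ 4) ≤ κ o * η) :
    g / κ o + 3 / 4 * κ o * n.choose p + a / 2 * ∑ k, curvWeight p κ k * κ k ^ 2
        + 3 * E / ρ * ∑ k, curvWeight p κ k * fderiv ℝ (fderiv ℝ u) x'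
          (untilt (gradient u x') (O (basisVec k))) (untilt (gradient u x') (O (basisVec k)))
      ≤ (∑ i, |G i|) / a ∧
    ∀ k, |third q (basisVec o) (basisVec o) (basisVec k)| ≤ κ o * (κ o + p * κ o / a) := by
  have hK := h.top_pos
  have hη0 : 0 < η := hη ▸ h.height_pos
  have hρ := h.rho_pos
  have hE0 : 0 ≤ E := hE ▸ mul_nonneg h.B_pos.le (Real.exp_pos _).le
  have hp' : (1 : ℝ) ≤ p := by exact_mod_cast hp
  obtain ⟨c, hc⟩ : ∃ c, c = (areaFactor u x)⁻¹ := ⟨_, rfl⟩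
  obtain ⟨s, hs⟩ : ∃ s : Fin n → ℝ, ∀ i, s i = slopeForm u x O (basisVec i) := ⟨_, fun _ => rfl⟩
  obtain ⟨b, hb⟩ : ∃ b : Fin n → ℝ, ∀ i, b i = fderiv ℝ u x' (frameMap u x O (basisVec i)) :=
    ⟨_, fun _ => rfl⟩
  obtain ⟨y, hy⟩ : ∃ y : Fin n → ℝ,
      ∀ i, y i = third q (basisVec o) (basisVec o) (basisVec i) / κ o := ⟨_, fun _ => rfl⟩
  have hδ : 0 < κ o / 8 := by linarith
  have h1 := h.combined hκ hp hpn hδ (fun k => untilt (gradient u x') (O (basisVec k)))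
    hs hb hy hη hc hE hG hg
  have hy1 := fun k => (h.variation_basis hδ k 0 hs hb hy hη hc hE).1
  rw [← hc] at hca
  have hc1 : c ≤ 1 := by
    rw [hc]
    refine inv_le_one_of_one_le₀ ?_
    rw [areaFactor_eq]
    exact one_le_slopeFactor _
  have hc0 : 0 ≤ c := by linarith
  have hca0 : 0 < c - a := by linarith
  have hs1 : ∀ k, |s k| ≤ 1 := fun k => hs k ▸ IsTangentGraph.abs_slopeForm_le k
  have hb1 : ∀ k, |b k| ≤ L := fun k => by
    rw [hb]
    refine (abs_fderiv_le_norm_gradient _ _ _).trans ?_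
    have := IsTangentGraph.norm_frameMap_le (u := u) (x := x) (O := O) k
    exact (mul_le_of_le_one_right (norm_nonneg _) this).trans hD'
  have hX : |fderiv ℝ u x' (gradient u x)| ≤ L ^ 2 := by
    refine (abs_fderiv_le_norm_gradient _ _ _).trans ?_
    rw [pow_two]
    exact mul_le_mul hD' hD (norm_nonneg _) (by linarith)
  have hF := curvWeight_pos hp hpn hκ
  constructor
  · have h2 : ∀ k ∈ Finset.univ, _ := fun k _ => absorb (F := curvWeight p κ k)
      (F₀ := curvWeight p κ o) (d := κ o - κ k) (k := κ k) (s := s k) (b := b k)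
      (V := ‖frameMap u x O (basisVec k) - untilt (gradient u x') (O (basisVec k))‖ ^ 2)
      (y := y k) (η := η) (ρ := ρ) (c := c) (a := a) (β := β) (E := E) (L := L)
      (θ := 1 / (8 * p)) (top := k = o) hK (h.le_top k) rfl (hF o)
      (curvWeight_anti hκ (h.le_top k))
      (fun hd => le_antisymm (curvWeight_anti hκ (sub_eq_zero.1 hd).le)
        (curvWeight_anti hκ (h.le_top k)))
      (fun hk => by rw [hk]) hL (hs1 k) (hb1 k)
      (by rw [hs, hb]; exact norm_frameMap_sub_untilt_sq_le k)
      ha hca hc1 hη0 hρ hηρ hE0 hβ1 hβ2 (hy1 k) (by positivity)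
      (one_div_le_one_div_of_le (by norm_num) (by linarith)) hbig1
    have h3 := Finset.sum_le_sum h2
    rw [Finset.sum_add_distrib, ← Finset.mul_sum] at h3
    have h4 : (∑ k, if k = o then (0 : ℝ) else 2 * κ o *
        ((curvWeight p κ k - curvWeight p κ o) * (y k ^ 2 / (κ o - κ k))
          + curvWeight p κ o * (y k ^ 2 / (κ o - κ k + κ o / 8))))
        = 2 * κ o * ∑ i, (curvWeight p κ i - curvWeight p κ o) * (y i ^ 2 / (κ o - κ i))
          + 2 * κ o * curvWeight p κ o *
            ∑ l ∈ Finset.univ.erase o, y l ^ 2 / (κ o - κ l + κ o / 8) := by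
      rw [← Finset.add_sum_erase _ _ (Finset.mem_univ o), if_pos rfl, zero_add,
        ← Finset.add_sum_erase (a := o) _ (fun i => (curvWeight p κ i - curvWeight p κ o) * _)
          (Finset.mem_univ o), sub_self, zero_mul, zero_add, Finset.mul_sum, Finset.mul_sum,
        ← Finset.sum_add_distrib]
      refine Finset.sum_congr rfl fun l hl => ?_
      rw [if_neg (Finset.ne_of_mem_erase hl)]
      ring
    rw [h4] at h3
    rw [sum_curvWeight_mul_self hκ] at h1
    have h5 : -((∑ i, |G i|) / a) ≤ (∑ i, G i * s i) / (c - a) := by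
      refine (neg_le_neg ?_).trans (neg_abs_le _)
      rw [abs_div, abs_of_pos hca0]
      refine div_le_div₀ (Finset.sum_nonneg fun _ _ => abs_nonneg _) ?_ ha hca
      refine (Finset.abs_sum_le_sum_abs _ _).trans (Finset.sum_le_sum fun i _ => ?_)
      rw [abs_mul]
      exact mul_le_of_le_one_right (abs_nonneg _) (hs1 i)
    have h6 : β * c / η + 3 * E / ρ * (c * fderiv ℝ u x' (gradient u x)) ≤ κ o / 4 := by
      have e1 : 3 * E / ρ ≤ 72 * E * L ^ 2 / η := by
        rw [div_le_div_iff₀ hρ hη0]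
        calc 3 * E * η ≤ 3 * E * (24 * L ^ 2 * ρ) := by gcongr
          _ = 72 * E * L ^ 2 * ρ := by ring
      have e2 : c * fderiv ℝ u x' (gradient u x) ≤ L ^ 2 := by
        refine (mul_le_mul_of_nonneg_left ((le_abs_self _).trans hX) hc0).trans ?_
        exact mul_le_of_le_one_left (by positivity) hc1
      have e3 : 3 * E / ρ * (c * fderiv ℝ u x' (gradient u x)) ≤ 72 * E * L ^ 2 / η * L ^ 2 :=
        (mul_le_mul_of_nonneg_left e2 (by positivity)).trans
          (mul_le_mul_of_nonneg_right e1 (by positivity))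
      have e4 : β * c / η ≤ β / η :=
        div_le_div_of_nonneg_right (mul_le_of_le_one_right (by linarith) hc1) hη0.le
      have e5 : β / η + 72 * E * L ^ 2 / η * L ^ 2 ≤ κ o / 4 := by
        have : β / η + 72 * E * L ^ 2 / η * L ^ 2 = (β + 72 * E * L ^ 4) / η := by
          field_simp
        rw [this, div_le_iff₀ hη0]
        linarith
      linarith
    have h7 := mul_le_mul_of_nonneg_right h6 (Nat.cast_nonneg (α := ℝ) (n.choose p))
    linarith
  · intro k
    have hyk : |y k| ≤ κ o + p * κ o / a := by
      have e1 : |κ k * s k / (c - a)| ≤ p * κ o / a := by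
        rw [abs_div, abs_of_pos hca0, abs_mul]
        refine div_le_div₀ (by positivity) ?_ ha hca
        exact (mul_le_of_le_one_right (abs_nonneg _) (hs1 k)).trans
          (abs_le_mul_top hκ hp hpn h.le_top hK k)
      have e2 : |β * s k / η| ≤ β / η := by
        rw [abs_div, abs_of_pos hη0, abs_mul, abs_of_nonneg (by linarith : 0 ≤ β)]
        exact div_le_div_of_nonneg_right (mul_le_of_le_one_right (by linarith) (hs1 k)) hη0.le
      have e3 : |3 * E / ρ * b k| ≤ 72 * E * L ^ 3 / η := by
        rw [abs_mul, abs_of_nonneg (by positivity), div_mul_eq_mul_div, div_le_div_iff₀ hρ hη0]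
        calc 3 * E * |b k| * η ≤ 3 * E * L * (24 * L ^ 2 * ρ) := by gcongr; exact hb1 k
          _ = 72 * E * L ^ 3 * ρ := by ring
      have e4 : β / η + 72 * E * L ^ 3 / η ≤ κ o := by
        rw [← add_div, div_le_iff₀ hη0]
        have : E * L ^ 3 ≤ E * L ^ 4 :=
          mul_le_mul_of_nonneg_left (pow_le_pow_right₀ hL (by norm_num)) hE0
        linarith [mul_nonneg hE0 (by positivity : 0 ≤ L ^ 4)]
      rw [hy1 k]
      refine (abs_sub _ _).trans ?_
      have := abs_sub (β * s k / η) (κ k * s k / (c - a))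
      linarith
    have : third q (basisVec o) (basisVec o) (basisVec k) = κ o * y k := by
      rw [hy]; field_simp
    rw [this, abs_mul, abs_of_pos hK]
    exact mul_le_mul_of_nonneg_left hyk hK.le

end IsTestMax

end GraphSurface

end

/-! ### The estimate at a maximum point -/

section

set_option maxSynthPendingDepth 3

namespace GraphSurface

variable {n : ℕ}

namespace IsTestMax

variable {u : Eucl n → ℝ} {t ρ β a B : ℝ} {x x' : Eucl n} {O : Eucl n ≃ₗᵢ[ℝ] Eucl n}
  {q : Eucl n → ℝ} {κ : Fin n → ℝ} {o : Fin n}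

/-- The contribution of the second derivatives at the second point, compared with the sums of the
second fundamental form there. These are positive by admissibility, bounded above by maximality in
the second point, and their product is bounded below by the equation. -/
theorem second_point_sums (h : IsTestMax u t ρ β a B x x' O q κ o) {p : ℕ}
    (hκ : ∀ I ∈ pSets n p, 0 < ∑ i ∈ I, κ i)
    (hadm : ∀ s ∈ (principalCurvatures u x').powersetCard p, 0 ≤ s.sum)
    (hpos : 0 < curvatureProd p u x') :
    ∃ μ : Finset (Fin n) → ℝ, (∀ I ∈ pSets n p, 0 < μ I) ∧ (∀ I ∈ pSets n p, μ I ≤ p / ρ) ∧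
      curvatureProd p u x' ≤ ∏ I ∈ pSets n p, μ I ∧
      ∑ I ∈ pSets n p, μ I / ∑ i ∈ I, κ i ≤ ∑ k, curvWeight p κ k * fderiv ℝ (fderiv ℝ u) x'
          (untilt (gradient u x') (O (basisVec k))) (untilt (gradient u x') (O (basisVec k))) := by
  have hρ := h.rho_pos
  obtain ⟨κ', O', hF⟩ := exists_isPrincipalFrame (u := u)
    (x := x') (h.contDiffAt'.isSymmSndFDerivAt (by simp))
  set T : Fin n → Eucl n := fun k => untilt (gradient u x') (O (basisVec k)) with hT
  have hs := hF.schur (p := p) (fun I hI => hF.sum_pos hadm hpos hI) (e := T) fun i j => by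
    rw [hT, gForm_untilt, LinearIsometryEquiv.inner_map_map, EuclideanSpace.inner_single_left]
    simp
  have hw := areaFactor_pos u x'
  have hw1 : 1 ≤ areaFactor u x' := by rw [areaFactor_eq]; exact one_le_slopeFactor _
  refine ⟨fun I => ∑ i ∈ I, hForm u x' (T i) (T i), hs.1, fun I hI => ?_, ?_, ?_⟩
  · have h1 : ∀ i ∈ I, hForm u x' (T i) (T i) ≤ 1 / ρ := fun i _ => by
      rw [hForm, div_le_iff₀ hw]
      refine (h.second_point (T i)).2.trans ?_
      have h2 : ‖T i‖ ≤ 1 := by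
        refine (norm_untilt_le _ _).trans ?_
        simp
      have h3 : ‖T i‖ ^ 2 ≤ 1 := pow_le_one₀ (norm_nonneg _) h2
      rw [div_mul_eq_mul_div, one_mul]
      exact div_le_div_of_nonneg_right (h3.trans hw1) hρ.le
    refine (Finset.sum_le_card_nsmul _ _ _ h1).trans_eq ?_
    rw [nsmul_eq_mul, (Finset.mem_powersetCard.1 hI).2, mul_one_div]
  · have h1 := hs.2
    rw [← Real.log_prod fun I hI => (hs.1 I hI).ne'] at h1
    exact (Real.log_le_log_iff hpos (Finset.prod_pos hs.1)).1 h1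
  · rw [← sum_pSets_eq_sum_curvWeight]
    refine Finset.sum_le_sum fun I hI => div_le_div_of_nonneg_right ?_ (hκ I hI).le
    have h1 := hs.1 I hI
    simp only [hForm, ← Finset.sum_div] at h1 ⊢
    exact div_le_self ((div_pos_iff_of_pos_right hw).1 h1).le hw1

end IsTestMax

set_option maxHeartbeats 1000000 in
/-- **The curvature estimate at a maximum point of the test function.** If the coefficient of the
two-point term is large, depending on the data but not on `β`, the largest principal curvature is
bounded by a multiple of the inverse height. -/
theorem exists_bound_at_testMax {n p : ℕ} (hp : 1 ≤ p) (hpn : p ≤ n) {L m Λ a : ℝ} (hL : 1 ≤ L)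
    (hm : 0 < m) (hΛ : 1 ≤ Λ) (ha : 0 < a) :
    ∃ E₀ : ℝ, 0 < E₀ ∧ ∀ B β : ℝ, 0 < B → 6 * (1 + B) ≤ β → 3456 * L ^ 4 * B ≤ β →
      ∃ C : ℝ, 0 < C ∧ ∀ (u : Eucl n → ℝ) (f : RhsSpace n → ℝ) (t ρ : ℝ) (x x' : Eucl n)
        (O : Eucl n ≃ₗᵢ[ℝ] Eucl n) (q : Eucl n → ℝ) (κ : Fin n → ℝ) (o : Fin n),
        IsTestMax u t ρ β a B x x' O q κ o →
        E₀ ≤ B * Real.exp (3 / ρ * supKernel u ρ x x') → supKernel u ρ x x' ≤ 0 →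
        ‖gradient u x‖ ≤ L → ‖gradient u x'‖ ≤ L → a ≤ (areaFactor u x)⁻¹ - a →
        -u x - t / 2 ≤ 24 * L ^ 2 * ρ → -u x - t / 2 ≤ L →
        (∀ᶠ y in 𝓝 x, (∀ s ∈ (principalCurvatures u y).powersetCard p, 0 ≤ s.sum) ∧
          0 < curvatureProd p u y) →
        (∀ s ∈ (principalCurvatures u x').powersetCard p, 0 ≤ s.sum) →
        m ≤ curvatureProd p u x' → curvatureProd p u x ≤ Λ →
        ContDiffAt ℝ 2 f (x, u x, normal u x) → m ≤ f (x, u x, normal u x) →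
        ‖fderiv ℝ f (x, u x, normal u x)‖ ≤ Λ →
        ‖fderiv ℝ (fderiv ℝ f) (x, u x, normal u x)‖ ≤ Λ →
        (n ≤ 2 * p ∧ (∀ᶠ y in 𝓝 x, curvatureProd p u y = f (y, u y, normal u y)) ∨
          ∀ᶠ y in 𝓝 x, curvatureProd p u y = f (y, u y, normal u x)) →
        κ o * (-u x - t / 2) ≤ C := by
  have hp' : (1 : ℝ) ≤ p := by exact_mod_cast hp
  set A := Λ / m with hA
  have hA0 : 0 < A := by positivity
  set c₂ := min 1 (m / (2 * (2 * p) ^ (n - 1).choose (p - 1) * Λ)) with hc₂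
  have hc₂0 : 0 < c₂ := lt_min one_pos (by positivity)
  set C₁ := A * (2 + n * (1 + p / a)) + 4 * (A + A ^ 2) + n * A * (1 + p) / a with hC₁
  have hC₁0 : 0 < C₁ := by positivity
  set K₂ := 2 * (2 * A + A ^ 2 + n * A / a) with hK₂
  have hK₂0 : 0 < K₂ := by positivity
  -- with this lower bound for `E`, the two-point term exceeds `C₁ K`
  refine ⟨(C₁ + 1) / (3 * c₂), by positivity, fun B β hB hβ1 hβ2 => ?_⟩
  -- the sum of the thresholds for `K · height` which are needed below
  set C := L * (1 + 128 * C₁ * Λ * p ^ 2 / a + K₂) + 64 * p * (β + 72 * B * L ^ 3) / a ^ 2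
    + 4 * (β + 72 * B * L ^ 4) + 24 * L ^ 2 with hC
  have hβ0 : 0 < β := by linarith
  have q1 : 0 < 128 * C₁ * Λ * p ^ 2 / a := by positivity
  have q2 : 0 < 64 * p * (β + 72 * B * L ^ 3) / a ^ 2 := by positivity
  have q3 : 0 < 4 * (β + 72 * B * L ^ 4) := by positivity
  have q4 : 0 < 24 * L ^ 2 := by positivity
  have q5 : 0 < L * (1 + 128 * C₁ * Λ * p ^ 2 / a + K₂) := by positivity
  refine ⟨C, by positivity, fun u f t ρ x x' O q κ o h hEge hψ hD hD' hca hηρ hηL hadm hadm' hm'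
    hΛ' hf hfm hf1 hf2 heq => ?_⟩
  by_contra! hcon
  have hρ := h.rho_pos
  have hK := h.top_pos
  have hη0 := h.height_pos
  obtain ⟨η, hη⟩ : ∃ η, η = -u x - t / 2 := ⟨_, rfl⟩
  obtain ⟨E, hE⟩ : ∃ E, E = B * Real.exp (3 / ρ * supKernel u ρ x x') := ⟨_, rfl⟩
  rw [← hη] at hηρ hηL hcon hη0
  rw [← hE] at hEge
  have hEB : E ≤ B := by
    rw [hE]
    refine mul_le_of_le_one_right hB.le (Real.exp_le_one_iff.2 ?_)
    exact mul_nonpos_of_nonneg_of_nonpos (by positivity) hψ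
  have hE0 : 0 < E := lt_of_lt_of_le (by positivity) hEge
  have hn := h.graph.isNormalGraph h.contDiffAt h.frame
  have hκ : ∀ I ∈ pSets n p, 0 < ∑ i ∈ I, κ i := fun I hI =>
    h.frame.sum_pos hadm.self_of_nhds.1 hadm.self_of_nhds.2 hI
  have hprod : ∏ I ∈ pSets n p, ∑ i ∈ I, κ i ≤ Λ := by
    rwa [← h.frame.curvatureProd_eq]
  have hF := curvWeight_pos hp hpn hκ
  have hKη : κ o * η ≤ κ o * L := mul_le_mul_of_nonneg_left hηL hK.le
  have hK1 : 1 + 128 * C₁ * Λ * p ^ 2 / a + K₂ < κ o := by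
    have : (1 + 128 * C₁ * Λ * p ^ 2 / a + K₂) * L < κ o * L := by linarith
    exact lt_of_mul_lt_mul_right this (by linarith)
  have hKge1 : 1 ≤ κ o := by linarith
  have hKρ : 1 ≤ κ o * ρ := by
    have h1 : κ o * η ≤ κ o * (24 * L ^ 2 * ρ) := mul_le_mul_of_nonneg_left hηρ hK.le
    have h2 : 24 * L ^ 2 * 1 ≤ 24 * L ^ 2 * (κ o * ρ) := by linarith
    exact le_of_mul_le_mul_left h2 q4
  have hL3 : E * L ^ 3 ≤ B * L ^ 3 := mul_le_mul_of_nonneg_right hEB (by positivity)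
  have hL4 : E * L ^ 4 ≤ B * L ^ 4 := mul_le_mul_of_nonneg_right hEB (by positivity)
  have hbig1 : 8 * (β + 72 * E * L ^ 3) / a ^ 2 ≤ 1 / (8 * p) * κ o * η := by
    have h1 : 64 * p * (β + 72 * B * L ^ 3) / a ^ 2 ≤ κ o * η := by linarith
    have h2 : 8 * (β + 72 * E * L ^ 3) / a ^ 2 ≤ 8 * (β + 72 * B * L ^ 3) / a ^ 2 :=
      div_le_div_of_nonneg_right (by linarith) (by positivity)
    have h3 : 8 * (β + 72 * B * L ^ 3) / a ^ 2
        = 1 / (8 * p) * (64 * p * (β + 72 * B * L ^ 3) / a ^ 2) := by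
      field_simp
      ring
    rw [mul_assoc (1 / (8 * (p : ℝ)))]
    exact h2.trans (h3.trans_le (mul_le_mul_of_nonneg_left h1 (by positivity)))
  obtain ⟨μ, hμ0, hμ1, hμm, hμS⟩ := h.second_point_sums hκ hadm' (hm.trans_le hm')
  have key := fun (G : Fin n → ℝ) (g : ℝ) hG hg => h.reduced hκ hp hpn (G := G) (g := g) (L := L)
    hη hE hG hg hL hD hD' ha hca hηρ (by linarith)
    ((mul_le_mul_of_nonneg_left hEB (by positivity)).trans hβ2) hbig1 (by linarith)
  have hS0 : 0 ≤ ∑ I ∈ pSets n p, μ I / ∑ i ∈ I, κ i :=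
    Finset.sum_nonneg fun I hI => (div_pos (hμ0 I hI) (hκ I hI)).le
  set S := ∑ k, curvWeight p κ k * fderiv ℝ (fderiv ℝ u) x'
          (untilt (gradient u x') (O (basisVec k))) (untilt (gradient u x') (O (basisVec k)))
    with hS
  have hN : (1 : ℝ) ≤ n.choose p := by exact_mod_cast Nat.choose_pos hpn
  have hKN : κ o ≤ κ o * n.choose p := le_mul_of_one_le_right hK.le hN
  have hFκ : ∀ k, 0 ≤ curvWeight p κ k * κ k ^ 2 := fun k => mul_nonneg (hF k).le (sq_nonneg _)
  have hES : 0 ≤ 3 * E / ρ * S := mul_nonneg (by positivity) (hS0.trans hμS)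
  rcases heq with ⟨hn2, heq⟩ | heq
  · obtain ⟨G, g, hG, hg, hG1, hg1⟩ := h.graph.exists_bounds_of_normal h.contDiffAt h.frame hadm o
      hf hm hfm hf1 hf2 heq
    obtain ⟨k1, k2⟩ := key G g hG hg
    have hG2 : (∑ i, |G i|) / a ≤ κ o * (n * A * (1 + p) / a) := by
      rw [← mul_div_assoc]
      refine div_le_div_of_nonneg_right ?_ ha.le
      have h1 : ∀ i ∈ Finset.univ, |G i| ≤ A * ((1 + p) * κ o) := fun i _ => by
        refine (hG1 i).trans (mul_le_mul_of_nonneg_left ?_ hA0.le)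
        have := abs_le_mul_top hκ hp hpn h.le_top hK i
        linarith
      refine (Finset.sum_le_card_nsmul _ _ _ h1).trans_eq ?_
      rw [nsmul_eq_mul, Finset.card_univ, Fintype.card_fin]
      ring
    have hg2 : -(g / κ o) ≤ κ o * (A * (2 + n * (1 + p / a)) + 4 * (A + A ^ 2)) := by
      rw [← neg_div, div_le_iff₀ hK]
      refine hg1.trans ?_
      have h1 := Finset.sum_le_card_nsmul _ _ _ fun k (_ : k ∈ Finset.univ) => k2 k
      rw [nsmul_eq_mul, Finset.card_univ, Fintype.card_fin] at h1
      rw [abs_of_pos hK]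
      have h2 : κ o + κ o ^ 2 + ∑ i, |third q (basisVec o) (basisVec o) (basisVec i)|
          ≤ κ o ^ 2 * (2 + n * (1 + p / a)) := by
        have e1 : n * (κ o * (κ o + p * κ o / a)) = κ o ^ 2 * (n * (1 + p / a)) := by ring
        have e2 : κ o ≤ κ o ^ 2 := le_self_pow₀ hKge1 two_ne_zero
        rw [e1] at h1
        rw [mul_add]
        linarith
      have h3 : (1 + κ o) ^ 2 ≤ κ o ^ 2 * 4 := by
        have e1 := pow_le_pow_left₀ (by linarith) (by linarith : 1 + κ o ≤ κ o * 2) 2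
        exact e1.trans_eq (by ring)
      have h4 := mul_le_mul_of_nonneg_left h2 hA0.le
      have h5 := mul_le_mul_of_nonneg_left h3 (by positivity : 0 ≤ A + A ^ 2)
      linarith
    have hmain : a / 2 * ∑ k, curvWeight p κ k * κ k ^ 2 + 3 * E / ρ * S ≤ C₁ * κ o := by
      have : C₁ * κ o = κ o * (A * (2 + n * (1 + p / a)) + 4 * (A + A ^ 2))
        + κ o * (n * A * (1 + p) / a) := by rw [hC₁]; ring
      rw [this]
      linarith
    have hlarge : ¬∃ l, 1 / Λ ≤ curvWeight p κ l ∧ 1 / (8 * p) * κ o ≤ |κ l| := by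
      rintro ⟨l, hl1, hl2⟩
      have h1 : 1 / Λ * (1 / (8 * p) * κ o) ^ 2 ≤ ∑ k, curvWeight p κ k * κ k ^ 2 := by
        refine le_trans ?_ (Finset.single_le_sum (fun k _ => hFκ k) (Finset.mem_univ l))
        rw [← sq_abs (κ l)]
        exact mul_le_mul hl1 (pow_le_pow_left₀ (by positivity) hl2 2) (by positivity) (hF l).le
      have h2 : a / 2 * (1 / Λ * (1 / (8 * p) * κ o) ^ 2) ≤ C₁ * κ o :=
        (mul_le_mul_of_nonneg_left h1 (by positivity)).trans (by linarith)
      have h3 : a / 2 * (1 / Λ * (1 / (8 * p) * κ o) ^ 2)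
          = κ o * (a / (128 * Λ * p ^ 2)) * κ o := by
        field_simp
        ring
      rw [h3] at h2
      have h4 := le_of_mul_le_mul_right h2 hK
      rw [← mul_div_assoc, div_le_iff₀ (by positivity)] at h4
      have h5 : κ o ≤ 128 * C₁ * Λ * p ^ 2 / a := by
        rw [le_div_iff₀ ha]
        linarith
      linarith
    have hmax : max 1 Λ = Λ := max_eq_right hΛ
    obtain ⟨l, -, hl⟩ := Finset.exists_min_image Finset.univ κ ⟨o, Finset.mem_univ o⟩
    have hl' : 1 / Λ ≤ curvWeight p κ l := by
      have := one_div_le_curvWeight hκ hp hpn hprod (fun i => hl i (Finset.mem_univ i))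
      rwa [hmax] at this
    have hθ1 : 1 / (8 * p : ℝ) ≤ 1 := by
      rw [div_le_one (by positivity)]
      linarith
    rcases hpn.eq_or_lt with rfl | hlt
    · refine hlarge ⟨o, ?_, ?_⟩
      · rwa [curvWeight_eq_of_card κ o l]
      · rw [abs_of_pos hK]
        exact mul_le_of_le_one_left hK.le hθ1
    · have hsmall : ∀ k, -(1 / (8 * p) * κ o) ≤ κ k := by
        intro k
        by_contra! hk
        refine hlarge ⟨l, hl', ?_⟩
        rw [le_abs]
        right
        linarith [hl k (Finset.mem_univ k)]
      have h1 := le_sum_div_of_nearly_nonneg hκ hp hlt hn2 hK hsmall hm hρ hΛ hprod hμ0 hμ1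
        (hm'.trans hμm) hKρ
      have h2 : 3 * E / ρ * (c₂ * (κ o * ρ)) ≤ C₁ * κ o := by
        have h3 := mul_le_mul_of_nonneg_left (h1.trans hμS) (by positivity : 0 ≤ 3 * E / ρ)
        have h4 : 0 ≤ a / 2 * ∑ k, curvWeight p κ k * κ k ^ 2 :=
          mul_nonneg (by positivity) (Finset.sum_nonneg fun k _ => hFκ k)
        linarith
      have h3 : 3 * E / ρ * (c₂ * (κ o * ρ)) = E * (3 * c₂) * κ o := by
        field_simp
      rw [h3] at h2
      have h4 := le_of_mul_le_mul_right h2 hK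
      rw [div_le_iff₀ (by positivity)] at hEge
      linarith
  · obtain ⟨G, g, hG, hg, hG1, hg1⟩ := h.graph.exists_bounds_of_const h.contDiffAt h.frame hadm o
      hf hm hfm hf1 hf2 heq
    obtain ⟨k1, -⟩ := key G g hG hg
    have hG2 : (∑ i, |G i|) / a ≤ n * A / a := by
      refine div_le_div_of_nonneg_right ?_ ha.le
      refine (Finset.sum_le_card_nsmul _ _ _ fun i _ => hG1 i).trans_eq ?_
      rw [nsmul_eq_mul, Finset.card_univ, Fintype.card_fin]
    have hg2 : -(g / κ o) ≤ 2 * A + A ^ 2 := by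
      rw [← neg_div, div_le_iff₀ hK]
      refine hg1.trans ?_
      rw [abs_of_pos hK]
      have := mul_nonneg (by positivity : 0 ≤ A + A ^ 2) (sub_nonneg.2 hKge1)
      linarith
    have h4 : 0 ≤ a / 2 * ∑ k, curvWeight p κ k * κ k ^ 2 :=
      mul_nonneg (by positivity) (Finset.sum_nonneg fun k _ => hFκ k)
    linarith

end GraphSurface

end

/-! ### Sign of the solution and balls in the domain -/

section

set_option maxSynthPendingDepth 3

namespace GraphSurface

variable {n : ℕ} {Ω : Set (Eucl n)} {u : Eucl n → ℝ} {x : Eucl n}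

theorem norm_gradient (u : Eucl n → ℝ) (x : Eucl n) : ‖gradient u x‖ = ‖fderiv ℝ u x‖ := by
  rw [gradient, LinearIsometryEquiv.norm_map]

/-- A ball around an interior point, of a radius on which the Lipschitz bound keeps `u` away from
its boundary value zero, lies in the domain. -/
theorem closedBall_subset (hΩ : IsOpen Ω) (hc : ContinuousOn u (closure Ω))
    (h0 : ∀ x ∈ frontier Ω, u x = 0) (hd : ∀ x ∈ Ω, DifferentiableAt ℝ u x) {L r : ℝ}
    (hL : ∀ x ∈ Ω, ‖fderiv ℝ u x‖ ≤ L) (hL0 : 0 ≤ L) (hx : x ∈ Ω) (hr : L * r < -u x) :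
    Metric.closedBall x r ⊆ Ω := by
  rcases Ωᶜ.eq_empty_or_nonempty with he | he
  · rw [Set.compl_empty_iff] at he
    simp [he]
  obtain ⟨z, hz, hdist⟩ := hΩ.isClosed_compl.exists_infDist_eq_dist he x
  rcases lt_or_ge r (Metric.infDist x Ωᶜ) with hlt | hle
  · exact (Metric.closedBall_subset_ball hlt).trans Metric.ball_infDist_compl_subset
  exfalso
  rw [hdist] at hle
  have hball : Metric.ball x (dist x z) ⊆ Ω := hdist ▸ Metric.ball_infDist_compl_subset
  have hpos : 0 < dist x z := dist_pos.2 fun h => hz (h ▸ hx)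
  have hzc : z ∈ closure (Metric.ball x (dist x z)) := by
    rw [closure_ball x hpos.ne', Metric.mem_closedBall, dist_comm]
  have hzf : z ∈ frontier Ω := ⟨closure_mono hball hzc, fun h => hz (interior_subset h)⟩
  have hne : (𝓝[Metric.ball x (dist x z)] z).NeBot := mem_closure_iff_nhdsWithin_neBot.1 hzc
  have h1 : Tendsto u (𝓝[Metric.ball x (dist x z)] z) (𝓝 (u z)) :=
    (hc z (closure_mono hball hzc)).mono_left
      (nhdsWithin_mono _ (hball.trans subset_closure))
  have h2 : ∀ᶠ y in 𝓝[Metric.ball x (dist x z)] z, u y - u x ≤ L * dist x z := by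
    filter_upwards [self_mem_nhdsWithin] with y hy
    have := (convex_ball x (dist x z)).norm_image_sub_le_of_norm_fderiv_le
      (fun y hy => hd y (hball hy)) (fun y hy => hL y (hball hy)) (Metric.mem_ball_self hpos) hy
    refine (le_abs_self _).trans (this.trans (mul_le_mul_of_nonneg_left ?_ hL0))
    rw [← dist_eq_norm]
    exact (Metric.mem_ball.1 hy).le
  have h3 := le_of_tendsto (h1.sub_const (u x)) h2
  rw [h0 z hzf] at h3
  have := mul_le_mul_of_nonneg_left hle hL0
  linarith

/-- At an interior maximum all principal curvatures would be nonpositive. -/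
theorem neg_of_curvatureProd_pos (hΩ : IsBoundedDomain Ω) (hc : ContinuousOn u (closure Ω))
    (h0 : ∀ x ∈ frontier Ω, u x = 0) (hu : ∀ x ∈ Ω, ContDiffAt ℝ 4 u x) {p : ℕ} (hpn : p ≤ n)
    (hadm : IsAdmissible p u Ω) (hpos : ∀ x ∈ Ω, 0 < curvatureProd p u x) (hx : x ∈ Ω) :
    u x < 0 := by
  by_contra! hux
  obtain ⟨z, hz, hmax⟩ := (hΩ.isBounded.isCompact_closure).exists_isMaxOn
    ⟨x, subset_closure hx⟩ hc
  obtain ⟨y, hy, hymax⟩ : ∃ y ∈ Ω, IsMaxOn u (closure Ω) y := by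
    by_cases hzΩ : z ∈ Ω
    · exact ⟨z, hzΩ, hmax⟩
    · have hz0 : u z = 0 := h0 z ⟨hz, fun h => hzΩ (interior_subset h)⟩
      refine ⟨x, hx, fun y hy => ?_⟩
      have : u y ≤ u z := hmax hy
      exact (this.trans hz0.le).trans hux
  have hloc : ∀ᶠ w in 𝓝 y, u w ≤ u y := by
    filter_upwards [hΩ.isOpen.mem_nhds hy] with w hw
    exact hymax (subset_closure hw)
  obtain ⟨κ, O, hF⟩ := exists_isPrincipalFrame (u := u) (x := y)
    ((hu y hy).isSymmSndFDerivAt (by norm_num))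
  have hneg : ∀ v, hForm u y v v ≤ 0 := by
    intro v
    have h1 := (Jet2.line y v).comp (Φ := u) ((hu y hy).of_le (by norm_num))
    have h2 := (h1.of_isLocalMax ((Jet2.line y v).tendsto.eventually hloc)).2
    simp only [map_zero, zero_add, smul_eq_mul] at h2
    rw [hForm]
    refine div_nonpos_of_nonpos_of_nonneg ?_ (areaFactor_pos u y).le
    linarith
  obtain ⟨I, hI⟩ : (pSets n p).Nonempty := by
    rw [Finset.powersetCard_nonempty]
    simpa using hpn
  have h3 := hF.sum_pos (hadm y hy) (hpos y hy) hI
  have h4 : ∑ i ∈ I, κ i ≤ 0 := Finset.sum_nonpos fun i _ => by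
    have := hneg (untilt (gradient u y) (O (basisVec i)))
    rw [hF] at this
    simpa using this
  linarith

/-- The normal curvature of the graph in the direction `e`. -/
noncomputable def normalCurv (u : Eucl n → ℝ) (x e : Eucl n) : ℝ :=
  hForm u x e e / gForm u x e e

theorem gForm_self_pos (u : Eucl n → ℝ) (x : Eucl n) {e : Eucl n} (he : e ≠ 0) :
    0 < gForm u x e e := by
  rw [gForm, real_inner_self_eq_norm_sq]
  have := norm_pos_iff.2 he
  nlinarith [mul_self_nonneg (fderiv ℝ u x e)]

theorem normalCurv_smul (u : Eucl n → ℝ) (x e : Eucl n) {k : ℝ} (hk : k ≠ 0) :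
    normalCurv u x (k • e) = normalCurv u x e := by
  have h1 : hForm u x (k • e) (k • e) = k ^ 2 * hForm u x e e := by
    simp [hForm]
    ring
  have h2 : gForm u x (k • e) (k • e) = k ^ 2 * gForm u x e e := by
    simp only [gForm, inner_smul_left, inner_smul_right, map_smul, smul_eq_mul, conj_trivial]
    ring
  rw [normalCurv, h1, h2, normalCurv, mul_div_mul_left _ _ (pow_ne_zero 2 hk)]

theorem IsPrincipalFrame.hForm_le {κ : Fin n → ℝ} {O : Eucl n ≃ₗᵢ[ℝ] Eucl n}
    (h : IsPrincipalFrame u x κ O) {K : ℝ} (hK : ∀ i, κ i ≤ K) (e : Eucl n) :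
    hForm u x e e ≤ K * gForm u x e e := by
  obtain ⟨y, rfl⟩ : ∃ y, e = untilt (gradient u x) (O y) :=
    ⟨O.symm (tilt (gradient u x) e), by simp [untilt_tilt]⟩
  rw [h, gForm_untilt, LinearIsometryEquiv.inner_map_map, PiLp.inner_apply, Finset.mul_sum]
  refine Finset.sum_le_sum fun i _ => ?_
  simp only [RCLike.inner_apply, conj_trivial]
  nlinarith [mul_nonneg (sub_nonneg.2 (hK i)) (mul_self_nonneg (y i))]

theorem IsPrincipalFrame.normalCurv_le {κ : Fin n → ℝ} {O : Eucl n ≃ₗᵢ[ℝ] Eucl n}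
    (h : IsPrincipalFrame u x κ O) {K : ℝ} (hK : ∀ i, κ i ≤ K) {e : Eucl n} (he : e ≠ 0) :
    normalCurv u x e ≤ K := by
  rw [normalCurv, div_le_iff₀ (gForm_self_pos u x he)]
  exact h.hForm_le hK e

theorem continuousAt_areaFactor (hu : ContDiffAt ℝ 4 u x) : ContinuousAt (areaFactor u) x := by
  have h1 : ContinuousAt (fderiv ℝ u) x := (hu.fderiv_right (m := 3) (by norm_num)).continuousAt
  unfold areaFactor pd
  fun_prop

theorem continuousAt_normalCurv {e : Eucl n} (hu : ContDiffAt ℝ 4 u x) (he : e ≠ 0) :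
    ContinuousAt (fun z : Eucl n × Eucl n => normalCurv u z.1 z.2) (x, e) := by
  have h1 : ContinuousAt (fun z : Eucl n × Eucl n => fderiv ℝ u z.1) (x, e) :=
    ((hu.fderiv_right (m := 3) (by norm_num)).continuousAt).comp' continuousAt_fst
  have h2 : ContinuousAt (fun z : Eucl n × Eucl n => fderiv ℝ (fderiv ℝ u) z.1) (x, e) :=
    (((hu.fderiv_right (m := 3) (by norm_num)).fderiv_right (m := 2)
      (by norm_num)).continuousAt).comp' continuousAt_fst
  have h3 : ContinuousAt (fun z : Eucl n × Eucl n => areaFactor u z.1) (x, e) :=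
    (continuousAt_areaFactor hu).comp' continuousAt_fst
  have hs : ContinuousAt (fun z : Eucl n × Eucl n => z.2) (x, e) := continuousAt_snd
  refine ContinuousAt.div ?_ ?_ (gForm_self_pos u x he).ne'
  · exact ((h2.clm_apply hs).clm_apply hs).div h3 (areaFactor_pos u x).ne'
  · exact (ContinuousAt.inner (𝕜 := ℝ) hs hs).add ((h1.clm_apply hs).mul (h1.clm_apply hs))

end GraphSurface

end

/-! ### Existence of a maximum point -/

section

set_option maxSynthPendingDepth 3

namespace GraphSurface

variable {n : ℕ} {Ω : Set (Eucl n)} {u : Eucl n → ℝ} {x : Eucl n}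

/-- The exponential of `testFn`, which makes sense also where the normal curvature or the height
factor vanishes. -/
noncomputable def testQuot (u : Eucl n → ℝ) (t ρ : ℝ) (b : ℕ) (a B : ℝ) (x x' e : Eucl n) : ℝ :=
  normalCurv u x e * (-u x - t / 2) ^ b * ((areaFactor u x)⁻¹ - a)⁻¹
    * Real.exp (B * Real.exp (3 / ρ * supKernel u ρ x x'))

theorem log_testQuot {t ρ a B : ℝ} (b : ℕ) {x x' e : Eucl n} (he : 0 < hForm u x e e)
    (hη : 0 < -u x - t / 2) (ha : a < (areaFactor u x)⁻¹) :
    Real.log (testQuot u t ρ b a B x x' e) = testFn u t ρ b a B x x' e := by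
  have hg : 0 < gForm u x e e := gForm_self_pos u x fun h => by simp [h, hForm] at he
  have ha' : 0 < (areaFactor u x)⁻¹ - a := sub_pos.2 ha
  have hc : 0 < normalCurv u x e := div_pos he hg
  rw [testQuot, Real.log_mul (by positivity) (Real.exp_pos _).ne', Real.log_exp,
    Real.log_mul (by positivity) (by positivity), Real.log_inv,
    Real.log_mul hc.ne' (by positivity), Real.log_pow, normalCurv, Real.log_div he.ne' hg.ne',
    testFn]
  ring

theorem continuousAt_testQuot {t ρ a B : ℝ} (b : ℕ) {x x' e : Eucl n} (hu : ContDiffAt ℝ 4 u x)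
    (hu' : ContinuousAt u x') (ha : a < (areaFactor u x)⁻¹) (he : e ≠ 0) :
    ContinuousAt (fun z : Eucl n × Eucl n × Eucl n => testQuot u t ρ b a B z.1 z.2.1 z.2.2)
      (x, x', e) := by
  have h1 : ContinuousAt (fun z : Eucl n × Eucl n × Eucl n => normalCurv u z.1 z.2.2)
      (x, x', e) :=
    ContinuousAt.comp' (f := fun z : Eucl n × Eucl n × Eucl n => (z.1, z.2.2))
      (continuousAt_normalCurv hu he) (by fun_prop)
  have h2 : ContinuousAt (fun z : Eucl n × Eucl n × Eucl n => u z.1) (x, x', e) :=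
    hu.continuousAt.comp' continuousAt_fst
  have h3 : ContinuousAt (fun z : Eucl n × Eucl n × Eucl n => areaFactor u z.1) (x, x', e) :=
    (continuousAt_areaFactor hu).comp' continuousAt_fst
  have h4 : ContinuousAt (fun z : Eucl n × Eucl n × Eucl n => u z.2.1) (x, x', e) :=
    ContinuousAt.comp' (f := fun z : Eucl n × Eucl n × Eucl n => z.2.1) hu' (by fun_prop)
  have h5 : ContinuousAt (fun z : Eucl n × Eucl n × Eucl n => supKernel u ρ z.1 z.2.1)
      (x, x', e) := by
    have h9 : ContinuousAt (fun z : Eucl n × Eucl n × Eucl n => z.1 - z.2.1) (x, x', e) := by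
      fun_prop
    exact h4.sub ((h9.norm.pow 2).div_const _)
  have h6 := (h3.inv₀ (areaFactor_pos u x).ne').sub (continuousAt_const (y := a))
  have h7 := h6.inv₀ (sub_pos.2 ha).ne'
  have h8 : ContinuousAt (fun z : Eucl n × Eucl n × Eucl n =>
      Real.exp (B * Real.exp (3 / ρ * supKernel u ρ z.1 z.2.1))) (x, x', e) := by fun_prop
  exact ((h1.mul ((h2.neg.sub continuousAt_const).pow b)).mul h7).mul h8

/-- The superlevel sets of the height are compact. -/
theorem isCompact_height_ge (hΩ : IsBoundedDomain Ω) (hc : ContinuousOn u (closure Ω)) (t : ℝ) :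
    IsCompact (closure Ω ∩ u ⁻¹' Set.Iic (-t)) :=
  hΩ.isBounded.isCompact_closure.of_isClosed_subset
    (hc.preimage_isClosed_of_isClosed isClosed_closure isClosed_Iic) Set.inter_subset_left

theorem mem_of_height_ge (h0 : ∀ x ∈ frontier Ω, u x = 0) {t : ℝ} (ht : 0 < t)
    (hx : x ∈ closure Ω ∩ u ⁻¹' Set.Iic (-t)) : x ∈ Ω := by
  by_contra h
  have h1 := h0 x ⟨hx.1, fun h' => h (interior_subset h')⟩
  have h2 : u x ≤ -t := hx.2
  linarith

set_option maxHeartbeats 1000000 in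
/-- The test function attains its maximum at an interior point of all its constraints, provided
that the comparison point `x₀` maximises the curvature weighted with a higher power of the
height. -/
theorem exists_isTestMax (hn : 0 < n) (hΩ : IsBoundedDomain Ω) (hc : ContinuousOn u (closure Ω))
    (h0 : ∀ x ∈ frontier Ω, u x = 0) (hu : ∀ x ∈ Ω, ContDiffAt ℝ 4 u x)
    (hneg : ∀ x ∈ Ω, u x < 0) {L : ℝ} (hL1 : 1 ≤ L) (hL : ∀ x ∈ Ω, ‖fderiv ℝ u x‖ ≤ L)
    {a B t : ℝ} {b j : ℕ} (ha : 0 < a) (haΩ : ∀ x ∈ Ω, a ≤ (areaFactor u x)⁻¹ - a) (hB : 0 < B)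
    (hb : b ≠ 0) (hj : Real.exp B / a < 2 ^ j) {x₀ e₀ : Eucl n} (hx₀ : x₀ ∈ Ω) (he₀ : ‖e₀‖ = 1)
    (hR : 0 < normalCurv u x₀ e₀) (ht : -u x₀ = t)
    (hmax : ∀ x ∈ Ω, 2 * t < -u x → ∀ e, ‖e‖ = 1 →
      normalCurv u x e * (-u x) ^ (2 * b + j) ≤ normalCurv u x₀ e₀ * t ^ (2 * b + j)) :
    ∃ x ∈ Ω, ∃ x' ∈ Ω, ∃ (O : Eucl n ≃ₗᵢ[ℝ] Eucl n) (q : Eucl n → ℝ) (κ : Fin n → ℝ) (o : Fin n),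
      IsTestMax u t (t / (16 * L ^ 2)) b a B x x' O q κ o ∧ -u x ≤ 2 * t ∧
      supKernel u (t / (16 * L ^ 2)) x x' ≤ 0 ∧ -(2 * t) ≤ supKernel u (t / (16 * L ^ 2)) x x' ∧
      normalCurv u x₀ e₀ * (t / 2) ^ b ≤ κ o * (-u x - t / 2) ^ b * (Real.exp B / a) := by
  have ht0 : 0 < t := by linarith [hneg x₀ hx₀]
  obtain ⟨ρ, hρ⟩ : ∃ ρ, ρ = t / (16 * L ^ 2) := ⟨_, rfl⟩
  obtain ⟨r, hr⟩ : ∃ r, r = t / (4 * L) := ⟨_, rfl⟩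
  have hρ0 : 0 < ρ := by rw [hρ]; positivity
  have hr0 : 0 < r := by rw [hr]; positivity
  have hLr : L * r = t / 4 := by rw [hr]; field_simp
  have hLρ : 4 * L * ρ = r := by rw [hr, hρ]; field_simp; ring
  rw [← hρ]
  have hd : ∀ x ∈ Ω, DifferentiableAt ℝ u x := fun x hx => (hu x hx).differentiableAt (by norm_num)
  have hslope : ∀ x ∈ Ω, a < (areaFactor u x)⁻¹ := fun x hx => by linarith [haΩ x hx]
  have hball : ∀ x ∈ Ω, t / 2 ≤ -u x → Metric.closedBall x r ⊆ Ω := fun x hx h =>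
    closedBall_subset hΩ.isOpen hc h0 hd hL (by linarith) hx (by linarith)
  set S : Set (Eucl n × Eucl n × Eucl n) := (closure Ω ∩ u ⁻¹' Set.Iic (-(t / 2))) ×ˢ
    (Metric.closedBall 0 r ×ˢ Metric.sphere 0 1) with hS
  have hScomp : IsCompact S := (isCompact_height_ge hΩ hc _).prod
    ((isCompact_closedBall _ _).prod (isCompact_sphere _ _))
  have hSΩ : ∀ z ∈ S, z.1 ∈ Ω ∧ t / 2 ≤ -u z.1 ∧ z.1 + z.2.1 ∈ Ω ∧ ‖z.2.1‖ ≤ r ∧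
      ‖z.2.2‖ = 1 := by
    rintro ⟨y, w, e⟩ ⟨h1, h2, h3⟩
    have hy : y ∈ Ω := mem_of_height_ge h0 (by linarith) h1
    have hyt : t / 2 ≤ -u y := by
      have : u y ≤ -(t / 2) := h1.2
      linarith
    have hw : ‖w‖ ≤ r := by simpa using h2
    exact ⟨hy, hyt, hball y hy hyt (by simpa using hw), hw, by simpa using h3⟩
  have hScont : ContinuousOn (fun z : Eucl n × Eucl n × Eucl n =>
      testQuot u t ρ b a B z.1 (z.1 + z.2.1) z.2.2) S := by
    intro z hz
    obtain ⟨h1, -, h3, -, h5⟩ := hSΩ z hz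
    refine ContinuousAt.continuousWithinAt ?_
    exact ContinuousAt.comp' (f := fun z : Eucl n × Eucl n × Eucl n => (z.1, z.1 + z.2.1, z.2.2))
      (continuousAt_testQuot b (hu _ h1) (hu _ h3).continuousAt (hslope _ h1)
        fun h => by simp [h] at h5) (by fun_prop)
  have hS0 : (x₀, (0 : Eucl n), e₀) ∈ S := by
    refine ⟨⟨subset_closure hx₀, ?_⟩, by simpa using hr0.le, by simpa using he₀⟩
    show u x₀ ≤ -(t / 2)
    linarith
  obtain ⟨⟨x, w, e⟩, hz, hzmax⟩ := hScomp.exists_isMaxOn ⟨_, hS0⟩ hScont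
  obtain ⟨hx, hxt, hx', hw, he⟩ := hSΩ _ hz
  dsimp only at hx hxt hx' hw he
  have he0 : e ≠ 0 := fun h => by simp [h] at he
  set M := testQuot u t ρ b a B x (x + w) e with hM
  have hle : ∀ y ∈ Ω, t / 2 ≤ -u y → ∀ w', ‖w'‖ ≤ r → ∀ e', ‖e'‖ = 1 →
      testQuot u t ρ b a B y (y + w') e' ≤ M := fun y hy hyt w' hw' e' he' => by
    have hyS : (y, w', e') ∈ S := ⟨⟨subset_closure hy, show u y ≤ -(t / 2) by linarith⟩,
      by simpa using hw', by simpa using he'⟩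
    have h1 := isMaxOn_iff.1 hzmax _ hyS
    dsimp only at h1
    rw [hM]
    exact h1
  have hca : ∀ y ∈ Ω, 1 ≤ ((areaFactor u y)⁻¹ - a)⁻¹ ∧ ((areaFactor u y)⁻¹ - a)⁻¹ ≤ a⁻¹ := by
    intro y hy
    have h1 := haΩ y hy
    refine ⟨(one_le_inv₀ (by linarith)).2 ?_, inv_anti₀ ha h1⟩
    have h2 : (areaFactor u y)⁻¹ ≤ 1 := by
      refine inv_le_one_of_one_le₀ ?_
      rw [areaFactor_eq]
      exact one_le_slopeFactor _
    linarith
  have hM0 : normalCurv u x₀ e₀ * (t / 2) ^ b ≤ M := by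
    refine le_trans ?_ (hle x₀ hx₀ (by linarith) 0 (by simpa using hr0.le) e₀ he₀)
    rw [testQuot, ht, show t - t / 2 = t / 2 by ring, mul_assoc]
    refine le_mul_of_one_le_right (by positivity) ?_
    exact one_le_mul_of_one_le_of_one_le (hca x₀ hx₀).1 (Real.one_le_exp (by positivity))
  have hMpos : 0 < M := lt_of_lt_of_le (by positivity) hM0
  have hca0 : 0 < ((areaFactor u x)⁻¹ - a)⁻¹ := by linarith [(hca x hx).1]
  have hprod : 0 < normalCurv u x e * (-u x - t / 2) ^ b := by
    have h1 : 0 < normalCurv u x e * (-u x - t / 2) ^ b *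
      (((areaFactor u x)⁻¹ - a)⁻¹ * Real.exp (B * Real.exp (3 / ρ * supKernel u ρ x (x + w)))) := by
      rw [← mul_assoc]
      exact hMpos
    exact (mul_pos_iff_of_pos_right (mul_pos hca0 (Real.exp_pos _))).1 h1
  have hη : 0 < -u x - t / 2 := by
    rcases (sub_nonneg.2 hxt).eq_or_lt with h | h
    · rw [← h, zero_pow hb, mul_zero] at hprod
      exact absurd hprod (lt_irrefl _)
    · exact h
  have hcurv : 0 < normalCurv u x e := (mul_pos_iff_of_pos_right (pow_pos hη b)).1 hprod
  -- the two-point term forces the second point into the interior of the ball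
  have hψ : u x ≤ supKernel u ρ x (x + w) := by
    have h1 := hle x hx hxt 0 (by simpa using hr0.le) e he
    rw [hM, testQuot, testQuot] at h1
    have h2 := (mul_le_mul_iff_right₀ (mul_pos hprod hca0)).1 h1
    have h3 := (mul_le_mul_iff_right₀ hB).1 (Real.exp_le_exp.1 h2)
    have h4 := (mul_le_mul_iff_right₀ (by positivity : 0 < 3 / ρ)).1 (Real.exp_le_exp.1 h3)
    simpa [supKernel] using h4
  have hwr : ‖w‖ < r := by
    have h1 : ‖w‖ ^ 2 / (2 * ρ) ≤ L * ‖w‖ := by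
      have h2 := (convex_closedBall x r).norm_image_sub_le_of_norm_fderiv_le
        (fun y hy => hd y (hball x hx hxt hy)) (fun y hy => hL y (hball x hx hxt hy))
        (Metric.mem_closedBall_self hr0.le) (y := x + w) (by simpa using hw)
      rw [add_sub_cancel_left] at h2
      have h3 := (le_abs_self _).trans h2
      rw [supKernel, sub_add_cancel_left, norm_neg] at hψ
      linarith
    rw [div_le_iff₀ (by positivity)] at h1
    by_contra! h2
    nlinarith
  have hψ0 : supKernel u ρ x (x + w) ≤ 0 := by
    have h1 := hneg _ hx'
    have h2 : 0 ≤ ‖x - (x + w)‖ ^ 2 / (2 * ρ) := by positivity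
    rw [supKernel]
    linarith
  have hMle : M ≤ normalCurv u x e * (-u x - t / 2) ^ b * (Real.exp B / a) := by
    rw [hM, testQuot, mul_assoc]
    refine mul_le_mul_of_nonneg_left ?_ hprod.le
    rw [div_eq_inv_mul (Real.exp B) a]
    refine mul_le_mul (hca x hx).2 (Real.exp_le_exp.2 ?_) (Real.exp_pos _).le (by positivity)
    refine mul_le_of_le_one_right hB.le (Real.exp_le_one_iff.2 ?_)
    exact mul_nonpos_of_nonneg_of_nonpos (by positivity) hψ0
  -- the choice of `x₀` rules out heights above `2 t`
  have hux : -u x ≤ 2 * t := by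
    by_contra! hcon
    have h1 := hmax x hx hcon e he
    set H := -u x with hH
    have hHpos : 0 < H := by linarith
    have h2 : normalCurv u x e * (H - t / 2) ^ b ≤ normalCurv u x e * H ^ b :=
      mul_le_mul_of_nonneg_left (pow_le_pow_left₀ hη.le (by linarith) b) hcurv.le
    have hea : 0 < Real.exp B / a := by positivity
    have h3 : normalCurv u x₀ e₀ * (t / 2) ^ b ≤ normalCurv u x e * H ^ b * (Real.exp B / a) :=
      hM0.trans (hMle.trans (mul_le_mul_of_nonneg_right h2 hea.le))
    have h4 : normalCurv u x e * H ^ b * (Real.exp B / a) < normalCurv u x e * H ^ b * 2 ^ j :=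
      mul_lt_mul_of_pos_left hj (by positivity)
    have h5 : normalCurv u x e * H ^ b * (2 ^ j * (2 * t) ^ (b + j))
        ≤ normalCurv u x e * H ^ b * (2 ^ j * H ^ (b + j)) := by
      have := pow_le_pow_left₀ (by linarith : 0 ≤ 2 * t) hcon.le (b + j)
      gcongr
    have h6 : normalCurv u x e * H ^ b * (2 ^ j * H ^ (b + j))
        ≤ 2 ^ j * (normalCurv u x₀ e₀ * t ^ (2 * b + j)) := by
      have : normalCurv u x e * H ^ b * (2 ^ j * H ^ (b + j))
        = 2 ^ j * (normalCurv u x e * H ^ (2 * b + j)) := by ring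
      rw [this]
      gcongr
    have h7 : normalCurv u x₀ e₀ * (t / 2) ^ b * (2 * t) ^ (b + j)
        = 2 ^ j * (normalCurv u x₀ e₀ * t ^ (2 * b + j)) := by
      rw [div_pow]
      field_simp
      ring
    have h8 : normalCurv u x₀ e₀ * (t / 2) ^ b * (2 * t) ^ (b + j)
        < normalCurv u x e * H ^ b * 2 ^ j * (2 * t) ^ (b + j) :=
      mul_lt_mul_of_pos_right (h3.trans_lt h4) (by positivity)
    linarith
  obtain ⟨κ, O, hF⟩ := exists_isPrincipalFrame (u := u) (x := x)
    ((hu x hx).isSymmSndFDerivAt (by norm_num))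
  obtain ⟨q, hq⟩ := exists_isTangentGraph (hu x hx) O
  have : Nonempty (Fin n) := ⟨⟨0, hn⟩⟩
  obtain ⟨o, -, ho⟩ := Finset.exists_max_image Finset.univ κ Finset.univ_nonempty
  have ho' : ∀ i, κ i ≤ κ o := fun i => ho i (Finset.mem_univ i)
  have hκo : 0 < κ o := hcurv.trans_le (hF.normalCurv_le ho' he0)
  have hhe : 0 < hForm u x e e := (div_pos_iff_of_pos_right (gForm_self_pos u x he0)).1 hcurv
  have hnorm := hq.isNormalGraph (hu x hx) hF
  have htop : hForm u x (frameMap u x O (basisVec o)) (frameMap u x O (basisVec o)) = κ o := by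
    rw [frameMap_apply, hF, ← hnorm.hess, hnorm.hess_basisVec]
    simp
  have htop' : gForm u x (frameMap u x O (basisVec o)) (frameMap u x O (basisVec o)) = 1 := by
    rw [frameMap_apply, gForm_untilt, LinearIsometryEquiv.inner_map_map]
    simp
  have hfn : testFn u t ρ b a B x (x + w) e
      ≤ testFn u t ρ b a B x (x + w) (frameMap u x O (basisVec o)) := by
    have h1 : Real.log (hForm u x e e) - Real.log (gForm u x e e) ≤ Real.log (κ o) := by
      rw [← Real.log_div hhe.ne' (gForm_self_pos u x he0).ne']
      exact Real.log_le_log hcurv (hF.normalCurv_le ho' he0)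
    rw [testFn, testFn, htop, htop', Real.log_one, sub_zero]
    linarith
  refine ⟨x, hx, x + w, hx', O, q, κ, o,
    ⟨hu x hx, (hu _ hx').of_le (by norm_num), hq, hF, ho', hκo, hη, hslope x hx, hρ0, hB, ?_⟩,
    hux, hψ0, by linarith, ?_⟩
  · have hnear : ∀ᶠ z : Eucl n × Eucl n in 𝓝 (x, x + w), z.1 ∈ Ω ∧ u z.1 < -(t / 2) ∧
        ‖z.2 - z.1‖ < r := by
      refine (continuousAt_fst.eventually (hΩ.isOpen.mem_nhds hx)).and
        (((hu x hx).continuousAt.comp' continuousAt_fst |>.eventually_lt continuousAt_const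
          (by linarith)).and ?_)
      have : ContinuousAt (fun z : Eucl n × Eucl n => ‖z.2 - z.1‖) (x, x + w) := by fun_prop
      exact this.eventually_lt continuousAt_const (by simpa using hwr)
    filter_upwards [hnear] with z ⟨h1, h2, h3⟩ e' he'
    refine le_trans ?_ hfn
    have he'0 : e' ≠ 0 := fun h => by simp [h, hForm] at he'
    rw [← log_testQuot b he' (by linarith) (hslope _ h1),
      ← log_testQuot b hhe hη (hslope x hx)]
    have h4 := hle z.1 h1 (by linarith) (z.2 - z.1) h3.le (‖e'‖⁻¹ • e')
      (by rw [norm_smul, norm_inv, norm_norm, inv_mul_cancel₀ (norm_ne_zero_iff.2 he'0)])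
    rw [add_sub_cancel, testQuot, normalCurv_smul u z.1 e' (by simpa using he'0)] at h4
    refine Real.log_le_log ?_ h4
    have h5 : 0 < normalCurv u z.1 e' := div_pos he' (gForm_self_pos u z.1 he'0)
    have h6 : 0 < -u z.1 - t / 2 := by linarith
    have h7 : 0 < ((areaFactor u z.1)⁻¹ - a)⁻¹ := by linarith [(hca z.1 h1).1]
    rw [testQuot]
    positivity
  · refine hM0.trans (hMle.trans ?_)
    have := hF.normalCurv_le ho' he0
    gcongr

end GraphSurface

end

/-! ### The curvature estimate -/

section

set_option maxSynthPendingDepth 3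

namespace GraphSurface

variable {n p : ℕ}

/-- A solution with the bounds on which the estimate depends, in the form used by the maximum
principle: `L` bounds the gradient, `f` lies between `m` and `Λ` along the graph, and `Λ` bounds
its first and second derivatives there. -/
structure IsBoundedSolution (p : ℕ) (Ω : Set (Eucl n)) (f : RhsSpace n → ℝ) (u : Eucl n → ℝ)
    (L m Λ : ℝ) : Prop where
  domain : IsBoundedDomain Ω
  contDiffAt : ∀ x ∈ Ω, ContDiffAt ℝ 4 u x
  continuousOn : ContinuousOn u (closure Ω)
  boundary : ∀ x ∈ frontier Ω, u x = 0
  admissible : IsAdmissible p u Ω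
  equation : ∀ x ∈ Ω, curvatureProd p u x = f (x, u x, normal u x)
  height_le : ∀ x ∈ Ω, |u x| ≤ L
  gradient_le : ∀ x ∈ Ω, ‖fderiv ℝ u x‖ ≤ L
  rhs_contDiffAt : ∀ x ∈ Ω, ContDiffAt ℝ 2 f (x, u x, normal u x)
  rhs_ge : ∀ x ∈ Ω, m ≤ f (x, u x, normal u x)
  rhs_le : ∀ x ∈ Ω, f (x, u x, normal u x) ≤ Λ
  rhs_fderiv : ∀ x ∈ Ω, ‖fderiv ℝ f (x, u x, normal u x)‖ ≤ Λ
  rhs_fderiv2 : ∀ x ∈ Ω, ‖fderiv ℝ (fderiv ℝ f) (x, u x, normal u x)‖ ≤ Λ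
  dichotomy : n ≤ 2 * p ∨ ∀ x ∈ Ω, ∀ y ∈ Ω, f (y, u y, normal u y) = f (y, u y, normal u x)

namespace IsBoundedSolution

variable {Ω : Set (Eucl n)} {f : RhsSpace n → ℝ} {u : Eucl n → ℝ} {L m Λ : ℝ}

theorem curvatureProd_pos (h : IsBoundedSolution p Ω f u L m Λ) (hm : 0 < m) :
    ∀ x ∈ Ω, 0 < curvatureProd p u x := fun x hx => by
  rw [h.equation x hx]
  exact hm.trans_le (h.rhs_ge x hx)

theorem inv_areaFactor_ge (h : IsBoundedSolution p Ω f u L m Λ) {x : Eucl n} (hx : x ∈ Ω) :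
    1 / (2 * √(1 + L ^ 2)) ≤ (areaFactor u x)⁻¹ - 1 / (2 * √(1 + L ^ 2)) := by
  have h1 : areaFactor u x ≤ √(1 + L ^ 2) := by
    rw [areaFactor_eq]
    refine Real.le_sqrt_of_sq_le ?_
    rw [slopeFactor_sq, norm_gradient]
    have := pow_le_pow_left₀ (norm_nonneg _) (h.gradient_le x hx) 2
    linarith
  have h2 := inv_anti₀ (areaFactor_pos u x) h1
  have h3 : 1 / (2 * √(1 + L ^ 2)) = (√(1 + L ^ 2))⁻¹ / 2 := by
    field_simp
  rw [h3]
  linarith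

end IsBoundedSolution

/-- **Interior curvature estimate**, with the principal curvatures in the form of a frame. -/
theorem exists_curvature_bound (hp : 1 ≤ p) (hpn : p ≤ n) {L m Λ : ℝ} (hL : 1 ≤ L) (hm : 0 < m)
    (hΛ : 1 ≤ Λ) :
    ∃ (C : ℝ) (N : ℕ), 0 < C ∧ 0 < N ∧ ∀ (Ω : Set (Eucl n)) (f : RhsSpace n → ℝ) (u : Eucl n → ℝ),
      IsBoundedSolution p Ω f u L m Λ → ∀ x ∈ Ω, u x < 0 ∧
        (-u x) ^ N * secondFormNorm u x ≤ C := by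
  -- half the lower bound for `1 / w`
  obtain ⟨a, ha⟩ : ∃ a, a = 1 / (2 * √(1 + L ^ 2)) := ⟨_, rfl⟩
  have ha0 : 0 < a := by rw [ha]; positivity
  obtain ⟨E₀, hE₀, hE⟩ := exists_bound_at_testMax hp hpn hL hm hΛ ha0
  -- at the maximum `ψ ≥ -2 t` and `ρ = t / (16 L²)`, so that `B exp (3 ψ / ρ) ≥ E₀`
  obtain ⟨B, hB⟩ : ∃ B, B = E₀ * Real.exp (96 * L ^ 2) := ⟨_, rfl⟩
  have hB0 : 0 < B := by rw [hB]; positivity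
  obtain ⟨b, hb⟩ := exists_nat_ge (max (6 * (1 + B)) (3456 * L ^ 4 * B))
  have hb1 : 6 * (1 + B) ≤ b := (le_max_left _ _).trans hb
  have hb0 : b ≠ 0 := by
    rintro rfl
    simp only [Nat.cast_zero] at hb1
    linarith
  obtain ⟨C₃, hC₃, hmain⟩ := hE B b hB0 hb1 ((le_max_right _ _).trans hb)
  -- the power of the height which is added to keep the maximum of the test function where the
  -- height is at most `2 t`
  obtain ⟨j, hj⟩ := pow_unbounded_of_one_lt (Real.exp B / a) one_lt_two
  obtain ⟨b', rfl⟩ := Nat.exists_eq_succ_of_ne_zero hb0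
  have hea : 0 < Real.exp B / a := by positivity
  set C₄ := 2 ^ (b' + 1) * (C₃ * (3 / 2) ^ b' * (Real.exp B / a)) with hC₄
  have hC₄0 : 0 < C₄ := by positivity
  have hn0 : 0 < n := by omega
  refine ⟨n * p * (C₄ * L ^ (2 * b' + 1 + j)), 2 * (b' + 1) + j, by positivity, by omega,
    fun Ω f u h x₁ hx₁ => ?_⟩
  have hpos := h.curvatureProd_pos hm
  have hneg : ∀ x ∈ Ω, u x < 0 := fun x hx =>
    neg_of_curvatureProd_pos h.domain h.continuousOn h.boundary h.contDiffAt hpn h.admissible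
      hpos hx
  refine ⟨hneg x₁ hx₁, ?_⟩
  obtain ⟨ε, hε⟩ : ∃ ε, ε = -u x₁ := ⟨_, rfl⟩
  have hε0 : 0 < ε := by linarith [hneg x₁ hx₁]
  have haΩ : ∀ x ∈ Ω, a ≤ (areaFactor u x)⁻¹ - a := fun x hx => by
    rw [ha]
    exact h.inv_areaFactor_ge hx
  obtain ⟨κ, O, hF⟩ := exists_isPrincipalFrame (u := u) (x := x₁)
    ((h.contDiffAt x₁ hx₁).isSymmSndFDerivAt (by norm_num))
  have hκ : ∀ I ∈ pSets n p, 0 < ∑ i ∈ I, κ i := fun I hI =>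
    hF.sum_pos (h.admissible x₁ hx₁) (hpos x₁ hx₁) hI
  have : Nonempty (Fin n) := ⟨⟨0, hn0⟩⟩
  obtain ⟨o, -, ho⟩ := Finset.exists_max_image Finset.univ κ Finset.univ_nonempty
  have ho' : ∀ i, κ i ≤ κ o := fun i => ho i (Finset.mem_univ i)
  have hκo : 0 < κ o := by
    obtain ⟨I, hI, -⟩ := exists_mem_pSets hp hpn o
    by_contra! hcon
    have := Finset.sum_nonpos fun i (_ : i ∈ I) => (ho' i).trans hcon
    linarith [hκ I hI]
  -- the reference point: a maximum of the curvature weighted with a high power of the height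
  set S : Set (Eucl n × Eucl n) := (closure Ω ∩ u ⁻¹' Set.Iic (-ε)) ×ˢ Metric.sphere 0 1 with hS
  have hScomp : IsCompact S :=
    (isCompact_height_ge h.domain h.continuousOn _).prod (isCompact_sphere _ _)
  have hSΩ : ∀ z ∈ S, z.1 ∈ Ω ∧ ε ≤ -u z.1 ∧ ‖z.2‖ = 1 := by
    rintro ⟨y, e⟩ ⟨h1, h2⟩
    refine ⟨mem_of_height_ge h.boundary hε0 h1, ?_, by simpa using h2⟩
    have : u y ≤ -ε := h1.2
    linarith
  have hScont : ContinuousOn (fun z : Eucl n × Eucl n =>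
      normalCurv u z.1 z.2 * (-u z.1) ^ (2 * (b' + 1) + j)) S := by
    intro z hz
    obtain ⟨h1, -, h3⟩ := hSΩ z hz
    refine ContinuousAt.continuousWithinAt ?_
    have h4 : ContinuousAt (fun z : Eucl n × Eucl n => u z.1) z :=
      (h.contDiffAt _ h1).continuousAt.comp' continuousAt_fst
    exact (continuousAt_normalCurv (h.contDiffAt _ h1) fun h => by simp [h] at h3).mul
      (h4.neg.pow _)
  set e₁ : Eucl n := untilt (gradient u x₁) (O (basisVec o)) with he₁
  have he₁h : hForm u x₁ e₁ e₁ = κ o := by rw [he₁, hF]; simp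
  have he₁g : gForm u x₁ e₁ e₁ = 1 := by
    rw [he₁, gForm_untilt, LinearIsometryEquiv.inner_map_map]
    simp
  have he₁0 : ‖e₁‖ ≠ 0 := fun h0 => by
    rw [norm_eq_zero] at h0
    simp [h0, gForm] at he₁g
  have hS1 : (x₁, ‖e₁‖⁻¹ • e₁) ∈ S := by
    refine ⟨⟨subset_closure hx₁, ?_⟩, ?_⟩
    · show u x₁ ≤ -ε
      linarith
    · simp [norm_smul, he₁0]
  obtain ⟨⟨x₀, e₀⟩, hz, hzmax⟩ := hScomp.exists_isMaxOn ⟨_, hS1⟩ hScont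
  obtain ⟨hx₀, hx₀ε, he₀⟩ := hSΩ _ hz
  dsimp only at hx₀ hx₀ε he₀
  obtain ⟨t, ht⟩ : ∃ t, -u x₀ = t := ⟨_, rfl⟩
  rw [ht] at hx₀ε
  have ht0 : 0 < t := hε0.trans_le hx₀ε
  have hle : ∀ y ∈ Ω, ε ≤ -u y → ∀ e, ‖e‖ = 1 → normalCurv u y e * (-u y) ^ (2 * (b' + 1) + j)
      ≤ normalCurv u x₀ e₀ * t ^ (2 * (b' + 1) + j) := fun y hy hyε e he => by
    have hyS : (y, e) ∈ S := ⟨⟨subset_closure hy, show u y ≤ -ε by linarith⟩, by simpa using he⟩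
    rw [← ht]
    exact isMaxOn_iff.1 hzmax _ hyS
  have h1 : κ o * ε ^ (2 * (b' + 1) + j) ≤ normalCurv u x₀ e₀ * t ^ (2 * (b' + 1) + j) := by
    have := hle x₁ hx₁ hε.le (‖e₁‖⁻¹ • e₁) (by simp [norm_smul, he₁0])
    rwa [normalCurv_smul u x₁ e₁ (inv_ne_zero he₁0), normalCurv, he₁h, he₁g, div_one,
      ← hε] at this
  have hR : 0 < normalCurv u x₀ e₀ := by
    have : 0 < normalCurv u x₀ e₀ * t ^ (2 * (b' + 1) + j) :=
      lt_of_lt_of_le (by positivity) h1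
    exact (mul_pos_iff_of_pos_right (by positivity)).1 this
  obtain ⟨x, hx, x', hx', O', q, κ', o', htest, hxt, hψ0, hψt, hbound⟩ := exists_isTestMax hn0
    h.domain h.continuousOn h.boundary h.contDiffAt hneg hL h.gradient_le ha0 haΩ hB0
    (Nat.succ_ne_zero b') hj hx₀ he₀ hR ht fun y hy hyt e he => hle y hy (by linarith) e he
  have hη0 := htest.height_pos
  have hηt : -u x - t / 2 ≤ 3 / 2 * t := by linarith
  have hfinal := hmain u f t (t / (16 * L ^ 2)) x x' O' q κ' o' htest
    (by
      have h2 : -(96 * L ^ 2) ≤ 3 / (t / (16 * L ^ 2)) * supKernel u (t / (16 * L ^ 2)) x x' := by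
        have h3 := mul_le_mul_of_nonneg_left hψt
          (by positivity : 0 ≤ 3 / (t / (16 * L ^ 2)))
        refine le_trans (le_of_eq ?_) h3
        field_simp
        norm_num
      refine le_trans ?_ (mul_le_mul_of_nonneg_left (Real.exp_le_exp.2 h2) hB0.le)
      rw [hB, mul_assoc, ← Real.exp_add]
      simp)
    hψ0 (by rw [norm_gradient]; exact h.gradient_le x hx)
    (by rw [norm_gradient]; exact h.gradient_le x' hx') (haΩ x hx)
    (by
      refine hηt.trans (le_of_eq ?_)
      field_simp
      norm_num)
    (by linarith [(abs_le.1 (h.height_le x hx)).1])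
    (by
      filter_upwards [h.domain.isOpen.mem_nhds hx] with y hy
      exact ⟨h.admissible y hy, hpos y hy⟩)
    (h.admissible x' hx')
    (by rw [h.equation x' hx']; exact h.rhs_ge x' hx')
    (by rw [h.equation x hx]; exact h.rhs_le x hx)
    (h.rhs_contDiffAt x hx) (h.rhs_ge x hx) (h.rhs_fderiv x hx) (h.rhs_fderiv2 x hx)
    (h.dichotomy.imp
      (fun h2 => ⟨h2, by
        filter_upwards [h.domain.isOpen.mem_nhds hx] with y hy
        exact h.equation y hy⟩)
      (fun h2 => by
        filter_upwards [h.domain.isOpen.mem_nhds hx] with y hy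
        rw [h.equation y hy]
        exact h2 x hx y hy))
  have h2 : normalCurv u x₀ e₀ * t ≤ C₄ := by
    have h3 : κ' o' * (-u x - t / 2) ^ (b' + 1) ≤ C₃ * (3 / 2 * t) ^ b' := by
      have : κ' o' * (-u x - t / 2) ^ (b' + 1)
        = κ' o' * (-u x - t / 2) * (-u x - t / 2) ^ b' := by ring
      rw [this]
      exact mul_le_mul hfinal (pow_le_pow_left₀ hη0.le hηt b') (by positivity) hC₃.le
    have h4 := hbound.trans (mul_le_mul_of_nonneg_right h3 hea.le)
    have h5 : normalCurv u x₀ e₀ * (t / 2) ^ (b' + 1)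
        = normalCurv u x₀ e₀ * t * (t ^ b' / 2 ^ (b' + 1)) := by
      rw [div_pow]
      ring
    have h6 : C₃ * (3 / 2 * t) ^ b' * (Real.exp B / a) = C₄ * (t ^ b' / 2 ^ (b' + 1)) := by
      rw [hC₄, mul_pow]
      field_simp
    rw [h5, h6] at h4
    exact le_of_mul_le_mul_right h4 (by positivity)
  have htL : t ≤ L := by
    have := (abs_le.1 (h.height_le x₀ hx₀)).1
    linarith
  have h3 : κ o * ε ^ (2 * (b' + 1) + j) ≤ C₄ * L ^ (2 * b' + 1 + j) := by
    refine h1.trans ?_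
    have : normalCurv u x₀ e₀ * t ^ (2 * (b' + 1) + j)
      = normalCurv u x₀ e₀ * t * t ^ (2 * b' + 1 + j) := by ring
    rw [this]
    exact mul_le_mul h2 (pow_le_pow_left₀ ht0.le htL _) (by positivity) hC₄0.le
  have h4 : secondFormNorm u x₁ ≤ n * p * κ o := by
    rw [hF.curvatures.2]
    refine (Real.sqrt_le_left (by positivity)).2 ?_
    have h5 : ∀ i ∈ Finset.univ, κ i ^ 2 ≤ (p * κ o) ^ 2 := fun i _ => by
      rw [← sq_abs]
      exact pow_le_pow_left₀ (abs_nonneg _) (abs_le_mul_top hκ hp hpn ho' hκo i) 2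
    refine (Finset.sum_le_card_nsmul _ _ _ h5).trans ?_
    rw [nsmul_eq_mul, Finset.card_univ, Fintype.card_fin, mul_assoc, mul_pow _ ((p : ℝ) * κ o)]
    refine mul_le_mul_of_nonneg_right ?_ (sq_nonneg _)
    exact_mod_cast Nat.le_self_pow two_ne_zero n
  rw [← hε]
  calc ε ^ (2 * (b' + 1) + j) * secondFormNorm u x₁
      ≤ ε ^ (2 * (b' + 1) + j) * (n * p * κ o) := mul_le_mul_of_nonneg_left h4 (by positivity)
    _ = n * p * (κ o * ε ^ (2 * (b' + 1) + j)) := by ring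
    _ ≤ n * p * (C₄ * L ^ (2 * b' + 1 + j)) := mul_le_mul_of_nonneg_left h3 (by positivity)

end GraphSurface

end

theorem theorem1p2 (n p : ℕ) (hp : 1 ≤ p) (hpn : p ≤ n)
    (M c₀ Λ : ℝ) (hc₀ : 0 < c₀) :
    ∃ C β : ℝ, 0 < C ∧ 0 < β ∧
      ∀ (Ω : Set (Eucl n)) (f : RhsSpace n → ℝ) (u : Eucl n → ℝ),
        IsBoundedDomain Ω →
        -- the right-hand side: smooth and positive
        ContDiffOn ℝ ∞ f (Ω ×ˢ (Set.univ ×ˢ {ν | ν ≠ 0})) →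
        (∀ x ∈ Ω, ∀ z : ℝ, ∀ ν ∈ unitSphere n, 0 < f (x, z, ν)) →
        -- `p ≥ n / 2`, or `f` does not depend on `ν`
        (n ≤ 2 * p ∨
          ∀ x ∈ Ω, ∀ z : ℝ, ∀ ν ∈ unitSphere n, ∀ ν' ∈ unitSphere n,
            f (x, z, ν) = f (x, z, ν')) →
        -- the solution
        ContDiffOn ℝ 4 u Ω →
        IsCkUpToBoundary 2 u Ω →
        GraphSurface.IsAdmissible p u Ω →
        (∀ x ∈ Ω, GraphSurface.curvatureProd p u x = f (x, u x, GraphSurface.normal u x)) →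
        (∀ x ∈ frontier Ω, u x = 0) →
        -- the bounds on which the constants depend
        CkNormLE 1 u Ω M →
        (∀ y ∈ rhsRange Ω M, c₀ ≤ f y ^ (1 / (n.choose p : ℝ))) →
        CkNormLE 2 f (rhsRange Ω M) Λ →
        ∀ x ∈ Ω, u x < 0 ∧ (-u x) ^ β * GraphSurface.secondFormNorm u x ≤ C := by
  obtain ⟨C, N, hC, hN, hmain⟩ := GraphSurface.exists_curvature_bound hp hpn
    (le_max_left 1 M) (pow_pos hc₀ (n.choose p)) (le_max_left 1 Λ)
  refine ⟨C, N, hC, by exact_mod_cast hN, fun Ω f u hΩ hf hfpos halt hu hu2 hadm heq h0 hu1 hf0 hf2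
    x hx => ?_⟩
  have hsphere : ∀ y, GraphSurface.normal u y ∈ unitSphere n := fun y => by
    simp [unitSphere, GraphSurface.norm_normal]
  have hrange : ∀ y ∈ Ω, (y, u y, GraphSurface.normal u y) ∈ rhsRange Ω M := fun y hy => by
    refine ⟨hy, ?_, hsphere y⟩
    have := hu1 0 (by norm_num) y hy
    rw [norm_iteratedFDeriv_zero, Real.norm_eq_abs] at this
    exact abs_le.1 this
  have hN0 : n.choose p ≠ 0 := (Nat.choose_pos hpn).ne'
  have hsol : GraphSurface.IsBoundedSolution p Ω f u (max 1 M) (c₀ ^ n.choose p) (max 1 Λ) :=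
    { domain := hΩ
      contDiffAt := fun y hy => hu.contDiffAt (hΩ.isOpen.mem_nhds hy)
      continuousOn := hu2.continuousOn
      boundary := h0
      admissible := hadm
      equation := heq
      height_le := fun y hy => by
        have := hu1 0 (by norm_num) y hy
        rw [norm_iteratedFDeriv_zero, Real.norm_eq_abs] at this
        exact this.trans (le_max_right _ _)
      gradient_le := fun y hy => by
        have := hu1 1 le_rfl y hy
        rw [norm_iteratedFDeriv_one] at this
        exact this.trans (le_max_right _ _)
      rhs_contDiffAt := fun y hy => by
        refine (hf.contDiffAt ?_).of_le (by norm_cast)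
        refine (hΩ.isOpen.prod (isOpen_univ.prod isOpen_ne)).mem_nhds ⟨hy, trivial, fun h => ?_⟩
        have := GraphSurface.norm_normal u y
        rw [show GraphSurface.normal u y = 0 from h, norm_zero] at this
        exact zero_ne_one this
      rhs_ge := fun y hy => by
        have h1 := pow_le_pow_left₀ hc₀.le (hf0 _ (hrange y hy)) (n.choose p)
        rwa [one_div, Real.rpow_inv_natCast_pow (hfpos y hy _ _ (hsphere y)).le hN0] at h1
      rhs_le := fun y hy => by
        have := hf2 0 (by norm_num) _ (hrange y hy)
        rw [norm_iteratedFDeriv_zero, Real.norm_eq_abs] at this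
        exact ((le_abs_self _).trans this).trans (le_max_right _ _)
      rhs_fderiv := fun y hy => by
        have := hf2 1 (by norm_num) _ (hrange y hy)
        rw [norm_iteratedFDeriv_one] at this
        exact this.trans (le_max_right _ _)
      rhs_fderiv2 := fun y hy => by
        have := hf2 2 le_rfl _ (hrange y hy)
        rw [← norm_iteratedFDeriv_fderiv, norm_iteratedFDeriv_one] at this
        exact this.trans (le_max_right _ _)
      dichotomy := halt.imp_right fun h y _ z hz => h z hz _ _ (hsphere z) _ (hsphere y) }
  obtain ⟨h1, h2⟩ := hmain Ω f u hsol x hx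
  exact ⟨h1, by rwa [Real.rpow_natCast]⟩
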